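/- For $m,n\ge 0$ let $ILP(A,b,w)$ be the covering integer program $\min\{w^{T}x : Ax\ge b,\ x\in\mathbb N^n\}$, where $A\in\mathbb R_{\ge0}^{m\times n}$, $b\in\mathbb R_{\ge 0}^m$, $w\in\mathbb R_{\ge 0}^n$. Let $f=f(A)$ and $\Delta=\Delta(A)$ be the maximum number of nonzero entries in a row, respectively a column, of $A$, and let $M=\max\{1,\max_{i,j:\,A_{i,j}\ne0} b_i/A_{i,j}\}$. The communication network is the bipartite graph with a variable node $x_j$ for every column, a constraint node $c_i$ for every row, and a link $\{x_j,c_i\}$ whenever $A_{i,j}\neq 0$. Initially $x_j$ knows $w_j$ and the $j$-th column of $A$, $c_i$ knows $b_i$ and its links, and every node knows its own name and $n,m,f,\varepsilon$. Computation is in the (deterministic) CONGEST model: synchronous rounds, in which neighbours exchange messages of $O(\log (n+m))$ bits and local computation is free. The entries of $A,b,w$ are assumed to be rationals whose numerators and denominators have $O(\log(n+m))$ bits. All logarithms are to base $2$. For a constant $\gamma>0$ let $$T_\gamma(f,\Delta,\varepsilon)= f\log\frac f\varepsilon+\frac{\log\Delta}{\log\log\Delta}+\min\Big\{\log\Delta,\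 f\log\frac f\varepsilon\,(\log\Delta)^{\gamma}\Big\}$$ (with $T_\gamma(0,\Delta,\varepsilon)=\log\Delta/\log\log\Delta$) be the bound on the round complexity of the primal-dual CONGEST algorithm MWHVC for $(f+\varepsilon)$-approximate minimum weight vertex cover in hypergraphs of rank $f$ and maximum degree $\Delta$. Here, and in the bound below, a degree $\Delta<3$ is replaced by $3$, and $\log n$ is replaced by $1$ if $n\le 1$. Claim. For every $\gamma>0$ there is a deterministic distributed CONGEST algorithm that, for every $\varepsilon\in(0,1]$ and every feasible covering program $ILP(A,b,w)$ as above, computes a feasible integral solution $x$ of cost at most $(f(A)+\varepsilon)$ times the integral optimum (each node $x_j$ outputs its value and all nodes halt), within $$O\Big(\big(1+\tfrac{f(A)}{\log n}\big)\cdot T_\gamma\big(f(A)\cdot(1+\log M),\ 2^{f(A)}\cdot M\cdot\Delta(A),\ \varepsilon\big)\Big)$$ rounds. If $\gamma\le 0.001$, then the number of rounds of the same algorithm is also $$O\Big(\big(1+\tfrac{f}{\log n}\big)\Big(\frac{\log\Delta}{\log\log\Delta}+\big(f\,(1+\log M)\big)^{1.01}\,(1+\log\varepsilon^{-1})\,(\log\Delta)^{0.01}\Big)\Big).$$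 The constants hidden in the $O$-terms (message size and rounds) depend only on $\gamma$ and on the constant in the bound on the input size. -/

import Mathlib

noncomputable section

/-- A covering integer linear program with `m` constraints and `n` variables:
minimise `wᵀ x` subject to `A x ≥ b`, `x ∈ ℕⁿ`, all data being non-negative. -/
structure CoveringILP (m n : ℕ) where
  A : Matrix (Fin m) (Fin n) ℝ
  b : Fin m → ℝ
  w : Fin n → ℝ
  A_nonneg : ∀ i j, 0 ≤ A i j
  b_nonneg : ∀ i, 0 ≤ b i
  w_nonneg : ∀ j, 0 ≤ w j

/-- `x` is a non-negative rational whose numerator and denominator have at most `k` bits each. -/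
def IsShort (k : ℕ) (x : ℝ) : Prop :=
  ∃ p q : ℕ, p < 2 ^ k ∧ 0 < q ∧ q < 2 ^ k ∧ x = (p : ℝ) / (q : ℝ)

namespace CoveringILP

variable {m n : ℕ}

/-- `x` is an integral feasible solution. -/
def Feasible (P : CoveringILP m n) (x : Fin n → ℕ) : Prop :=
  ∀ i, P.b i ≤ ∑ j, P.A i j * (x j : ℝ)

def cost (P : CoveringILP m n) (x : Fin n → ℕ) : ℝ :=
  ∑ j, P.w j * (x j : ℝ)

/-- `x` is a feasible integral solution of cost at most `ρ` times the integral optimum. -/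
def IsApprox (P : CoveringILP m n) (ρ : ℝ) (x : Fin n → ℕ) : Prop :=
  P.Feasible x ∧ ∀ y : Fin n → ℕ, P.Feasible y → P.cost x ≤ ρ * P.cost y

/-- `f(A)`: the maximum number of nonzero entries in a row of `A`. -/
def rank (P : CoveringILP m n) : ℕ :=
  Finset.univ.sup fun i : Fin m => Set.ncard {j : Fin n | P.A i j ≠ 0}

/-- `Δ(A)`: the maximum number of nonzero entries in a column of `A`. -/
def maxDegree (P : CoveringILP m n) : ℕ :=
  Finset.univ.sup fun j : Fin n => Set.ncard {i : Fin m | P.A i j ≠ 0}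

/-- `M = max {1, max {b_i / A_{i,j} : A_{i,j} ≠ 0}}`. -/
def maxRatio (P : CoveringILP m n) : ℝ :=
  max 1 (sSup {r : ℝ | ∃ i j, P.A i j ≠ 0 ∧ r = P.b i / P.A i j})

/-- Every number of the input is represented by (twice) at most `k` bits. -/
def InputShort (P : CoveringILP m n) (k : ℕ) : Prop :=
  (∀ i j, IsShort k (P.A i j)) ∧ (∀ i, IsShort k (P.b i)) ∧ ∀ j, IsShort k (P.w j)

/-- The communication network: variable nodes `Sum.inl j`, constraint nodes `Sum.inr i`, and a
link between `x_j` and `c_i` iff `A_{i,j} ≠ 0`. -/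
def network (P : CoveringILP m n) : SimpleGraph (Fin n ⊕ Fin m) :=
  SimpleGraph.fromRel fun u v =>
    ∃ (j : Fin n) (i : Fin m), u = Sum.inl j ∧ v = Sum.inr i ∧ P.A i j ≠ 0

end CoveringILP

/-- Bit strings of length at most `bw`. -/
abbrev Message (bw : ℕ) : Type := {l : List Bool // l.length ≤ bw}

/-- A deterministic synchronous message-passing program for the `n + m` nodes of the network of a
covering ILP, in which a message has at most `bw` bits. A variable node knows its name, its weight
and its column; a constraint node knows its name, its right-hand side and its links. Local
computation is free. A node halts when its state has an output. -/
structure CongestAlg (n m bw : ℕ) where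
  State : Type
  initVar : Fin n → ℝ → (Fin m → ℝ) → State
  initCon : Fin m → ℝ → Set (Fin n) → State
  /-- the message (if any) that is sent to a given neighbour -/
  send : State → Fin n ⊕ Fin m → Option (Message bw)
  /-- the new state, from the old one and the messages received -/
  recv : State → (Fin n ⊕ Fin m → Option (Message bw)) → State
  output : State → Option ℕ

namespace CongestAlg

variable {n m bw : ℕ}

def init (alg : CongestAlg n m bw) (P : CoveringILP m n) : Fin n ⊕ Fin m → alg.State
  | Sum.inl j => alg.initVar j (P.w j) fun i => P.A i j
  | Sum.inr i => alg.initCon i (P.b i) {j | P.A i j ≠ 0}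

open Classical in
/-- One synchronous round. Nodes that have halted keep their state and send nothing. -/
def round (alg : CongestAlg n m bw) (P : CoveringILP m n) (s : Fin n ⊕ Fin m → alg.State) :
    Fin n ⊕ Fin m → alg.State := fun v =>
  if (alg.output (s v)).isSome then s v
  else alg.recv (s v) fun u =>
    if P.network.Adj u v ∧ (alg.output (s u)).isNone then alg.send (s u) v else none

/-- The states of all nodes after `t` rounds. -/
def run (alg : CongestAlg n m bw) (P : CoveringILP m n) : ℕ → Fin n ⊕ Fin m → alg.State
  | 0 => alg.init P
  | t + 1 => alg.round P (alg.run P t)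

/-- After `t` rounds all nodes have halted, and the variable nodes have output `x`. -/
def HaltsWith (alg : CongestAlg n m bw) (P : CoveringILP m n) (t : ℕ) (x : Fin n → ℕ) : Prop :=
  (∀ v, (alg.output (alg.run P t v)).isSome) ∧
    ∀ j, alg.output (alg.run P t (Sum.inl j)) = some (x j)

end CongestAlg

/-- The round complexity
`T(f, Δ, ε) = f log (f/ε) + log Δ / log log Δ + min {log Δ, f log (f/ε) (log Δ)^γ}`
of the primal-dual algorithm for minimum weight vertex cover in hypergraphs of rank `f` and maximum
degree `Δ`, with parameter `γ`; degrees are taken to be at least `3`, so that `log log Δ > 0`. -/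
def mwhvcTime (γ f Δ ε : ℝ) : ℝ :=
  f * Real.logb 2 (f / ε)
    + Real.logb 2 (max 3 Δ) / Real.logb 2 (Real.logb 2 (max 3 Δ))
    + min (Real.logb 2 (max 3 Δ)) (f * Real.logb 2 (f / ε) * Real.logb 2 (max 3 Δ) ^ γ)

/-- The simplified bound
`log Δ / log log Δ + (f (1 + log M))^1.01 (1 + log ε⁻¹) (log Δ)^0.01`, again with `Δ ≥ 3`. -/
def simplifiedTime (f Δ M ε : ℝ) : ℝ :=
  Real.logb 2 (max 3 Δ) / Real.logb 2 (Real.logb 2 (max 3 Δ))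
    + (f * (1 + Real.logb 2 M)) ^ (1.01 : ℝ) * (1 + Real.logb 2 ε⁻¹)
      * Real.logb 2 (max 3 Δ) ^ (0.01 : ℝ)

end

/-! The bounds come from a primal-dual auction that runs on the covering program itself, without a
reduction to vertex cover. Let `x` be the current values and let constraint `i` have residual `ρ >
0`. At each variable `j` of its row the constraint has a scale `k`, about `log (ρ / (F * A i j))`,
and a target, the least multiple of `2 ^ k` above `x j`. An integral vector that stays below all
targets of row `i` gains less than `ρ` there, so every feasible `y` reaches one of them
(`Fits.exists_target_le`). Hence the constraint may repeatedly pay one and the same bid `2 ^ e` at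
all its targets. If the payments `C j T` at targets up to `T` never exceed `w j * T`, the sum of all
bids is at most the cost of any feasible `y` (`Fits.totalPaid_le`). After a payment `x j` moves up
to the largest `T` with `(1 - β) * w j * T ≤ C j T`. A bid is paid at most `F` times, so `(1 - β) *
cost x ≤ F * cost y` (`Fits.cost_le`), and `β = ε / (F + ε)` gives the factor `F + ε`.

The bound on `C` is protected by `VarView.Inv`: at every scale the bids together take at most a
quarter of the slack. A bid is raised by `2 ^ a` only if no variable of the row finds this
dangerous; it is cut when a slack has become small and when the constraint moves to smaller scales
(`VarView.Inv.update`).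

For the running time, the slack at a target lies between `β` times the capacity `w * target` and the
capacity, so its logarithmic `depth` lies between `0` and `Z ≈ log (1 / β)`. An iteration in which a
constraint is stuck deepens some relevant place by at least about `2 ^ (-a)`, or moves a target (a
renewal). Relevant renewals number `O(F (1 + log M))`, because they are paid for by the relative
decrease of the residual, which telescopes in a logarithm (`Fits.sum_sum_renewal_le`). With `G = Z F
(1 + log M)` up to constants, `Fits.accounting` yields that the exponents of all raises sum to
`O(log M + log Δ + G)` and the weights `2 ^ (-a)` of all stuck iterations to `O(G)`.

The schedule `raiseExp` alternates `a = 1` with `a ≈ γ log t`. The even iterations give `O(log (MΔ)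
+ G)`; the odd ones divide the first sum by a logarithm at the price of a factor `t ^ γ` on the
second. `exists_iterations_le` combines both into the claimed bound, and the schedule needs to know
neither `Δ` nor `M`.

Finally, `Fits.run_eq_nodesA` shows that four rounds simulate one iteration. Only exponents, scales
and capped values are sent. Their length is logarithmic because a tolerance that is too small is
replaced by one for which integrality of the scaled costs already gives the guarantee
(`InputShort.cost_le`). -/

noncomputable section

open scoped Classical

/-! ### Dyadic targets -/

/-- The least multiple of `2 ^ k` that is larger than `x`. -/
def target (k x : ℕ) : ℕ := (x / 2 ^ k + 1) * 2 ^ k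

theorem lt_target (k x : ℕ) : x < target k x := by
  unfold target
  have := Nat.lt_div_mul_add (a := x) (b := 2 ^ k) (by positivity)
  nlinarith

theorem target_le (k x : ℕ) : target k x ≤ x + 2 ^ k := by
  unfold target
  have := Nat.div_mul_le_self x (2 ^ k)
  nlinarith

theorem target_le_of_dvd {k x T : ℕ} (h : 2 ^ k ∣ T) (hx : x < T) : target k x ≤ T := by
  obtain ⟨c, rfl⟩ := h
  unfold target
  have : x / 2 ^ k < c := Nat.div_lt_of_lt_mul hx
  rw [mul_comm]
  exact Nat.mul_le_mul_left _ this

theorem dvd_target (k x : ℕ) : 2 ^ k ∣ target k x := Dvd.intro_left _ rfl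

theorem target_mono_left {k l : ℕ} (h : k ≤ l) (x : ℕ) : target k x ≤ target l x :=
  target_le_of_dvd ((pow_dvd_pow 2 h).trans (dvd_target l x)) (lt_target l x)

theorem target_mono_right (k : ℕ) {x y : ℕ} (h : x ≤ y) : target k x ≤ target k y :=
  target_le_of_dvd (dvd_target k y) (h.trans_lt (lt_target k y))

theorem target_eq_of_lt {k x y : ℕ} (h : x ≤ y) (hy : y < target k x) :
    target k y = target k x :=
  le_antisymm (target_le_of_dvd (dvd_target k x) hy) (target_mono_right k h)

theorem target_le_pow_mul {k l : ℕ} (h : k ≤ l) (x : ℕ) :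
    target l x ≤ 2 ^ (l - k) * target k x := by
  apply target_le_of_dvd
  · obtain ⟨c, hc⟩ := dvd_target k x
    rw [hc, ← mul_assoc, ← pow_add, Nat.sub_add_cancel h]
    exact Dvd.intro _ rfl
  · exact (lt_target k x).trans_le (Nat.le_mul_of_pos_left _ (by positivity))

theorem target_eq_iff_div_eq {k x y : ℕ} : target k x = target k y ↔ x / 2 ^ k = y / 2 ^ k := by
  unfold target
  have h : 0 < 2 ^ k := by positivity
  rw [Nat.mul_left_inj h.ne']
  omega

/-! ### The local view of a variable and its invariant -/

/-- What a variable node knows: its weight, its value `x`, the cumulative load `C T` of all bids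
that were paid to it with a target at most `T`, the largest relevant scale, the set of adjacent
constraints that are still active, and the bid exponents and scales of these constraints. -/
structure VarView (m : ℕ) where
  w : ℝ
  x : ℕ
  C : ℕ → ℝ
  top : ℕ
  act : Finset (Fin m)
  e : Fin m → ℤ
  k : Fin m → ℕ

namespace VarView

variable {m : ℕ}

def slack (V : VarView m) (k : ℕ) : ℝ := V.w * target k V.x - V.C (target k V.x)

/-- Smaller scales count as well: targets are monotone in the scale, so those bids also burden `C`
at the target of scale `k`. -/
def load (V : VarView m) (k : ℕ) : ℝ := ∑ i ∈ V.act with V.k i ≤ k, (2 : ℝ) ^ V.e i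

/-- Constraint `i` may not multiply its bid by `2 ^ a`. -/
def Stuck (V : VarView m) (a : ℕ) (i : Fin m) : Prop :=
  ∃ k, V.k i ≤ k ∧ k ≤ V.top ∧ V.slack k < 8 * 2 ^ a * V.load k

def raise (V : VarView m) (a : ℕ) (r : Fin m → Prop) : VarView m :=
  { V with e := fun i => if i ∈ V.act ∧ r i then V.e i + a else V.e i }

/-- The cumulative load after all active constraints have paid their bids. -/
def paid (V : VarView m) (T : ℕ) : ℝ :=
  V.C T + ∑ i ∈ V.act with target (V.k i) V.x ≤ T, (2 : ℝ) ^ V.e i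

/-- For weight zero and nonnegative payments the set is all of `ℕ`, its `sSup` is the default `0`,
and the maximum keeps `x` unchanged. -/
def fill (V : VarView m) (β : ℝ) : VarView m :=
  { V with
    C := V.paid
    x := max V.x (sSup {T : ℕ | (1 - β) * V.w * T ≤ V.paid T}) }

/-- The number of halvings that scale `k` asks for. -/
def cut (V : VarView m) (Z k : ℕ) : ℕ := min (Z + 1) (Nat.clog 2 ⌈8 * V.load k / V.slack k⌉₊)

/-- A bid is part of the load of every scale from its own up to `top`, so it has to obey the demand
of each of them. -/
def maxCut (V : VarView m) (Z : ℕ) (i : Fin m) : ℕ :=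
  (Finset.Icc (V.k i) V.top).sup fun k => V.cut Z k

/-- By `flat`, beyond `x` the step function `C` jumps only at current targets, so control of the
slack at the targets controls `C` everywhere. `safe` makes the next payment harmless, `unsat` keeps
a fraction `β` of every capacity beyond `x` free, and `sat` is what the cost bound uses. -/
structure Inv (V : VarView m) (β : ℝ) : Prop where
  w_nonneg : 0 ≤ V.w
  C_mono : Monotone V.C
  C_nonneg : ∀ T, 0 ≤ V.C T
  C_le : ∀ T, V.C T ≤ V.w * T
  flat : ∀ T₁ T₂, T₁ ≤ T₂ → V.x ≤ T₁ →
    (∀ k ≤ V.top, ¬(T₁ < target k V.x ∧ target k V.x ≤ T₂)) → V.C T₁ = V.C T₂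
  safe : ∀ k ≤ V.top, 4 * V.load k ≤ V.slack k
  unsat : 0 < V.w → ∀ T, V.x < T → V.C T < (1 - β) * V.w * T
  sat : (1 - β) * V.w * V.x ≤ V.C V.x
  k_le : ∀ i ∈ V.act, V.k i ≤ V.top
  w_pos : V.act.Nonempty → 0 < V.w

variable {V : VarView m} {β : ℝ} {a Z : ℕ} {r : Fin m → Prop}

theorem load_nonneg (V : VarView m) (k : ℕ) : 0 ≤ V.load k :=
  Finset.sum_nonneg fun _ _ => by positivity

theorem le_load {i : Fin m} (hi : i ∈ V.act) {k : ℕ} (hk : V.k i ≤ k) :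
    (2 : ℝ) ^ V.e i ≤ V.load k :=
  Finset.single_le_sum (f := fun i => (2 : ℝ) ^ V.e i) (fun _ _ => by positivity)
    (Finset.mem_filter.2 ⟨hi, hk⟩)

theorem Inv.slack_le (h : V.Inv β) (k : ℕ) : V.slack k ≤ V.w * target k V.x := by
  have := h.C_nonneg (target k V.x)
  unfold slack; linarith

theorem Inv.lt_slack (h : V.Inv β) (hw : 0 < V.w) (k : ℕ) :
    β * (V.w * target k V.x) < V.slack k := by
  have := h.unsat hw _ (lt_target k V.x)
  unfold slack; nlinarith

theorem load_raise_ge (V : VarView m) (a : ℕ) (r : Fin m → Prop) (k : ℕ) :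
    V.load k ≤ (V.raise a r).load k := by
  unfold load raise
  apply Finset.sum_le_sum
  intro i _
  dsimp only
  split_ifs
  · exact zpow_le_zpow_right₀ (by norm_num) (by omega)
  · exact le_rfl

/-- Raising the bids of constraints that are not stuck keeps all loads safe. -/
theorem Inv.raise (h : V.Inv β) (hr : ∀ i ∈ V.act, r i → ¬V.Stuck a i) :
    (V.raise a r).Inv β where
  w_nonneg := h.w_nonneg
  C_mono := h.C_mono
  C_nonneg := h.C_nonneg
  C_le := h.C_le
  flat := h.flat
  unsat := h.unsat
  sat := h.sat
  k_le := h.k_le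
  w_pos := h.w_pos
  safe := by
    intro k hk
    change 4 * _ ≤ V.slack k
    -- A single raising constraint of scale at most `k` certifies that the whole load at `k` may
    -- grow by `2 ^ a`, so all of them may raise simultaneously.
    by_cases hex : ∃ i ∈ V.act, V.k i ≤ k ∧ r i
    · obtain ⟨i, hi, hik, hri⟩ := hex
      have hns := hr i hi hri
      simp only [Stuck, not_exists, not_and, not_lt] at hns
      have h1 := hns k hik hk
      have h2 : (V.raise a r).load k ≤ 2 ^ a * V.load k := by
        unfold load
        rw [Finset.mul_sum]
        apply Finset.sum_le_sum
        intro i' _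
        simp only [VarView.raise]
        split_ifs
        · rw [zpow_add₀ (by norm_num), zpow_natCast, mul_comm]
        · exact le_mul_of_one_le_left (by positivity) (one_le_pow₀ (by norm_num))
      have := load_nonneg V k
      nlinarith [load_nonneg (V.raise a r) k]
    · push Not at hex
      have : (V.raise a r).load k = V.load k := by
        unfold load
        apply Finset.sum_congr rfl
        intro i hi
        have hi := Finset.mem_filter.1 hi
        simp only [VarView.raise]
        rw [if_neg (fun hc => hex i hi.1 hi.2 hc.2)]
      rw [this]
      exact h.safe k hk

theorem Inv.paid_sub_le (h : V.Inv β) {k : ℕ} (hk : k ≤ V.top) :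
    V.paid (target k V.x) ≤ V.C (target k V.x) + V.slack k / 4 := by
  -- Different scales can share a target, so constraints of scale above `k` may pay here too. The
  -- largest such scale has the same target, hence the same slack, and its load contains all these
  -- bids.
  set S := insert k ((V.act.filter fun i => target (V.k i) V.x ≤ target k V.x).image V.k) with hS
  have hne : S.Nonempty := ⟨k, Finset.mem_insert_self _ _⟩
  obtain ⟨l, hl, hmax⟩ := S.exists_max_image id hne
  have hl' : k ≤ l ∧ l ≤ V.top ∧ target l V.x = target k V.x := by
    have h0 : k ≤ l := hmax k (Finset.mem_insert_self _ _)
    rw [hS, Finset.mem_insert, Finset.mem_image] at hl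
    rcases hl with rfl | ⟨i, hi, rfl⟩
    · exact ⟨le_rfl, hk, rfl⟩
    · rw [Finset.mem_filter] at hi
      exact ⟨h0, h.k_le i hi.1, le_antisymm hi.2 (target_mono_left h0 _)⟩
  have h1 := h.safe l hl'.2.1
  have h2 : V.slack l = V.slack k := by unfold slack; rw [hl'.2.2]
  have h3 : ∑ i ∈ V.act with target (V.k i) V.x ≤ target k V.x, (2 : ℝ) ^ V.e i ≤ V.load l := by
    apply Finset.sum_le_sum_of_subset_of_nonneg
    · intro i hi
      rw [Finset.mem_filter]
      refine ⟨(Finset.mem_filter.1 hi).1, ?_⟩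
      exact hmax _ (Finset.mem_insert_of_mem (Finset.mem_image_of_mem _ hi))
    · exact fun _ _ _ => by positivity
  unfold paid
  linarith

theorem le_paid (V : VarView m) (T : ℕ) : V.C T ≤ V.paid T :=
  le_add_of_nonneg_right (Finset.sum_nonneg fun _ _ => by positivity)

theorem add_load_le_paid (V : VarView m) (k : ℕ) :
    V.C (target k V.x) + V.load k ≤ V.paid (target k V.x) := by
  unfold paid load
  refine add_le_add le_rfl (Finset.sum_le_sum_of_subset_of_nonneg ?_ fun _ _ _ => by positivity)
  intro i
  simp only [Finset.mem_filter]
  exact fun ⟨h₁, h₂⟩ => ⟨h₁, target_mono_left h₂ _⟩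

theorem Inv.paid_mono (h : V.Inv β) : Monotone V.paid := by
  intro T₁ T₂ hT
  unfold paid
  have := h.C_mono hT
  have h2 : ∑ i ∈ V.act with target (V.k i) V.x ≤ T₁, (2 : ℝ) ^ V.e i ≤
      ∑ i ∈ V.act with target (V.k i) V.x ≤ T₂, (2 : ℝ) ^ V.e i := by
    apply Finset.sum_le_sum_of_subset_of_nonneg
    · intro i
      simp only [Finset.mem_filter]
      exact fun ⟨h₁, h₂⟩ => ⟨h₁, h₂.trans hT⟩
    · exact fun _ _ _ => by positivity
  linarith

theorem Inv.slack_nonneg (h : V.Inv β) (k : ℕ) : 0 ≤ V.slack k := by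
  have := h.C_le (target k V.x)
  unfold slack; linarith

theorem Inv.paid_le (h : V.Inv β) (T : ℕ) : V.paid T ≤ V.w * T := by
  by_cases hex : ∃ k ≤ V.top, target k V.x ≤ T
  · set S := (Finset.range (V.top + 1)).filter fun k => target k V.x ≤ T with hS
    have hne : S.Nonempty := by
      obtain ⟨k, hk, hkT⟩ := hex
      exact ⟨k, by simp [hS, hkT]; omega⟩
    obtain ⟨l, hl, hmax⟩ := S.exists_max_image id hne
    simp only [hS, Finset.mem_filter, Finset.mem_range] at hl hmax
    have hl1 : l ≤ V.top := by omega
    have hC : V.C (target l V.x) = V.C T := by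
      apply h.flat _ _ hl.2 (lt_target l V.x).le
      rintro k hk ⟨h1, h2⟩
      have : k ≤ l := hmax k ⟨by omega, h2⟩
      exact absurd (target_mono_left this V.x) (by omega)
    have hp : V.paid T = V.paid (target l V.x) := by
      unfold paid
      rw [hC]
      congr 1
      apply Finset.sum_congr _ (fun _ _ => rfl)
      apply Finset.filter_congr
      intro i hi
      constructor
      · intro hT
        have hk := h.k_le i hi
        exact target_mono_left (hmax _ ⟨by omega, hT⟩) _
      · exact fun h' => h'.trans hl.2
    rw [hp]
    have h1 := h.paid_sub_le hl1
    have h2 := h.slack_nonneg l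
    have h3 : V.C (target l V.x) + V.slack l = V.w * target l V.x := by unfold slack; ring
    have h4 : V.w * (target l V.x : ℝ) ≤ V.w * T :=
      mul_le_mul_of_nonneg_left (by exact_mod_cast hl.2) h.w_nonneg
    linarith
  · push Not at hex
    have : V.paid T = V.C T := by
      unfold paid
      rw [Finset.filter_false_of_mem, Finset.sum_empty, add_zero]
      intro i hi
      exact not_le.2 (hex _ (h.k_le i hi))
    rw [this]
    exact h.C_le T

/-- `paid` is constant beyond the last target while `(1 - β) * w * T` grows without bound. Thus the
supremum in `fill` is a genuine maximum. -/
theorem Inv.exists_paid_le (h : V.Inv β) (hw : 0 < V.w) (hβ : β < 1) :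
    BddAbove {T : ℕ | (1 - β) * V.w * T ≤ V.paid T} := by
  set B := V.paid (max V.x (target V.top V.x)) with hB
  have hbound : ∀ T, V.paid T ≤ B := by
    intro T
    rcases le_total T (max V.x (target V.top V.x)) with hT | hT
    · exact h.paid_mono hT
    · apply le_of_eq
      rw [hB]
      have hlt := lt_target V.top V.x
      rw [max_eq_right hlt.le] at hT ⊢
      unfold paid
      congr 1
      · symm
        apply h.flat _ _ hT hlt.le
        rintro k hk ⟨h1, _⟩
        exact absurd (target_mono_left hk V.x) (by omega)
      · apply Finset.sum_congr _ (fun _ _ => rfl)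
        apply Finset.filter_congr
        intro i hi
        have := target_mono_left (h.k_le i hi) V.x
        constructor <;> intro <;> omega
  refine ⟨⌈B / ((1 - β) * V.w)⌉₊, fun T hT => ?_⟩
  have hp : 0 < (1 - β) * V.w := mul_pos (by linarith) hw
  have h1 : (T : ℝ) ≤ B / ((1 - β) * V.w) := by
    rw [le_div_iff₀ hp]
    have := hbound T
    simp only [Set.mem_ofPred_eq] at hT
    nlinarith
  exact_mod_cast h1.trans (Nat.le_ceil _)

theorem le_fill_x (V : VarView m) (β : ℝ) : V.x ≤ (V.fill β).x := le_max_left _ _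

theorem fill_slack_le {k : ℕ} (hk : target k (V.fill β).x = target k V.x) :
    (V.fill β).slack k ≤ V.slack k - V.load k := by
  have := add_load_le_paid V k
  unfold slack
  rw [hk]
  change V.w * _ - V.paid _ ≤ _
  linarith

theorem Inv.le_fill_slack (h : V.Inv β) {k : ℕ} (hk : k ≤ V.top)
    (hT : target k (V.fill β).x = target k V.x) :
    3 / 4 * V.slack k ≤ (V.fill β).slack k := by
  have h1 := h.paid_sub_le hk
  have h2 : (V.fill β).slack k = V.w * target k V.x - V.paid (target k V.x) := by
    unfold slack; rw [hT]; rfl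
  have h3 : V.slack k = V.w * target k V.x - V.C (target k V.x) := rfl
  linarith

/-- The part of the invariant that does not concern the bids survives a payment. -/
theorem Inv.fill_aux (h : V.Inv β) (hβ : β < 1) :
    (0 < V.w → ∀ T, (V.fill β).x < T → V.paid T < (1 - β) * V.w * T) ∧
    (1 - β) * V.w * (V.fill β).x ≤ V.paid (V.fill β).x ∧
    (∀ T₁ T₂, T₁ ≤ T₂ → (V.fill β).x ≤ T₁ →
      (∀ k ≤ V.top, ¬(T₁ < target k (V.fill β).x ∧ target k (V.fill β).x ≤ T₂)) →
      V.paid T₁ = V.paid T₂) := by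
  refine ⟨?_, ?_, ?_⟩
  · intro hw T hT
    by_contra! hc
    have := le_csSup (h.exists_paid_le hw hβ) (show T ∈ {T : ℕ | _} from hc)
    have h2 : sSup {T : ℕ | (1 - β) * V.w * T ≤ V.paid T} ≤ (V.fill β).x := le_max_right _ _
    omega
  · rcases h.w_nonneg.eq_or_lt with hw | hw
    · have := h.C_nonneg (V.fill β).x
      have := le_paid V (V.fill β).x
      rw [← hw]; linarith
    · have hx : V.x ∈ {T : ℕ | (1 - β) * V.w * T ≤ V.paid T} := h.sat.trans (le_paid V _)
      have hm := Nat.sSup_mem ⟨_, hx⟩ (h.exists_paid_le hw hβ)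
      have hle := le_csSup (h.exists_paid_le hw hβ) hx
      have : (V.fill β).x = sSup {T : ℕ | (1 - β) * V.w * T ≤ V.paid T} := max_eq_right hle
      rw [this]
      exact hm
  · intro T₁ T₂ hT hx hk
    have hx0 := le_fill_x V β
    have hk0 : ∀ k ≤ V.top, ¬(T₁ < target k V.x ∧ target k V.x ≤ T₂) := by
      rintro k hkt ⟨h1, h2⟩
      -- An old target that lies beyond the new value is still the target of its scale.
      have h3 : target k (V.fill β).x = target k V.x := target_eq_of_lt hx0 (by omega)
      exact hk k hkt (by rw [h3]; exact ⟨h1, h2⟩)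
    unfold paid
    rw [h.flat T₁ T₂ hT (hx0.trans hx) hk0]
    congr 1
    apply Finset.sum_congr _ (fun _ _ => rfl)
    apply Finset.filter_congr
    intro i hi
    have h1 := hk0 _ (h.k_le i hi)
    constructor
    · intro; omega
    · intro h2
      by_contra h3
      exact h1 ⟨by omega, h2⟩

theorem Inv.lt_fill_slack (h : V.Inv β) (hβ : β < 1) (hw : 0 < V.w) (k : ℕ) :
    β * (V.w * target k (V.fill β).x) < (V.fill β).slack k := by
  have := (h.fill_aux hβ).1 hw _ (lt_target k (V.fill β).x)
  change _ < V.w * _ - V.paid _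
  nlinarith

/-- The cap `Z + 1` in `cut` never binds: eight loads are at most twice the old capacity, and the
new slack is at least `2 ^ (-Z)` times the new capacity, which is no smaller. -/
theorem Inv.two_pow_cut (h : V.Inv β) (hβ : β < 1) (hZ : (2 : ℝ)⁻¹ ^ Z ≤ β) (hw : 0 < V.w)
    {k : ℕ} (hk : k ≤ V.top) :
    V.load k ≤ 2 ^ (V.fill β).cut Z k * ((V.fill β).slack k / 8) := by
  have hβ0 : 0 < β := lt_of_lt_of_le (by positivity) hZ
  have hT : (0 : ℝ) < target k V.x := by exact_mod_cast (Nat.zero_le _).trans_lt (lt_target k V.x)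
  have hT' : (target k V.x : ℝ) ≤ target k (V.fill β).x := by
    exact_mod_cast target_mono_right k (le_fill_x V β)
  have h1 := h.lt_fill_slack hβ hw k
  have h2 := h.safe k hk
  have h3 := h.slack_le k
  have hs : 0 < (V.fill β).slack k := lt_of_le_of_lt (by positivity) h1
  have hq : 8 * V.load k / (V.fill β).slack k ≤ 2 ^ (Z + 1) := by
    rw [div_le_iff₀ hs]
    have h4 : V.w * target k V.x ≤ 2 ^ Z * (V.fill β).slack k := by
      have h5 : (1 : ℝ) ≤ 2 ^ Z * β := by
        have : (2 : ℝ) ^ Z * (2 : ℝ)⁻¹ ^ Z = 1 := by rw [← mul_pow]; norm_num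
        calc (1 : ℝ) = 2 ^ Z * (2 : ℝ)⁻¹ ^ Z := this.symm
          _ ≤ _ := by gcongr
      calc V.w * target k V.x ≤ V.w * target k (V.fill β).x := by gcongr
        _ ≤ (2 ^ Z * β) * (V.w * target k (V.fill β).x) :=
            le_mul_of_one_le_left (by positivity) h5
        _ = 2 ^ Z * (β * (V.w * target k (V.fill β).x)) := by ring
        _ ≤ _ := by gcongr
    rw [pow_succ]
    linarith
  have hc : (V.fill β).cut Z k = Nat.clog 2 ⌈8 * V.load k / (V.fill β).slack k⌉₊ := by
    unfold cut
    apply min_eq_right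
    apply Nat.clog_le_of_le_pow
    apply Nat.ceil_le.2
    exact_mod_cast hq
  rw [hc]
  have h6 : 8 * V.load k / (V.fill β).slack k ≤
      2 ^ Nat.clog 2 ⌈8 * V.load k / (V.fill β).slack k⌉₊ := by
    refine (Nat.le_ceil _).trans ?_
    exact_mod_cast Nat.le_pow_clog (by norm_num) _
  rw [div_le_iff₀ hs] at h6
  linarith

theorem sum_quarter_pow_le (k N : ℕ) :
    ∑ l ∈ Finset.Ioc k N, (4 : ℝ)⁻¹ ^ (l - k) ≤ 1 / 2 := by
  rcases le_total N k with h | h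
  · rw [Finset.Ioc_eq_empty (by omega)]; norm_num
  · obtain ⟨d, rfl⟩ := Nat.exists_eq_add_of_le h
    have : ∑ l ∈ Finset.Ioc k (k + d), (4 : ℝ)⁻¹ ^ (l - k) = 1 / 3 * (1 - (4 : ℝ)⁻¹ ^ d) := by
      induction d with
      | zero => simp
      | succ d ih =>
        rw [← add_assoc, Finset.sum_Ioc_succ_top (by omega), ih (by omega)]
        rw [show k + d + 1 - k = d + 1 by omega, pow_succ]
        ring
    rw [this]
    have : (0 : ℝ) ≤ (4 : ℝ)⁻¹ ^ d := by positivity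
    linarith

/-- Constraints that move to a smaller scale have reduced their bids so much that they fit in. -/
theorem Inv.arrivals_le (h : V.Inv β) (hβ : β < 1) (hZ : (2 : ℝ)⁻¹ ^ Z ≤ β) (hw : 0 < V.w)
    (k : ℕ) :
    ∑ i ∈ V.act with k < V.k i, (2 : ℝ) ^ (V.e i - ((Z : ℤ) + 3) * ((V.k i : ℤ) - k)) ≤
      (V.fill β).slack k / 8 := by
  have hβ0 : 0 < β := lt_of_lt_of_le (by positivity) hZ
  have hlt := h.lt_fill_slack hβ hw k
  have hT' : (target k V.x : ℝ) ≤ target k (V.fill β).x := by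
    exact_mod_cast target_mono_right k (le_fill_x V β)
  have hW : (2 : ℝ)⁻¹ ^ Z * (V.w * target k V.x) ≤ (V.fill β).slack k := by
    refine le_trans ?_ hlt.le
    gcongr
  have hmaps : ∀ i ∈ V.act.filter (fun i => k < V.k i), V.k i ∈ Finset.Ioc k V.top := by
    intro i hi
    rw [Finset.mem_filter] at hi
    exact Finset.mem_Ioc.2 ⟨hi.2, h.k_le i hi.1⟩
  rw [← Finset.sum_fiberwise_of_maps_to hmaps]
  have hstep : ∀ l ∈ Finset.Ioc k V.top,
      ∑ i ∈ V.act.filter (fun i => k < V.k i) with V.k i = l,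
        (2 : ℝ) ^ (V.e i - ((Z : ℤ) + 3) * ((V.k i : ℤ) - k)) ≤
      (V.fill β).slack k / 4 * (4 : ℝ)⁻¹ ^ (l - k) := by
    intro l hl
    rw [Finset.mem_Ioc] at hl
    obtain ⟨d, rfl⟩ := Nat.exists_eq_add_of_lt hl.1
    have h1 : ∑ i ∈ V.act.filter (fun i => k < V.k i) with V.k i = k + d + 1,
        (2 : ℝ) ^ (V.e i - ((Z : ℤ) + 3) * ((V.k i : ℤ) - k)) ≤
        (2 : ℝ)⁻¹ ^ ((Z + 3) * (d + 1)) * V.load (k + d + 1) := by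
      unfold load
      rw [Finset.mul_sum]
      refine le_trans (Finset.sum_le_sum (g := fun i =>
        (2 : ℝ)⁻¹ ^ ((Z + 3) * (d + 1)) * 2 ^ V.e i) ?_) ?_
      · intro i hi
        rw [Finset.mem_filter] at hi
        rw [hi.2, zpow_sub₀ (by norm_num), div_eq_inv_mul, inv_pow]
        apply le_of_eq
        congr 2
        rw [← zpow_natCast]
        congr 1
        push_cast
        ring
      · apply Finset.sum_le_sum_of_subset_of_nonneg
        · intro i hi
          simp only [Finset.mem_filter] at hi ⊢
          exact ⟨hi.1.1, hi.2.le⟩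
        · exact fun _ _ _ => by positivity
    have h2 := h.safe _ hl.2
    have h3 := h.slack_le (k + d + 1)
    have h4 : (target (k + d + 1) V.x : ℝ) ≤ 2 ^ (d + 1) * target k V.x := by
      have := target_le_pow_mul (show k ≤ k + d + 1 by omega) V.x
      rw [show k + d + 1 - k = d + 1 by omega] at this
      exact_mod_cast this
    have h5 : V.load (k + d + 1) ≤ 2 ^ (d + 1) * (V.w * target k V.x) / 4 := by
      have := mul_le_mul_of_nonneg_left h4 hw.le
      linarith
    refine h1.trans ?_
    rw [show k + d + 1 - k = d + 1 by omega]
    -- Origin of `Z + 3`: `Z` halvings allow for a slack that is only a `2 ^ (-Z)` fraction of the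
    -- capacity, one per scale offsets the doubling of the target, and two per scale make the sum
    -- over the scales geometric.
    have h6 : (2 : ℝ)⁻¹ ^ ((Z + 3) * (d + 1)) * 2 ^ (d + 1) ≤
        (2 : ℝ)⁻¹ ^ Z * (4 : ℝ)⁻¹ ^ (d + 1) := by
      have e1 : (Z + 3) * (d + 1) = Z + Z * d + 2 * (d + 1) + (d + 1) := by ring
      have e2 : (2 : ℝ)⁻¹ ^ (d + 1) * 2 ^ (d + 1) = 1 := by rw [← mul_pow]; norm_num
      have e3 : (2 : ℝ)⁻¹ ^ (2 * (d + 1)) = (4 : ℝ)⁻¹ ^ (d + 1) := by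
        rw [pow_mul]; norm_num
      rw [e1, pow_add, pow_add, pow_add, mul_assoc, e2, e3, mul_one]
      have : (2 : ℝ)⁻¹ ^ (Z * d) ≤ 1 := pow_le_one₀ (by norm_num) (by norm_num)
      gcongr
      exact mul_le_of_le_one_right (by positivity) this
    calc (2 : ℝ)⁻¹ ^ ((Z + 3) * (d + 1)) * V.load (k + d + 1)
        ≤ (2 : ℝ)⁻¹ ^ ((Z + 3) * (d + 1)) * (2 ^ (d + 1) * (V.w * target k V.x) / 4) := by gcongr
      _ = ((2 : ℝ)⁻¹ ^ ((Z + 3) * (d + 1)) * 2 ^ (d + 1)) * (V.w * target k V.x) / 4 := by ring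
      _ ≤ ((2 : ℝ)⁻¹ ^ Z * (4 : ℝ)⁻¹ ^ (d + 1)) * (V.w * target k V.x) / 4 := by gcongr
      _ = ((2 : ℝ)⁻¹ ^ Z * (V.w * target k V.x)) / 4 * (4 : ℝ)⁻¹ ^ (d + 1) := by ring
      _ ≤ _ := by gcongr
  refine (Finset.sum_le_sum hstep).trans ?_
  rw [← Finset.mul_sum]
  have h7 := sum_quarter_pow_le k V.top
  have h8 : 0 ≤ (V.fill β).slack k := le_trans (by positivity) hW
  nlinarith

/-- A whole iteration preserves the invariant. -/
theorem Inv.update (h : V.Inv β) (hβ : β < 1) (hZ : (2 : ℝ)⁻¹ ^ Z ≤ β) {V' : VarView m}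
    (hw : V'.w = V.w) (hx : V'.x = (V.fill β).x) (hC : V'.C = V.paid) (htop : V'.top = V.top)
    (hact : V'.act ⊆ V.act) (hk : ∀ i ∈ V'.act, V'.k i ≤ V.k i)
    (he : ∀ i ∈ V'.act,
      V'.e i ≤ V.e i - (V.fill β).maxCut Z i - ((Z : ℤ) + 3) * ((V.k i : ℤ) - V'.k i)) :
    V'.Inv β := by
  obtain ⟨h1, h2, h3⟩ := h.fill_aux hβ
  have hslack : ∀ k, V'.slack k = (V.fill β).slack k := by
    intro k; unfold slack; rw [hw, hx, hC]; rfl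
  refine ⟨?_, ?_, ?_, ?_, ?_, ?_, ?_, ?_, ?_, ?_⟩
  · rw [hw]; exact h.w_nonneg
  · rw [hC]; exact h.paid_mono
  · rw [hC]; exact fun T => (h.C_nonneg T).trans (le_paid V T)
  · rw [hC, hw]; exact h.paid_le
  · rw [hC, hx, htop]; exact h3
  · intro k hk'
    rw [htop] at hk'
    by_cases hne : V'.act.Nonempty
    · have hwp : 0 < V.w := h.w_pos (hne.mono hact)
      have hA := h.two_pow_cut hβ hZ hwp hk'
      have hB := h.arrivals_le hβ hZ hwp k
      -- The bids now counted at `k` were counted there before or come from a larger scale. Each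
      -- group fits into an eighth of the new slack, which together is the required quarter.
      have hsplit : V'.load k ≤
          ∑ i ∈ V.act with V.k i ≤ k, ((2 : ℝ) ^ (V.fill β).cut Z k)⁻¹ * (2 : ℝ) ^ V.e i +
          ∑ i ∈ V.act with k < V.k i,
            (2 : ℝ) ^ (V.e i - ((Z : ℤ) + 3) * ((V.k i : ℤ) - k)) := by
        unfold load
        rw [← Finset.sum_filter_add_sum_filter_not _ (fun i => V.k i ≤ k)]
        apply add_le_add
        · refine le_trans (Finset.sum_le_sum (g := fun i =>
            ((2 : ℝ) ^ (V.fill β).cut Z k)⁻¹ * (2 : ℝ) ^ V.e i) ?_) ?_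
          · intro i hi
            simp only [Finset.mem_filter] at hi
            have h4 := he i hi.1.1
            have h5 := hk i hi.1.1
            have h6 : (V.fill β).cut Z k ≤ (V.fill β).maxCut Z i :=
              Finset.le_sup (f := fun k => (V.fill β).cut Z k)
                (Finset.mem_Icc.2 ⟨hi.2, hk'⟩)
            rw [← zpow_natCast, ← zpow_neg, ← zpow_add₀ (by norm_num)]
            apply zpow_le_zpow_right₀ (by norm_num)
            have h7 : 0 ≤ ((Z : ℤ) + 3) * ((V.k i : ℤ) - V'.k i) :=
              mul_nonneg (by omega) (by omega)
            omega
          · apply Finset.sum_le_sum_of_subset_of_nonneg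
            · intro i hi
              simp only [Finset.mem_filter] at hi ⊢
              exact ⟨hact hi.1.1, hi.2⟩
            · exact fun _ _ _ => by positivity
        · refine le_trans (Finset.sum_le_sum (g := fun i =>
            (2 : ℝ) ^ (V.e i - ((Z : ℤ) + 3) * ((V.k i : ℤ) - k))) ?_) ?_
          · intro i hi
            simp only [Finset.mem_filter] at hi
            have h4 := he i hi.1.1
            apply zpow_le_zpow_right₀ (by norm_num)
            have h7 : ((Z : ℤ) + 3) * ((V.k i : ℤ) - k) ≤
                ((Z : ℤ) + 3) * ((V.k i : ℤ) - V'.k i) :=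
              mul_le_mul_of_nonneg_left (by omega) (by omega)
            omega
          · apply Finset.sum_le_sum_of_subset_of_nonneg
            · intro i hi
              simp only [Finset.mem_filter, not_le] at hi ⊢
              exact ⟨hact hi.1.1, hi.2⟩
            · exact fun _ _ _ => by positivity
      rw [← Finset.mul_sum] at hsplit
      have hA' : ((2 : ℝ) ^ (V.fill β).cut Z k)⁻¹ * V.load k ≤ (V.fill β).slack k / 8 := by
        rw [inv_mul_le_iff₀ (by positivity)]
        exact hA
      rw [hslack]
      unfold load at hA' hsplit ⊢
      linarith
    · rw [Finset.not_nonempty_iff_eq_empty] at hne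
      have : V'.load k = 0 := by unfold load; rw [hne]; simp
      rw [this, mul_zero]
      have := h.paid_le (target k V'.x)
      unfold slack
      rw [hw, hC]
      linarith
  · rw [hw, hC, hx]; exact h1
  · rw [hw, hC, hx]; exact h2
  · intro i hi
    rw [htop]
    exact (hk i hi).trans (h.k_le i (hact hi))
  · intro hne
    rw [hw]
    exact h.w_pos (hne.mono hact)

end VarView

/-! ### The bidding process and preservation of the invariant -/

/-- Parameters of the bidding process: a bound `F` on the rank, the tolerance `β ≥ 2 ^ (-Z)`, and
the number `K` of bits of the input numbers. -/
structure Tuning where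
  F : ℕ
  Z : ℕ
  K : ℕ
  β : ℝ

/-- The global state of the bidding process: values, cumulative loads and bid exponents. -/
structure BidState (n m : ℕ) where
  x : Fin n → ℕ
  C : Fin n → ℕ → ℝ
  e : Fin m → ℤ

/-- Chosen so that an increase by at most `2 ^ k - 1` covers less than `ρ / F`. If the quotient is
below `1`, the value `Nat.log 2 0 = 0` is right, since then `2 ^ k - 1 = 0`; a coefficient `a = 0`
also gets scale `0`. -/
def scaleOf (F : ℕ) (ρ a : ℝ) : ℕ := Nat.log 2 ⌊ρ / (F * a)⌋₊

/-- The initial value of a variable of weight `w`. -/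
def startValue (K : ℕ) (w : ℝ) : ℕ := if w = 0 then 2 ^ (2 * K) else 0

/-- The number of halvings of `2 ^ K` after which `deg` bids together take at most a quarter of `w`.
-/
def startCost (K deg : ℕ) (w : ℝ) : ℕ := Nat.clog 2 ⌈4 * deg * 2 ^ K / w⌉₊

theorem le_two_pow_startCost (K deg : ℕ) (w : ℝ) :
    4 * deg * 2 ^ K / w ≤ (2 : ℝ) ^ startCost K deg w := by
  refine (Nat.le_ceil _).trans ?_
  have h := Nat.le_pow_clog (b := 2) (by norm_num) ⌈4 * deg * 2 ^ K / w⌉₊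
  calc (⌈4 * deg * 2 ^ K / w⌉₊ : ℝ) ≤ ((2 ^ startCost K deg w : ℕ) : ℝ) := Nat.cast_le.2 h
    _ = _ := by push_cast; rfl

theorem scaleOf_mono {F : ℕ} {ρ ρ' a : ℝ} (ha : 0 ≤ a) (h : ρ ≤ ρ') :
    scaleOf F ρ a ≤ scaleOf F ρ' a := by
  unfold scaleOf
  apply Nat.log_mono_right
  apply Nat.floor_mono
  gcongr

theorem lt_two_pow_scaleOf {F : ℕ} {ρ a : ℝ} (hF : 0 < F) (ha : 0 < a) :
    ρ < 2 ^ (scaleOf F ρ a + 1) * (F * a) := by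
  have hF' : (0 : ℝ) < F := by exact_mod_cast hF
  rw [← div_lt_iff₀ (by positivity)]
  have h1 := Nat.lt_floor_add_one (ρ / (F * a))
  have h2 : ⌊ρ / (F * a)⌋₊ + 1 ≤ 2 ^ (scaleOf F ρ a + 1) :=
    Nat.lt_pow_succ_log_self (by norm_num) _
  exact h1.trans_le (by exact_mod_cast h2)

theorem mul_two_pow_scaleOf_sub_one_lt {F : ℕ} {ρ a : ℝ} (hF : 0 < F) (ha : 0 < a) (hρ : 0 < ρ) :
    a * (2 ^ scaleOf F ρ a - 1) < ρ / F := by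
  have hF' : (0 : ℝ) < F := by exact_mod_cast hF
  by_cases h0 : ⌊ρ / (F * a)⌋₊ = 0
  · have : scaleOf F ρ a = 0 := by unfold scaleOf; rw [h0]; simp
    rw [this]
    simp only [pow_zero, sub_self, mul_zero]
    positivity
  · have h1 : 2 ^ scaleOf F ρ a ≤ ⌊ρ / (F * a)⌋₊ := Nat.pow_log_le_self 2 h0
    have h2 : ((2 : ℝ) ^ scaleOf F ρ a) ≤ ρ / (F * a) := by
      refine le_trans ?_ (Nat.floor_le (by positivity))
      exact_mod_cast h1
    rw [le_div_iff₀ (by positivity)] at h2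
    rw [lt_div_iff₀ hF']
    nlinarith [mul_pos hF' ha]

theorem two_pow_scaleOf_le {F : ℕ} {ρ a M : ℝ} (hF : 0 < F) (hρ : ρ / a ≤ M)
    (hM : 1 ≤ M) : (2 : ℝ) ^ scaleOf F ρ a ≤ M := by
  by_cases h0 : ⌊ρ / (F * a)⌋₊ = 0
  · have : scaleOf F ρ a = 0 := by unfold scaleOf; rw [h0]; simp
    rw [this]; simpa
  · have h1 : 2 ^ scaleOf F ρ a ≤ ⌊ρ / (F * a)⌋₊ := Nat.pow_log_le_self 2 h0
    have h3 : 0 ≤ ρ / (F * a) := by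
      by_contra! hc
      exact h0 (Nat.floor_of_nonpos hc.le)
    have h2 : ((2 : ℝ) ^ scaleOf F ρ a) ≤ ρ / (F * a) := by
      refine le_trans ?_ (Nat.floor_le h3)
      exact_mod_cast h1
    have hF' : (1 : ℝ) ≤ F := by exact_mod_cast hF
    have h4 : ρ / (F * a) = ρ / a / F := by rw [mul_comm, div_div]
    rw [h4] at h2 h3
    have h5 : 0 ≤ ρ / a := by
      by_contra! hc
      exact absurd h3 (not_le.2 (div_neg_of_neg_of_pos hc (by linarith)))
    exact h2.trans ((div_le_self h5 hF').trans hρ)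

namespace CoveringILP

variable {n m : ℕ}

def residual (P : CoveringILP m n) (x : Fin n → ℕ) (i : Fin m) : ℝ :=
  P.b i - ∑ j, P.A i j * (x j : ℝ)

def row (P : CoveringILP m n) (i : Fin m) : Finset (Fin n) := {j | P.A i j ≠ 0}

def col (P : CoveringILP m n) (j : Fin n) : Finset (Fin m) := {i | P.A i j ≠ 0}

def scale (P : CoveringILP m n) (θ : Tuning) (x : Fin n → ℕ) (i : Fin m) (j : Fin n) : ℕ :=
  scaleOf θ.F (P.residual x i) (P.A i j)

/-- The active constraints adjacent to variable `j`. -/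
def act (P : CoveringILP m n) (x : Fin n → ℕ) (j : Fin n) : Finset (Fin m) :=
  {i | P.A i j ≠ 0 ∧ 0 < P.residual x i}

def start (P : CoveringILP m n) (θ : Tuning) : BidState n m where
  x j := startValue θ.K (P.w j)
  C _ _ := 0
  e i := θ.K - ((P.row i).sup fun j => startCost θ.K (P.col j).card (P.w j) : ℕ)

/-- Residuals only decrease, so the scales of the start bound all later ones. -/
def top (P : CoveringILP m n) (θ : Tuning) (j : Fin n) : ℕ :=
  (P.act (P.start θ).x j).sup fun i => P.scale θ (P.start θ).x i j

/-- Exponents and scales are set to `0` off the active set, so that the view equals, as a structure,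
what the node reconstructs from its messages. -/
def view (P : CoveringILP m n) (θ : Tuning) (g : BidState n m) (j : Fin n) : VarView m where
  w := P.w j
  x := g.x j
  C := g.C j
  top := P.top θ j
  act := P.act g.x j
  e i := if i ∈ P.act g.x j then g.e i else 0
  k i := if i ∈ P.act g.x j then P.scale θ g.x i j else 0

def Raises (P : CoveringILP m n) (θ : Tuning) (g : BidState n m) (a : ℕ) (i : Fin m) : Prop :=
  ∀ j ∈ P.row i, ¬(P.view θ g j).Stuck a i

def raised (P : CoveringILP m n) (θ : Tuning) (g : BidState n m) (a : ℕ) (j : Fin n) : VarView m :=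
  (P.view θ g j).raise a (P.Raises θ g a)

def filled (P : CoveringILP m n) (θ : Tuning) (g : BidState n m) (a : ℕ) (j : Fin n) : VarView m :=
  (P.raised θ g a j).fill θ.β

def rowCut (P : CoveringILP m n) (θ : Tuning) (g : BidState n m) (a : ℕ) (i : Fin m) : ℕ :=
  (P.row i).sup fun j => (P.filled θ g a j).maxCut θ.Z i

/-- A constraint has one bid for its whole row; it therefore takes the largest cut demanded in the
row and pays for the scale drops at all its variables. -/
def step (P : CoveringILP m n) (θ : Tuning) (a : ℕ) (g : BidState n m) : BidState n m where
  x j := (P.filled θ g a j).x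
  C j := (P.filled θ g a j).C
  e i := (if P.Raises θ g a i then g.e i + a else g.e i) - P.rowCut θ g a i
    - ((θ.Z : ℤ) + 3) * ∑ j ∈ P.row i,
      ((P.scale θ g.x i j : ℤ) - P.scale θ (fun j => (P.filled θ g a j).x) i j)

def bidRun (P : CoveringILP m n) (θ : Tuning) (a : ℕ → ℕ) : ℕ → BidState n m
  | 0 => P.start θ
  | t + 1 => P.step θ (a t) (P.bidRun θ a t)

/-- The parameters fit the covering program. -/
structure Fits (P : CoveringILP m n) (θ : Tuning) : Prop where
  F_pos : 0 < θ.F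
  row_card_le : ∀ i, (P.row i).card ≤ θ.F
  β_lt : θ.β < 1
  Z_le : (2 : ℝ)⁻¹ ^ θ.Z ≤ θ.β
  b_le : ∀ i j, P.A i j ≠ 0 → P.b i ≤ P.A i j * 2 ^ (2 * θ.K)
  w_le : ∀ j, P.w j ≤ 2 ^ θ.K

variable {P : CoveringILP m n} {θ : Tuning} {a : ℕ → ℕ}

theorem A_pos (P : CoveringILP m n) {i : Fin m} {j : Fin n} (h : P.A i j ≠ 0) : 0 < P.A i j :=
  (P.A_nonneg i j).lt_of_ne' h

theorem mem_row {i : Fin m} {j : Fin n} : j ∈ P.row i ↔ P.A i j ≠ 0 := by simp [row]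

theorem mem_col {i : Fin m} {j : Fin n} : i ∈ P.col j ↔ P.A i j ≠ 0 := by simp [col]

theorem mem_act {x : Fin n → ℕ} {i : Fin m} {j : Fin n} :
    i ∈ P.act x j ↔ P.A i j ≠ 0 ∧ 0 < P.residual x i := by simp [act]

theorem residual_anti {x y : Fin n → ℕ} (h : x ≤ y) (i : Fin m) :
    P.residual y i ≤ P.residual x i := by
  unfold residual
  have : ∑ j, P.A i j * (x j : ℝ) ≤ ∑ j, P.A i j * (y j : ℝ) := by
    apply Finset.sum_le_sum
    intro j _
    exact mul_le_mul_of_nonneg_left (by exact_mod_cast h j) (P.A_nonneg i j)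
  linarith

theorem residual_le_sub (P : CoveringILP m n) (x : Fin n → ℕ) (i : Fin m) (j : Fin n) :
    P.residual x i ≤ P.b i - P.A i j * x j := by
  unfold residual
  have : P.A i j * (x j : ℝ) ≤ ∑ j, P.A i j * (x j : ℝ) :=
    Finset.single_le_sum (f := fun j => P.A i j * (x j : ℝ))
      (fun j _ => mul_nonneg (P.A_nonneg i j) (Nat.cast_nonneg _)) (Finset.mem_univ j)
  linarith

theorem residual_le (P : CoveringILP m n) (x : Fin n → ℕ) (i : Fin m) : P.residual x i ≤ P.b i := by
  unfold residual
  have : 0 ≤ ∑ j, P.A i j * (x j : ℝ) :=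
    Finset.sum_nonneg fun j _ => mul_nonneg (P.A_nonneg i j) (Nat.cast_nonneg _)
  linarith

theorem scale_anti {x y : Fin n → ℕ} (h : x ≤ y) (i : Fin m) (j : Fin n) :
    P.scale θ y i j ≤ P.scale θ x i j :=
  scaleOf_mono (P.A_nonneg i j) (residual_anti h i)

theorem act_anti {x y : Fin n → ℕ} (h : x ≤ y) (j : Fin n) : P.act y j ⊆ P.act x j := by
  intro i
  simp only [mem_act]
  exact fun ⟨h1, h2⟩ => ⟨h1, h2.trans_le (residual_anti h i)⟩

theorem le_step_x (P : CoveringILP m n) (θ : Tuning) (a : ℕ) (g : BidState n m) :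
    g.x ≤ (P.step θ a g).x :=
  fun j => VarView.le_fill_x (P.raised θ g a j) θ.β

theorem bidRun_x_mono (P : CoveringILP m n) (θ : Tuning) (a : ℕ → ℕ) :
    Monotone fun t => (P.bidRun θ a t).x :=
  monotone_nat_of_le_succ fun t => P.le_step_x θ (a t) (P.bidRun θ a t)

/-- A free variable starts at `2 ^ (2 * K)`, which alone satisfies every constraint in which it
occurs. -/
theorem Fits.w_pos (h : P.Fits θ) {x : Fin n → ℕ} (hx : (P.start θ).x ≤ x) {i : Fin m} {j : Fin n}
    (hi : i ∈ P.act x j) : 0 < P.w j := by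
  rw [mem_act] at hi
  refine (P.w_nonneg j).lt_of_ne' fun h0 => ?_
  have h1 := P.residual_le_sub (P.start θ).x i j
  have h2 : ((P.start θ).x j : ℝ) = 2 ^ (2 * θ.K) := by
    simp [start, startValue, h0]
  have h3 := h.b_le i j hi.1
  have h4 := residual_anti hx i (P := P)
  rw [h2] at h1
  linarith [hi.2]

theorem Fits.start_inv (h : P.Fits θ) (j : Fin n) : (P.view θ (P.start θ) j).Inv θ.β where
  w_nonneg := P.w_nonneg j
  C_mono := fun _ _ _ => le_rfl
  C_nonneg := fun _ => le_rfl
  C_le := fun T => mul_nonneg (P.w_nonneg j) (Nat.cast_nonneg T)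
  flat := fun _ _ _ _ _ => rfl
  safe := by
    intro k _
    have hsl : P.w j ≤ (P.view θ (P.start θ) j).slack k := by
      have : (1 : ℝ) ≤ target k ((P.start θ).x j) := by
        exact_mod_cast (Nat.zero_le _).trans_lt (lt_target k _)
      have h1 := P.w_nonneg j
      change _ ≤ P.w j * (target k ((P.start θ).x j) : ℝ) - 0
      nlinarith
    by_cases hne : (P.act (P.start θ).x j).Nonempty
    · obtain ⟨i0, hi0⟩ := hne
      have hw := h.w_pos le_rfl hi0
      have hdeg : (0 : ℝ) < (P.col j).card := by
        exact_mod_cast Finset.card_pos.2 ⟨i0, mem_col.2 (mem_act.1 hi0).1⟩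
      have hbid : ∀ i ∈ P.act (P.start θ).x j,
          (2 : ℝ) ^ (P.start θ).e i ≤ P.w j / (4 * (P.col j).card) := by
        intro i hi
        have h1 : startCost θ.K (P.col j).card (P.w j) ≤
            (P.row i).sup fun j => startCost θ.K (P.col j).card (P.w j) :=
          Finset.le_sup (f := fun j => startCost θ.K (P.col j).card (P.w j))
            (mem_row.2 (mem_act.1 hi).1)
        have h2 : 4 * (P.col j).card * 2 ^ θ.K / P.w j ≤
            (2 : ℝ) ^ startCost θ.K (P.col j).card (P.w j) :=
          le_two_pow_startCost _ _ _
        calc (2 : ℝ) ^ (P.start θ).e i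
            ≤ (2 : ℝ) ^ ((θ.K : ℤ) - (startCost θ.K (P.col j).card (P.w j) : ℕ)) := by
              apply zpow_le_zpow_right₀ (by norm_num)
              simp only [start]
              omega
          _ = 2 ^ θ.K / 2 ^ startCost θ.K (P.col j).card (P.w j) := by
              rw [zpow_sub₀ (by norm_num), zpow_natCast, zpow_natCast]
          _ ≤ _ := by
              rw [div_le_iff₀ hw] at h2
              rw [div_le_div_iff₀ (by positivity) (by positivity)]
              linarith
      have hload : (P.view θ (P.start θ) j).load k ≤ P.w j / 4 := by
        unfold VarView.load
        calc ∑ i ∈ (P.view θ (P.start θ) j).act with (P.view θ (P.start θ) j).k i ≤ k,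
              (2 : ℝ) ^ (P.view θ (P.start θ) j).e i
            ≤ ∑ i ∈ P.col j, P.w j / (4 * (P.col j).card) := by
              refine le_trans (Finset.sum_le_sum (g := fun _ => P.w j / (4 * (P.col j).card)) ?_) ?_
              · intro i hi
                have hi := (Finset.mem_filter.1 hi).1
                simp only [view] at hi ⊢
                rw [if_pos hi]
                exact hbid i hi
              · apply Finset.sum_le_sum_of_subset_of_nonneg
                · intro i hi
                  have hi := (Finset.mem_filter.1 hi).1
                  exact mem_col.2 (mem_act.1 hi).1
                · exact fun _ _ _ => by positivity
          _ = _ := by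
              rw [Finset.sum_const, nsmul_eq_mul]
              field_simp
      linarith
    · rw [Finset.not_nonempty_iff_eq_empty] at hne
      have : (P.view θ (P.start θ) j).load k = 0 := by
        unfold VarView.load view
        simp [hne]
      rw [this]
      linarith [P.w_nonneg j]
  unsat := by
    intro hw T hT
    have h0 : (0 : ℝ) < T := by exact_mod_cast (Nat.zero_le _).trans_lt hT
    have h1 := h.β_lt
    have h2 : 0 < 1 - θ.β := by linarith
    change (0 : ℝ) < (1 - θ.β) * P.w j * T
    have hw' : 0 < P.w j := hw
    positivity
  sat := by
    change (1 - θ.β) * P.w j * (startValue θ.K (P.w j) : ℝ) ≤ 0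
    unfold startValue
    split_ifs with h0
    · rw [h0]; simp
    · simp
  k_le := by
    intro i hi
    change (if i ∈ P.act (P.start θ).x j then _ else _) ≤ P.top θ j
    have hi' : i ∈ P.act (P.start θ).x j := hi
    rw [if_pos hi']
    exact Finset.le_sup (f := fun i => P.scale θ (P.start θ).x i j) hi'
  w_pos := fun ⟨_, hi⟩ => h.w_pos le_rfl hi

theorem raised_inv {g : BidState n m} {j : Fin n} (h : (P.view θ g j).Inv θ.β) (a : ℕ) :
    (P.raised θ g a j).Inv θ.β :=
  h.raise fun _ hi hr => hr j (mem_row.2 (mem_act.1 hi).1)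

theorem raised_e {g : BidState n m} {j : Fin n} {i : Fin m} (hi : i ∈ P.act g.x j) (a : ℕ) :
    (P.raised θ g a j).e i = if P.Raises θ g a i then g.e i + a else g.e i := by
  change (if i ∈ P.act g.x j ∧ _ then (if i ∈ P.act g.x j then _ else _) + (a : ℤ) else
    (if i ∈ P.act g.x j then _ else _)) = _
  simp [hi]

theorem raised_k {g : BidState n m} {j : Fin n} {i : Fin m} (hi : i ∈ P.act g.x j) (a : ℕ) :
    (P.raised θ g a j).k i = P.scale θ g.x i j := if_pos hi

theorem Fits.step_inv (h : P.Fits θ) {g : BidState n m} {j : Fin n}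
    (hg : (P.view θ g j).Inv θ.β) (a : ℕ) : (P.view θ (P.step θ a g) j).Inv θ.β := by
  have hx := P.le_step_x θ a g
  have hsub := act_anti (P := P) hx j
  apply (raised_inv hg a).update (Z := θ.Z) h.β_lt h.Z_le (V' := P.view θ (P.step θ a g) j)
    rfl rfl rfl rfl hsub
  · intro i hi
    have hi : i ∈ P.act (P.step θ a g).x j := hi
    rw [raised_k (hsub hi)]
    change (if i ∈ P.act (P.step θ a g).x j then _ else _) ≤ _
    rw [if_pos hi]
    exact scale_anti hx i j
  · intro i hi
    have hi : i ∈ P.act (P.step θ a g).x j := hi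
    have hij : j ∈ P.row i := mem_row.2 (mem_act.1 hi).1
    rw [raised_k (hsub hi), raised_e (hsub hi)]
    change (if i ∈ P.act (P.step θ a g).x j then (P.step θ a g).e i else _) ≤
      _ - _ * (_ - ((if i ∈ P.act (P.step θ a g).x j then P.scale θ (P.step θ a g).x i j else _ :
        ℕ) : ℤ))
    rw [if_pos hi, if_pos hi]
    change _ - (P.rowCut θ g a i : ℤ) - ((θ.Z : ℤ) + 3) * ∑ j ∈ P.row i,
      ((P.scale θ g.x i j : ℤ) - P.scale θ (P.step θ a g).x i j) ≤ _
    have h1 : (P.filled θ g a j).maxCut θ.Z i ≤ P.rowCut θ g a i :=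
      Finset.le_sup (f := fun j => (P.filled θ g a j).maxCut θ.Z i) hij
    have h2 : (P.scale θ g.x i j : ℤ) - P.scale θ (P.step θ a g).x i j ≤
        ∑ j ∈ P.row i, ((P.scale θ g.x i j : ℤ) - P.scale θ (P.step θ a g).x i j) := by
      apply Finset.single_le_sum
        (f := fun j => (P.scale θ g.x i j : ℤ) - P.scale θ (P.step θ a g).x i j) _ hij
      intro j' _
      have := scale_anti (P := P) (θ := θ) hx i j'
      omega
    have h3 := mul_le_mul_of_nonneg_left h2 (show (0 : ℤ) ≤ (θ.Z : ℤ) + 3 by omega)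
    have h1' : (((P.raised θ g a j).fill θ.β).maxCut θ.Z i : ℤ) ≤ P.rowCut θ g a i := by
      exact_mod_cast h1
    linarith

theorem Fits.inv (h : P.Fits θ) (a : ℕ → ℕ) (t : ℕ) (j : Fin n) :
    (P.view θ (P.bidRun θ a t) j).Inv θ.β := by
  induction t with
  | zero => exact h.start_inv j
  | succ t ih => exact h.step_inv ih (a t)

end CoveringILP

/-! ### Weak duality and the approximation guarantee -/

namespace CoveringILP

variable {n m : ℕ} {P : CoveringILP m n} {θ : Tuning} {a : ℕ → ℕ}

/-- The exponent of the bid that constraint `i` pays in an iteration. -/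
def bid (P : CoveringILP m n) (θ : Tuning) (g : BidState n m) (a : ℕ) (i : Fin m) : ℤ :=
  if P.Raises θ g a i then g.e i + a else g.e i

/-- The sum of all bids paid so far. -/
def totalPaid (P : CoveringILP m n) (θ : Tuning) (a : ℕ → ℕ) (t : ℕ) : ℝ :=
  ∑ s ∈ Finset.range t, ∑ i with 0 < P.residual (P.bidRun θ a s).x i,
    (2 : ℝ) ^ P.bid θ (P.bidRun θ a s) (a s) i

theorem step_C (P : CoveringILP m n) (θ : Tuning) (g : BidState n m) (a : ℕ) (j : Fin n) (T : ℕ) :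
    (P.step θ a g).C j T = g.C j T +
      ∑ i with (P.A i j ≠ 0 ∧ 0 < P.residual g.x i) ∧ target (P.scale θ g.x i j) (g.x j) ≤ T,
        (2 : ℝ) ^ P.bid θ g a i := by
  change g.C j T + ∑ i ∈ P.act g.x j with target ((P.raised θ g a j).k i) (g.x j) ≤ T,
    (2 : ℝ) ^ (P.raised θ g a j).e i = _
  congr 1
  rw [← Finset.filter_filter]
  change _ = ∑ i ∈ P.act g.x j with _, _
  apply Finset.sum_congr
  · apply Finset.filter_congr
    intro i hi
    rw [raised_k hi]
  · intro i hi
    rw [raised_e (Finset.mem_filter.1 hi).1]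
    rfl

/-- Below its target a variable gains at most `2 ^ k - 1`, worth less than `ρ / F`; at most `F` such
gains cannot close the residual `ρ`. This replaces dual feasibility. -/
theorem Fits.exists_target_le (h : P.Fits θ) {x y : Fin n → ℕ} {i : Fin m}
    (hx : 0 < P.residual x i) (hy : P.residual y i ≤ 0) :
    ∃ j ∈ P.row i, target (P.scale θ x i j) (x j) ≤ y j := by
  by_contra! hc
  have hF : (0 : ℝ) < θ.F := by exact_mod_cast h.F_pos
  have h1 : ∑ j ∈ P.row i, P.A i j * ((2 : ℝ) ^ P.scale θ x i j - 1) < P.residual x i := by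
    rcases (P.row i).eq_empty_or_nonempty with he | hne
    · rw [he, Finset.sum_empty]; exact hx
    · calc _ < ∑ j ∈ P.row i, P.residual x i / θ.F :=
            Finset.sum_lt_sum_of_nonempty hne fun j hj =>
              mul_two_pow_scaleOf_sub_one_lt h.F_pos (P.A_pos (mem_row.1 hj)) hx
        _ = (P.row i).card * (P.residual x i / θ.F) := by rw [Finset.sum_const, nsmul_eq_mul]
        _ ≤ θ.F * (P.residual x i / θ.F) := by
            have : ((P.row i).card : ℝ) ≤ θ.F := by exact_mod_cast h.row_card_le i
            gcongr
        _ = _ := by field_simp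
  have h2 : ∑ j, P.A i j * (y j : ℝ) ≤ ∑ j, P.A i j * (x j : ℝ) +
      ∑ j ∈ P.row i, P.A i j * ((2 : ℝ) ^ P.scale θ x i j - 1) := by
    rw [row, Finset.sum_filter, ← Finset.sum_add_distrib]
    apply Finset.sum_le_sum
    intro j _
    split_ifs with hj
    · have h3 := hc j (mem_row.2 hj)
      have h4 := target_le (P.scale θ x i j) (x j)
      have h5 : ((y j : ℝ)) + 1 ≤ x j + 2 ^ P.scale θ x i j := by
        have : y j + 1 ≤ x j + 2 ^ P.scale θ x i j := by omega
        exact_mod_cast this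
      have := P.A_nonneg i j
      nlinarith
    · rw [not_not] at hj
      rw [hj]; simp
  unfold residual at hx hy h1
  linarith

/-- Each bid is charged to a variable of its row where `y` reaches the target, and is contained in
`C` there. -/
theorem Fits.totalPaid_le (h : P.Fits θ) {y : Fin n → ℕ} (hy : P.Feasible y) (t : ℕ) :
    P.totalPaid θ a t ≤ ∑ j, (P.bidRun θ a t).C j (y j) := by
  induction t with
  | zero => simp [totalPaid, bidRun, start]
  | succ t ih =>
    set g := P.bidRun θ a t with hg
    have hC : ∀ j, (P.bidRun θ a (t + 1)).C j (y j) = _ := fun j => P.step_C θ g (a t) j (y j)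
    rw [Finset.sum_congr rfl fun j _ => hC j, Finset.sum_add_distrib]
    unfold totalPaid at ih ⊢
    rw [Finset.sum_range_succ]
    apply add_le_add ih
    simp_rw [Finset.sum_filter]
    rw [Finset.sum_comm]
    apply Finset.sum_le_sum
    intro i _
    split_ifs with hi
    · obtain ⟨j, hj, hjT⟩ := h.exists_target_le (y := y) hi (by
        have := hy i
        unfold residual; linarith)
      have := Finset.single_le_sum (f := fun j => if (P.A i j ≠ 0 ∧ 0 < P.residual g.x i) ∧
        target (P.scale θ g.x i j) (g.x j) ≤ y j then (2 : ℝ) ^ P.bid θ g (a t) i else 0)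
        (fun j _ => by split_ifs <;> positivity) (Finset.mem_univ j)
      exact le_trans (le_of_eq (if_pos ⟨⟨mem_row.1 hj, hi⟩, hjT⟩).symm) this
    · exact Finset.sum_nonneg fun j _ => by split_ifs <;> positivity

theorem Fits.sum_C_le (h : P.Fits θ) (T : Fin n → ℕ) (t : ℕ) :
    ∑ j, (P.bidRun θ a t).C j (T j) ≤ θ.F * P.totalPaid θ a t := by
  induction t with
  | zero => simp [totalPaid, bidRun, start]
  | succ t ih =>
    set g := P.bidRun θ a t with hg
    have hC : ∀ j, (P.bidRun θ a (t + 1)).C j (T j) = _ := fun j => P.step_C θ g (a t) j (T j)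
    rw [Finset.sum_congr rfl fun j _ => hC j, Finset.sum_add_distrib]
    unfold totalPaid at ih ⊢
    rw [Finset.sum_range_succ, mul_add]
    apply add_le_add ih
    simp_rw [Finset.sum_filter]
    rw [Finset.sum_comm, Finset.mul_sum]
    apply Finset.sum_le_sum
    intro i _
    split_ifs with hi
    · calc _ ≤ ∑ j, if P.A i j ≠ 0 then (2 : ℝ) ^ P.bid θ g (a t) i else 0 := by
            apply Finset.sum_le_sum
            intro j _
            by_cases hA : P.A i j ≠ 0
            · rw [if_pos hA]; split_ifs
              · exact le_rfl
              · positivity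
            · rw [if_neg hA, if_neg (fun hc => hA hc.1.1)]
        _ = (P.row i).card * (2 : ℝ) ^ P.bid θ g (a t) i := by
            rw [← Finset.sum_filter, Finset.sum_const, nsmul_eq_mul]; rfl
        _ ≤ _ := by
            have : ((P.row i).card : ℝ) ≤ θ.F := by exact_mod_cast h.row_card_le i
            gcongr
    · rw [mul_zero]
      apply le_of_eq
      apply Finset.sum_eq_zero
      intro j _
      rw [if_neg (fun hc => hi hc.1.2)]

/-- The approximation guarantee of the bidding process. -/
theorem Fits.cost_le (h : P.Fits θ) (a : ℕ → ℕ) {y : Fin n → ℕ} (hy : P.Feasible y) (t : ℕ) :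
    (1 - θ.β) * P.cost (P.bidRun θ a t).x ≤ θ.F * P.cost y := by
  unfold cost
  calc (1 - θ.β) * ∑ j, P.w j * ((P.bidRun θ a t).x j : ℝ)
      = ∑ j, (1 - θ.β) * P.w j * ((P.bidRun θ a t).x j : ℝ) := by
        rw [Finset.mul_sum]
        exact Finset.sum_congr rfl fun j _ => by ring
    _ ≤ ∑ j, (P.bidRun θ a t).C j ((P.bidRun θ a t).x j) :=
        Finset.sum_le_sum fun j _ => (h.inv a t j).sat
    _ ≤ θ.F * P.totalPaid θ a t := h.sum_C_le _ t
    _ ≤ θ.F * ∑ j, (P.bidRun θ a t).C j (y j) := by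
        gcongr
        exact h.totalPaid_le hy t
    _ ≤ θ.F * ∑ j, P.w j * (y j : ℝ) := by
        gcongr with j
        exact (h.inv a t j).C_le (y j)

end CoveringILP

/-! ### Depth as a measure of progress at a scale -/

/-- Once `p` holds it persists, so the sum telescopes from that time on. Used for places that become
relevant to a constraint when its scale has dropped far enough. -/
theorem sum_ite_sub_le {p : ℕ → Prop} (hp : ∀ t, p t → p (t + 1)) {y : ℕ → ℝ} {B : ℝ}
    (h0 : ∀ t, 0 ≤ y t) (hB : ∀ t, y t ≤ B) (τ : ℕ) :
    ∑ t ∈ Finset.range τ, (if p t then y (t + 1) - y t else 0) ≤ B := by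
  have key : (∀ τ, ¬p τ → ∑ t ∈ Finset.range τ, (if p t then y (t + 1) - y t else 0) = 0) := by
    intro τ hτ
    apply Finset.sum_eq_zero
    intro t ht
    rw [if_neg]
    intro hpt
    exact hτ (Nat.le_induction hpt (fun k _ hk => hp k hk) τ (Finset.mem_range.1 ht).le)
  refine le_trans ?_ (hB τ)
  induction τ with
  | zero => simpa using h0 0
  | succ τ ih =>
    rw [Finset.sum_range_succ]
    by_cases h : p τ
    · rw [if_pos h]; linarith
    · rw [if_neg h, key τ h, add_zero]; exact h0 _

namespace VarView

variable {m : ℕ} {V : VarView m} {β : ℝ} {a Z : ℕ} {r : Fin m → Prop}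

/-- The logarithm of the fraction of the capacity of scale `k` that is left. -/
def depth (V : VarView m) (k : ℕ) : ℝ := Real.log (V.w * target k V.x / V.slack k)

theorem capacity_pos (hw : 0 < V.w) (k : ℕ) : 0 < V.w * target k V.x :=
  mul_pos hw (by exact_mod_cast (Nat.zero_le _).trans_lt (lt_target k V.x))

theorem depth_mem (hZ : (2 : ℝ)⁻¹ ^ Z ≤ β) (hw : 0 < V.w) {k : ℕ}
    (h1 : β * (V.w * target k V.x) < V.slack k) (h2 : V.slack k ≤ V.w * target k V.x) :
    0 ≤ V.depth k ∧ V.depth k ≤ Z := by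
  have hW := capacity_pos hw k
  have hβ0 : 0 < β := lt_of_lt_of_le (by positivity) hZ
  have hs : 0 < V.slack k := lt_trans (by positivity) h1
  constructor
  · apply Real.log_nonneg
    rwa [le_div_iff₀ hs, one_mul]
  · have h3 : V.w * target k V.x / V.slack k ≤ 2 ^ Z := by
      rw [div_le_iff₀ hs]
      have h5 : (1 : ℝ) ≤ 2 ^ Z * β := by
        have : (2 : ℝ) ^ Z * (2 : ℝ)⁻¹ ^ Z = 1 := by rw [← mul_pow]; norm_num
        calc (1 : ℝ) = 2 ^ Z * (2 : ℝ)⁻¹ ^ Z := this.symm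
          _ ≤ _ := by gcongr
      calc V.w * target k V.x ≤ (2 ^ Z * β) * (V.w * target k V.x) :=
            le_mul_of_one_le_left hW.le h5
        _ = 2 ^ Z * (β * (V.w * target k V.x)) := by ring
        _ ≤ _ := by gcongr
    calc V.depth k ≤ Real.log (2 ^ Z) := Real.log_le_log (by positivity) h3
      _ = Z * Real.log 2 := Real.log_pow _ _
      _ ≤ Z * 1 := by
          have := Real.log_two_lt_d9
          gcongr
          linarith
      _ = Z := mul_one _

theorem Inv.depth_mem (h : V.Inv β) (hZ : (2 : ℝ)⁻¹ ^ Z ≤ β) (hw : 0 < V.w) (k : ℕ) :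
    0 ≤ V.depth k ∧ V.depth k ≤ Z :=
  VarView.depth_mem (V := V) (k := k) hZ hw (h.lt_slack hw k) (h.slack_le k)

theorem Inv.fill_depth_mem (h : V.Inv β) (hβ : β < 1) (hZ : (2 : ℝ)⁻¹ ^ Z ≤ β) (hw : 0 < V.w)
    (k : ℕ) : 0 ≤ (V.fill β).depth k ∧ (V.fill β).depth k ≤ Z := by
  refine VarView.depth_mem (V := V.fill β) (k := k) hZ hw (h.lt_fill_slack hβ hw k) ?_
  have := (h.C_nonneg (target k (V.fill β).x)).trans (le_paid V _)
  change V.w * _ - V.paid _ ≤ V.w * _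
  linarith

/-- The payment removes at least the load from the slack; `1 - 1 / r ≤ log r` for the ratio `r` of
old to new slack turns this into an increase of the depth. -/
theorem Inv.load_div_le (h : V.Inv β) (hβ : β < 1) (hβ0 : 0 < β) (hw : 0 < V.w) {k : ℕ}
    (hk : target k (V.fill β).x = target k V.x) :
    V.load k / V.slack k ≤ (V.fill β).depth k - V.depth k := by
  have hW := capacity_pos hw k
  have hs : 0 < V.slack k := lt_trans (by positivity) (h.lt_slack hw k)
  have hs' : 0 < (V.fill β).slack k := by
    refine lt_of_le_of_lt ?_ (h.lt_fill_slack hβ hw k)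
    positivity
  have h1 := fill_slack_le (β := β) hk
  have h2 : (V.fill β).depth k - V.depth k = Real.log (V.slack k / (V.fill β).slack k) := by
    unfold depth
    rw [hk]
    change Real.log (V.w * _ / _) - _ = _
    rw [Real.log_div hW.ne' hs'.ne', Real.log_div hW.ne' hs.ne', Real.log_div hs.ne' hs'.ne']
    ring
  rw [h2]
  have h3 := Real.one_sub_inv_le_log_of_pos (show 0 < V.slack k / (V.fill β).slack k by positivity)
  refine le_trans ?_ h3
  rw [inv_div, div_le_iff₀ hs, sub_mul, div_mul_cancel₀ _ hs.ne']
  linarith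

theorem Inv.depth_sub_nonneg (h : V.Inv β) (hβ : β < 1) (hZ : (2 : ℝ)⁻¹ ^ Z ≤ β) (hw : 0 < V.w)
    (k : ℕ) : 0 ≤ (V.fill β).depth k - V.depth k +
      (if target k V.x = target k (V.fill β).x then 0 else 1) * Z := by
  have hβ0 : 0 < β := lt_of_lt_of_le (by positivity) hZ
  split_ifs with hk
  · have h1 := h.load_div_le hβ hβ0 hw hk.symm
    have hs : 0 < V.slack k := by
      refine lt_trans ?_ (h.lt_slack hw k)
      have := capacity_pos hw k
      positivity
    have : 0 ≤ V.load k / V.slack k := div_nonneg (load_nonneg V k) hs.le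
    linarith
  · have h1 := (h.depth_mem hZ hw k).2
    have h2 := (h.fill_depth_mem hβ hZ hw k).1
    linarith

/-- With an unchanged target the slack keeps three quarters of its size, so at most two halvings are
demanded, and these only if `load / slack ≥ 3 / 32`; this gives `64 / 3 ≤ 22`. With a new target the
cap `Z + 1` is used. -/
theorem Inv.cut_le (h : V.Inv β) (hβ : β < 1) (hZ : (2 : ℝ)⁻¹ ^ Z ≤ β) (hw : 0 < V.w) {k : ℕ}
    (hkt : k ≤ V.top) :
    ((V.fill β).cut Z k : ℝ) ≤ 22 * ((V.fill β).depth k - V.depth k +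
      (if target k V.x = target k (V.fill β).x then 0 else 1) * Z) +
      (if target k V.x = target k (V.fill β).x then 0 else 1) * (Z + 1) := by
  have hβ0 : 0 < β := lt_of_lt_of_le (by positivity) hZ
  have h0 := h.depth_sub_nonneg hβ hZ hw k
  by_cases hk : target k V.x = target k (V.fill β).x
  · rw [if_pos hk] at h0 ⊢
    have h1 := h.load_div_le hβ hβ0 hw hk.symm
    have hs : 0 < V.slack k := by
      refine lt_trans ?_ (h.lt_slack hw k)
      have := capacity_pos hw k
      positivity
    have h2 := h.le_fill_slack hkt hk.symm
    have hs' : 0 < (V.fill β).slack k := by linarith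
    have h3 := h.safe k hkt
    by_cases hl : 8 * V.load k ≤ (V.fill β).slack k
    · have : (V.fill β).cut Z k = 0 := by
        unfold cut
        have h4 : ⌈8 * (V.fill β).load k / (V.fill β).slack k⌉₊ ≤ 1 := by
          apply Nat.ceil_le.2
          rw [Nat.cast_one, div_le_one hs']
          exact hl
        rw [Nat.clog_of_right_le_one h4]
        simp
      rw [this]
      push_cast
      linarith
    · have h5 : (V.fill β).cut Z k ≤ 2 := by
        unfold cut
        refine (min_le_right _ _).trans ?_
        apply Nat.clog_le_of_le_pow
        apply Nat.ceil_le.2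
        rw [div_le_iff₀ hs']
        change 8 * V.load k ≤ _
        push_cast
        linarith
      have h5' : ((V.fill β).cut Z k : ℝ) ≤ 2 := by exact_mod_cast h5
      have h6 : 3 / 32 ≤ V.load k / V.slack k := by
        rw [le_div_iff₀ hs]
        linarith
      linarith
  · rw [if_neg hk] at h0 ⊢
    have : (V.fill β).cut Z k ≤ Z + 1 := min_le_left _ _
    have : ((V.fill β).cut Z k : ℝ) ≤ Z + 1 := by exact_mod_cast this
    linarith

/-- At a place that blocks a raise, the load is more than `slack / (8 * 2 ^ a)`, and paying it
deepens the place by that fraction unless the target moves. -/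
theorem Inv.inv_two_pow_le (h : V.Inv β) (hβ : β < 1) (hZ : (2 : ℝ)⁻¹ ^ Z ≤ β) (hw : 0 < V.w)
    {k : ℕ} (hst : V.slack k < 8 * 2 ^ a * V.load k) :
    ((2 : ℝ) ^ a)⁻¹ ≤ 8 * ((V.fill β).depth k - V.depth k +
      (if target k V.x = target k (V.fill β).x then 0 else 1) * Z) +
      (if target k V.x = target k (V.fill β).x then 0 else 1) := by
  have hβ0 : 0 < β := lt_of_lt_of_le (by positivity) hZ
  have h0 := h.depth_sub_nonneg hβ hZ hw k
  by_cases hk : target k V.x = target k (V.fill β).x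
  · rw [if_pos hk] at h0 ⊢
    have h1 := h.load_div_le hβ hβ0 hw hk.symm
    have hs : 0 < V.slack k := by
      refine lt_trans ?_ (h.lt_slack hw k)
      have := capacity_pos hw k
      positivity
    have h2 : ((2 : ℝ) ^ a)⁻¹ ≤ 8 * (V.load k / V.slack k) := by
      rw [inv_le_iff_one_le_mul₀ (by positivity), ← mul_div_assoc, mul_comm, mul_div_assoc',
        le_div_iff₀ hs]
      linarith
    linarith
  · rw [if_neg hk] at h0 ⊢
    have : ((2 : ℝ) ^ a)⁻¹ ≤ 1 := inv_le_one_of_one_le₀ (one_le_pow₀ (by norm_num))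
    linarith

end VarView

/-! ### Progress, renewals and the accounting for one constraint -/

namespace CoveringILP

variable {n m : ℕ} {P : CoveringILP m n} {θ : Tuning} {a : ℕ → ℕ}

/-- Whether the target of scale `k` at variable `j` changes in iteration `t`. -/
def renewal (P : CoveringILP m n) (θ : Tuning) (a : ℕ → ℕ) (j : Fin n) (k t : ℕ) : ℝ :=
  if target k ((P.bidRun θ a t).x j) = target k ((P.bidRun θ a (t + 1)).x j) then 0 else 1

def depthAt (P : CoveringILP m n) (θ : Tuning) (a : ℕ → ℕ) (j : Fin n) (k t : ℕ) : ℝ :=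
  (P.view θ (P.bidRun θ a t) j).depth k

/-- The progress at scale `k` of variable `j` in iteration `t`. -/
def progress (P : CoveringILP m n) (θ : Tuning) (a : ℕ → ℕ) (j : Fin n) (k t : ℕ) : ℝ :=
  -- A renewal can lower the depth by `Z` and can cause `Z + 1` halvings; the credit covers both.
  P.depthAt θ a j k (t + 1) - P.depthAt θ a j k t + P.renewal θ a j k t * (2 * θ.Z + 1)

/-- The progress in iteration `t` at all places that are relevant for constraint `i`. -/
def rowProgress (P : CoveringILP m n) (θ : Tuning) (a : ℕ → ℕ) (i : Fin m) (t : ℕ) : ℝ :=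
  ∑ j ∈ P.row i, ∑ k ∈ Finset.range (P.top θ j + 1),
    if P.scale θ (P.bidRun θ a t).x i j ≤ k then P.progress θ a j k t else 0

theorem renewal_nonneg (P : CoveringILP m n) (θ : Tuning) (a : ℕ → ℕ) (j : Fin n) (k t : ℕ) :
    0 ≤ P.renewal θ a j k t := by unfold renewal; split_ifs <;> norm_num

theorem Fits.progress_nonneg (h : P.Fits θ) {j : Fin n} (hw : 0 < P.w j) (k t : ℕ) :
    0 ≤ P.progress θ a j k t := by
  have h1 := (raised_inv (h.inv a t j) (a t)).depth_sub_nonneg h.β_lt h.Z_le hw k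
  have h2 := P.renewal_nonneg θ a j k t
  have h3 : 0 ≤ P.depthAt θ a j k (t + 1) - P.depthAt θ a j k t + P.renewal θ a j k t * θ.Z := h1
  unfold progress
  have : 0 ≤ P.renewal θ a j k t * (θ.Z + 1) := mul_nonneg h2 (by positivity)
  linarith

theorem Fits.row_w_pos (h : P.Fits θ) {t : ℕ} {i : Fin m}
    (hi : 0 < P.residual (P.bidRun θ a t).x i) {j : Fin n} (hj : j ∈ P.row i) : 0 < P.w j :=
  h.w_pos (P.bidRun_x_mono θ a (Nat.zero_le t)) (mem_act.2 ⟨mem_row.1 hj, hi⟩)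

theorem Fits.progress_le_rowProgress (h : P.Fits θ) {t : ℕ} {i : Fin m}
    (hi : 0 < P.residual (P.bidRun θ a t).x i) {j : Fin n} (hj : j ∈ P.row i) {k : ℕ}
    (hk : k ≤ P.top θ j) (hs : P.scale θ (P.bidRun θ a t).x i j ≤ k) :
    P.progress θ a j k t ≤ P.rowProgress θ a i t := by
  have hnn : ∀ j ∈ P.row i, ∀ k ∈ Finset.range (P.top θ j + 1),
      0 ≤ if P.scale θ (P.bidRun θ a t).x i j ≤ k then P.progress θ a j k t else 0 := by
    intro j hj k _
    split_ifs
    · exact h.progress_nonneg (h.row_w_pos hi hj) k t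
    · exact le_rfl
  calc P.progress θ a j k t
      = if P.scale θ (P.bidRun θ a t).x i j ≤ k then P.progress θ a j k t else 0 := (if_pos hs).symm
    _ ≤ ∑ k ∈ Finset.range (P.top θ j + 1),
        if P.scale θ (P.bidRun θ a t).x i j ≤ k then P.progress θ a j k t else 0 :=
        Finset.single_le_sum (f := fun k => if P.scale θ (P.bidRun θ a t).x i j ≤ k then
          P.progress θ a j k t else 0) (hnn j hj) (Finset.mem_range.2 (by omega))
    _ ≤ _ := Finset.single_le_sum (f := fun j => ∑ k ∈ Finset.range (P.top θ j + 1),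
        if P.scale θ (P.bidRun θ a t).x i j ≤ k then P.progress θ a j k t else 0)
        (fun j hj => Finset.sum_nonneg (hnn j hj)) hj

theorem Fits.rowProgress_nonneg (h : P.Fits θ) {t : ℕ} {i : Fin m}
    (hi : 0 < P.residual (P.bidRun θ a t).x i) : 0 ≤ P.rowProgress θ a i t := by
  apply Finset.sum_nonneg
  intro j hj
  apply Finset.sum_nonneg
  intro k _
  split_ifs
  · exact h.progress_nonneg (h.row_w_pos hi hj) k t
  · exact le_rfl

theorem Fits.rowCut_le (h : P.Fits θ) {t : ℕ} {i : Fin m}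
    (hi : 0 < P.residual (P.bidRun θ a t).x i) :
    (P.rowCut θ (P.bidRun θ a t) (a t) i : ℝ) ≤ 22 * P.rowProgress θ a i t := by
  have h0 := h.rowProgress_nonneg hi
  have key : P.rowCut θ (P.bidRun θ a t) (a t) i ≤ ⌊22 * P.rowProgress θ a i t⌋₊ := by
    apply Finset.sup_le
    intro j hj
    apply Finset.sup_le
    intro k hk
    have hact : i ∈ P.act (P.bidRun θ a t).x j := mem_act.2 ⟨mem_row.1 hj, hi⟩
    have hk' : P.scale θ (P.bidRun θ a t).x i j ≤ k ∧ k ≤ P.top θ j := by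
      have := Finset.mem_Icc.1 hk
      have h2 : (P.filled θ (P.bidRun θ a t) (a t) j).k i = P.scale θ (P.bidRun θ a t).x i j :=
        raised_k hact (a t)
      rw [h2] at this
      exact this
    apply Nat.le_floor
    have hw := h.row_w_pos hi hj
    have h1 := (raised_inv (h.inv a t j) (a t)).cut_le h.β_lt h.Z_le hw hk'.2
    have h1' : ((P.filled θ (P.bidRun θ a t) (a t) j).cut θ.Z k : ℝ) ≤
      22 * (P.depthAt θ a j k (t + 1) - P.depthAt θ a j k t + P.renewal θ a j k t * θ.Z) +
        P.renewal θ a j k t * (θ.Z + 1) := h1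
    have h2 := h.progress_le_rowProgress hi hj hk'.2 hk'.1
    have h3 := P.renewal_nonneg θ a j k t
    have h4 : 0 ≤ P.renewal θ a j k t * (θ.Z + 1) := mul_nonneg h3 (by positivity)
    unfold progress at h2
    linarith
  exact (Nat.cast_le.2 key).trans (Nat.floor_le (by linarith))

theorem Fits.inv_two_pow_le (h : P.Fits θ) {t : ℕ} {i : Fin m}
    (hi : 0 < P.residual (P.bidRun θ a t).x i) (hr : ¬P.Raises θ (P.bidRun θ a t) (a t) i) :
    ((2 : ℝ) ^ a t)⁻¹ ≤ 8 * P.rowProgress θ a i t := by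
  unfold Raises at hr
  push Not at hr
  obtain ⟨j, hj, k, hk1, hk2, hst⟩ := hr
  have hact : i ∈ P.act (P.bidRun θ a t).x j := mem_act.2 ⟨mem_row.1 hj, hi⟩
  have hw := h.row_w_pos hi hj
  have hk1' : P.scale θ (P.bidRun θ a t).x i j ≤ k := by
    have hk : (P.view θ (P.bidRun θ a t) j).k i = P.scale θ (P.bidRun θ a t).x i j := if_pos hact
    rwa [hk] at hk1
  -- Being stuck was tested before the other constraints raised their bids. The raises only increase
  -- the load, so the test still holds for what is paid.
  have hst' : (P.raised θ (P.bidRun θ a t) (a t) j).slack k <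
      8 * 2 ^ a t * (P.raised θ (P.bidRun θ a t) (a t) j).load k := by
    refine lt_of_lt_of_le hst ?_
    have := (P.view θ (P.bidRun θ a t) j).load_raise_ge (a t) (P.Raises θ (P.bidRun θ a t) (a t)) k
    gcongr
    exact this
  have h1 := (raised_inv (h.inv a t j) (a t)).inv_two_pow_le h.β_lt h.Z_le hw hst'
  have h1' : ((2 : ℝ) ^ a t)⁻¹ ≤
      8 * (P.depthAt θ a j k (t + 1) - P.depthAt θ a j k t + P.renewal θ a j k t * θ.Z) +
        P.renewal θ a j k t := h1
  have h2 := h.progress_le_rowProgress hi hj hk2 hk1'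
  have h3 := P.renewal_nonneg θ a j k t
  have h4 : 0 ≤ P.renewal θ a j k t * θ.Z := mul_nonneg h3 (by positivity)
  unfold progress at h2
  linarith

theorem renewal_le (P : CoveringILP m n) (θ : Tuning) (a : ℕ → ℕ) (j : Fin n) (k t : ℕ) :
    P.renewal θ a j k t ≤ (((P.bidRun θ a (t + 1)).x j / 2 ^ k : ℕ) : ℝ) -
      (((P.bidRun θ a t).x j / 2 ^ k : ℕ) : ℝ) := by
  have hx : (P.bidRun θ a t).x j ≤ (P.bidRun θ a (t + 1)).x j :=
    P.bidRun_x_mono θ a (Nat.le_succ t) j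
  have hd : (P.bidRun θ a t).x j / 2 ^ k ≤ (P.bidRun θ a (t + 1)).x j / 2 ^ k :=
    Nat.div_le_div_right hx
  unfold renewal
  split_ifs with hc
  · rw [sub_nonneg]; exact_mod_cast hd
  · rw [target_eq_iff_div_eq] at hc
    have : (P.bidRun θ a t).x j / 2 ^ k + 1 ≤ (P.bidRun θ a (t + 1)).x j / 2 ^ k := by omega
    have : (((P.bidRun θ a t).x j / 2 ^ k : ℕ) : ℝ) + 1 ≤
      (((P.bidRun θ a (t + 1)).x j / 2 ^ k : ℕ) : ℝ) := by exact_mod_cast this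
    linarith

theorem scale_le_succ (P : CoveringILP m n) (θ : Tuning) (a : ℕ → ℕ) (i : Fin m) (j : Fin n)
    (k t : ℕ) (h : P.scale θ (P.bidRun θ a t).x i j ≤ k) :
    P.scale θ (P.bidRun θ a (t + 1)).x i j ≤ k :=
  (scale_anti (P.bidRun_x_mono θ a (Nat.le_succ t)) i j).trans h

/-- The number of renewals that are relevant for constraint `i`, at scale `k` of variable `j`. -/
theorem sum_renewal_le (P : CoveringILP m n) (θ : Tuning) (a : ℕ → ℕ) (i : Fin m) (j : Fin n)
    (k τ : ℕ) :
    ∑ t ∈ Finset.range τ, (if P.scale θ (P.bidRun θ a t).x i j ≤ k then P.renewal θ a j k t else 0)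
      ≤ 1 + ∑ t ∈ Finset.range τ, (if P.scale θ (P.bidRun θ a t).x i j ≤ k then
        (((P.bidRun θ a (t + 1)).x j : ℝ) - (P.bidRun θ a t).x j) / 2 ^ k else 0) := by
  -- The number of multiples of `2 ^ k` passed is compared with the increase of `x j / 2 ^ k`. The
  -- rounding error stays in an interval of length one, so it telescopes to at most `1`.
  set y : ℕ → ℝ := fun t =>
    (((P.bidRun θ a t).x j / 2 ^ k : ℕ) : ℝ) - ((P.bidRun θ a t).x j : ℝ) / 2 ^ k + 1 with hy
  have hy1 : ∀ t, y t ≤ 1 := by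
    intro t
    have : (((P.bidRun θ a t).x j / 2 ^ k : ℕ) : ℝ) ≤ ((P.bidRun θ a t).x j : ℝ) / 2 ^ k := by
      have := Nat.cast_div_le (α := ℝ) (m := (P.bidRun θ a t).x j) (n := 2 ^ k)
      push_cast at this
      exact this
    simp only [hy]; linarith
  have hy0 : ∀ t, 0 ≤ y t := by
    intro t
    have : ((P.bidRun θ a t).x j : ℝ) / 2 ^ k ≤ (((P.bidRun θ a t).x j / 2 ^ k : ℕ) : ℝ) + 1 := by
      rw [div_le_iff₀ (by positivity)]
      have := (Nat.lt_div_mul_add (a := (P.bidRun θ a t).x j) (b := 2 ^ k) (by positivity)).le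
      have h2 : (P.bidRun θ a t).x j ≤ ((P.bidRun θ a t).x j / 2 ^ k + 1) * 2 ^ k := by linarith
      exact_mod_cast h2
    simp only [hy]; linarith
  have h1 := sum_ite_sub_le (p := fun t => P.scale θ (P.bidRun θ a t).x i j ≤ k)
    (P.scale_le_succ θ a i j k) hy0 hy1 τ
  rw [← sub_le_iff_le_add, ← Finset.sum_sub_distrib]
  refine le_trans (Finset.sum_le_sum ?_) h1
  intro t _
  split_ifs
  · have := P.renewal_le θ a j k t
    simp only [hy]
    rw [sub_div]
    linarith
  · simp

theorem sum_half_pow_le {s N : ℕ} :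
    ∑ k ∈ Finset.range N, (if s ≤ k then ((2 : ℝ) ^ k)⁻¹ else 0) ≤ 2 * ((2 : ℝ) ^ s)⁻¹ := by
  have : ∀ N, s ≤ N → ∑ k ∈ Finset.range N, (if s ≤ k then ((2 : ℝ) ^ k)⁻¹ else 0) =
      2 * ((2 : ℝ) ^ s)⁻¹ - 2 * ((2 : ℝ) ^ N)⁻¹ := by
    intro N hN
    induction N, hN using Nat.le_induction with
    | base =>
      rw [sub_self]
      apply Finset.sum_eq_zero
      intro k hk
      rw [if_neg (not_le.2 (Finset.mem_range.1 hk))]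
    | succ N hN ih =>
      rw [Finset.sum_range_succ, ih, if_pos hN, pow_succ, mul_inv]
      ring
  rcases le_total s N with h | h
  · rw [this N h]
    have : (0 : ℝ) < ((2 : ℝ) ^ N)⁻¹ := by positivity
    linarith
  · rw [Finset.sum_eq_zero]
    · positivity
    · intro k hk
      rw [if_neg]
      have := Finset.mem_range.1 hk
      omega

theorem residual_sub (P : CoveringILP m n) (x y : Fin n → ℕ) (i : Fin m) :
    P.residual x i - P.residual y i = ∑ j ∈ P.row i, P.A i j * ((y j : ℝ) - x j) := by
  unfold residual row
  rw [Finset.sum_filter]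
  have : ∀ j, (if P.A i j ≠ 0 then P.A i j * ((y j : ℝ) - x j) else 0) =
      P.A i j * y j - P.A i j * x j := by
    intro j
    split_ifs with h
    · ring
    · rw [not_not] at h; rw [h]; ring
  simp_rw [this, Finset.sum_sub_distrib]
  ring

/-- The relative decrease of the residual, bounded by the decrease of a potential. -/
theorem residual_decrease_le {M : ℝ} (hM : 1 ≤ M) {i : Fin m}
    (hA : ∀ j, P.A i j ≠ 0 → P.b i / P.A i j ≤ M) {x y : Fin n → ℕ} (hxy : x ≤ y)
    (hy : 0 < P.residual y i) :
    (P.residual x i - P.residual y i) / P.residual x i ≤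
      2 * (Real.log (1 + M * P.residual x i / P.b i) -
        Real.log (1 + M * P.residual y i / P.b i)) := by
  have hx : 0 < P.residual x i := hy.trans_le (residual_anti hxy i)
  have hb : 0 < P.b i := hx.trans_le (P.residual_le x i)
  have hle := residual_anti (P := P) hxy i
  have hM0 : 0 < M := by linarith
  by_cases heq : P.residual x i = P.residual y i
  · rw [heq]; simp
  -- If the residual changes at all, some variable of the row grows by at least `1`, which is worth
  -- at least `b / M`. Hence `u ≥ 1` below and `1 + u ≤ 2 * u`; the added `1` keeps the potential
  -- nonnegative when the residual becomes small.
  · have hstep : P.b i / M ≤ P.residual x i := by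
      have hex : ∃ j ∈ P.row i, x j < y j := by
        by_contra! hc
        apply heq
        have := P.residual_sub x y i
        rw [Finset.sum_eq_zero] at this
        · linarith
        · intro j hj
          have : x j = y j := le_antisymm (hxy j) (hc j hj)
          rw [this, sub_self, mul_zero]
      obtain ⟨j, hj, hlt⟩ := hex
      have hAj := P.A_pos (mem_row.1 hj)
      have h1 := hA j (mem_row.1 hj)
      have h2 : P.A i j * ((y j : ℝ) - x j) ≤ P.residual x i - P.residual y i := by
        rw [residual_sub]
        apply Finset.single_le_sum (f := fun j => P.A i j * ((y j : ℝ) - x j)) _ hj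
        intro j' _
        have : (x j' : ℝ) ≤ y j' := by exact_mod_cast hxy j'
        exact mul_nonneg (P.A_nonneg i j') (by linarith)
      have h3 : (1 : ℝ) ≤ (y j : ℝ) - x j := by
        have : x j + 1 ≤ y j := hlt
        have : ((x j : ℝ)) + 1 ≤ y j := by exact_mod_cast this
        linarith
      rw [div_le_iff₀ hAj] at h1
      rw [div_le_iff₀ hM0]
      nlinarith
    set u := M * P.residual x i / P.b i with hu
    set v := M * P.residual y i / P.b i with hv
    have hu1 : 1 ≤ u := by
      rw [hu, le_div_iff₀ hb]
      rw [div_le_iff₀ hM0] at hstep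
      linarith
    have hv0 : 0 < v := by rw [hv]; positivity
    have h4 : (P.residual x i - P.residual y i) / P.residual x i = (u - v) / u := by
      rw [hu, hv]; field_simp
    have huv : v ≤ u := by rw [hu, hv]; gcongr
    rw [h4, ← Real.log_div (by linarith) (by linarith)]
    have h5 := Real.one_sub_inv_le_log_of_pos (show 0 < (1 + u) / (1 + v) by positivity)
    have h6 : (u - v) / u ≤ 2 * (1 - ((1 + u) / (1 + v))⁻¹) := by
      rw [inv_div, one_sub_div (by linarith), ← mul_div_assoc,
        div_le_div_iff₀ (by linarith) (by linarith)]
      nlinarith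
    linarith

theorem two_pow_top_le {M : ℝ} (hM : 1 ≤ M) (hF : 0 < θ.F)
    (hA : ∀ i j, P.A i j ≠ 0 → P.b i / P.A i j ≤ M) (j : Fin n) :
    (2 : ℝ) ^ P.top θ j ≤ M := by
  unfold top
  apply Finset.sup_induction (p := fun k => (2 : ℝ) ^ k ≤ M)
  · simpa
  · intro k hk l hl
    rcases max_cases k l with ⟨h, _⟩ | ⟨h, _⟩
    · change (2 : ℝ) ^ max k l ≤ M
      rw [h]; exact hk
    · change (2 : ℝ) ^ max k l ≤ M
      rw [h]; exact hl
  · intro i hi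
    apply two_pow_scaleOf_le hF _ hM
    rw [mem_act] at hi
    refine le_trans ?_ (hA i j hi.1)
    have := P.A_pos hi.1
    have := P.residual_le (P.start θ).x i
    gcongr

theorem top_le_logb {M : ℝ} (hM : 1 ≤ M) (hF : 0 < θ.F)
    (hA : ∀ i j, P.A i j ≠ 0 → P.b i / P.A i j ≤ M) (j : Fin n) :
    (P.top θ j : ℝ) ≤ Real.logb 2 M := by
  rw [Real.le_logb_iff_rpow_le (by norm_num) (by linarith), Real.rpow_natCast]
  exact two_pow_top_le hM hF hA j

theorem log_one_add_le {M : ℝ} (hM : 1 ≤ M) : Real.log (1 + M) ≤ 1 + Real.logb 2 M := by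
  have h1 : Real.log (1 + M) ≤ Real.log (2 * M) := Real.log_le_log (by linarith) (by linarith)
  rw [Real.log_mul (by norm_num) (by linarith)] at h1
  have h2 := Real.log_two_lt_d9
  have h3 : Real.log M ≤ Real.logb 2 M := by
    unfold Real.logb
    rw [le_div_iff₀ (Real.log_pos (by norm_num))]
    have := Real.log_nonneg hM
    nlinarith
  linarith

/-- The total number of renewals that are relevant for constraint `i`. -/
theorem Fits.sum_sum_renewal_le (h : P.Fits θ) {M : ℝ} (hM : 1 ≤ M)
    (hA : ∀ i j, P.A i j ≠ 0 → P.b i / P.A i j ≤ M) {i : Fin m} {τ : ℕ}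
    (hi : 0 < P.residual (P.bidRun θ a τ).x i) :
    ∑ j ∈ P.row i, ∑ k ∈ Finset.range (P.top θ j + 1), ∑ t ∈ Finset.range τ,
      (if P.scale θ (P.bidRun θ a t).x i j ≤ k then P.renewal θ a j k t else 0) ≤
      9 * (θ.F * (1 + Real.logb 2 M)) := by
  set ρ : ℕ → ℝ := fun t => P.residual (P.bidRun θ a t).x i with hρ
  have hmono := P.bidRun_x_mono θ a
  have hact : ∀ t ≤ τ, 0 < ρ t := fun t ht => hi.trans_le (residual_anti (hmono ht) i)
  have hF : (0 : ℝ) < θ.F := by exact_mod_cast h.F_pos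
  set d : Fin n → ℕ → ℝ := fun j t => ((P.bidRun θ a (t + 1)).x j : ℝ) - (P.bidRun θ a t).x j
    with hd
  have hd0 : ∀ j t, 0 ≤ d j t := by
    intro j t
    have : (P.bidRun θ a t).x j ≤ (P.bidRun θ a (t + 1)).x j := hmono (Nat.le_succ t) j
    have : ((P.bidRun θ a t).x j : ℝ) ≤ (P.bidRun θ a (t + 1)).x j := by exact_mod_cast this
    simp only [hd]; linarith
  have h1 : ∀ j ∈ P.row i, ∀ k ∈ Finset.range (P.top θ j + 1), ∑ t ∈ Finset.range τ,
      (if P.scale θ (P.bidRun θ a t).x i j ≤ k then P.renewal θ a j k t else 0) ≤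
      1 + ∑ t ∈ Finset.range τ,
        d j t * (if P.scale θ (P.bidRun θ a t).x i j ≤ k then ((2 : ℝ) ^ k)⁻¹ else 0) := by
    intro j _ k _
    refine (P.sum_renewal_le θ a i j k τ).trans (le_of_eq ?_)
    congr 1
    apply Finset.sum_congr rfl
    intro t _
    split_ifs
    · simp only [hd]; rw [div_eq_mul_inv]
    · simp
  have h2 : ∀ j ∈ P.row i, ∑ k ∈ Finset.range (P.top θ j + 1), ∑ t ∈ Finset.range τ,
      (if P.scale θ (P.bidRun θ a t).x i j ≤ k then P.renewal θ a j k t else 0) ≤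
      (1 + Real.logb 2 M) + ∑ t ∈ Finset.range τ, 4 * θ.F * (P.A i j * d j t / ρ t) := by
    intro j hj
    refine (Finset.sum_le_sum (h1 j hj)).trans ?_
    rw [Finset.sum_add_distrib]
    apply add_le_add
    · rw [Finset.sum_const, Finset.card_range, nsmul_eq_mul, mul_one]
      push_cast
      linarith [top_le_logb (P := P) hM h.F_pos hA j]
    · rw [Finset.sum_comm]
      apply Finset.sum_le_sum
      intro t ht
      rw [← Finset.mul_sum]
      have hρt := hact t (Finset.mem_range.1 ht).le
      have hAj := P.A_pos (mem_row.1 hj)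
      have h3 := sum_half_pow_le (s := P.scale θ (P.bidRun θ a t).x i j) (N := P.top θ j + 1)
      have h4 : ρ t < 2 ^ (P.scale θ (P.bidRun θ a t).x i j + 1) * (θ.F * P.A i j) :=
        lt_two_pow_scaleOf h.F_pos hAj
      -- The geometric sum over the relevant scales is governed by the smallest of them, which is
      -- comparable to `ρ / (F * A i j)`. Summed over the row, the growth of the variables becomes
      -- the relative decrease of the residual.
      have h5 : 2 * ((2 : ℝ) ^ P.scale θ (P.bidRun θ a t).x i j)⁻¹ ≤
          4 * θ.F * P.A i j / ρ t := by
        rw [← div_eq_mul_inv, div_le_div_iff₀ (by positivity) hρt]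
        rw [pow_succ] at h4
        nlinarith
      calc _ ≤ d j t * (4 * θ.F * P.A i j / ρ t) :=
            mul_le_mul_of_nonneg_left (h3.trans h5) (hd0 j t)
        _ = _ := by ring
  refine (Finset.sum_le_sum h2).trans ?_
  rw [Finset.sum_add_distrib, Finset.sum_const, nsmul_eq_mul, Finset.sum_comm]
  have hlog : 0 ≤ Real.logb 2 M := Real.logb_nonneg (by norm_num) hM
  have h6 : ((P.row i).card : ℝ) * (1 + Real.logb 2 M) ≤ θ.F * (1 + Real.logb 2 M) := by
    have : ((P.row i).card : ℝ) ≤ θ.F := by exact_mod_cast h.row_card_le i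
    gcongr
  have h7 : ∀ t ∈ Finset.range τ, ∑ j ∈ P.row i, 4 * θ.F * (P.A i j * d j t / ρ t) ≤
      8 * θ.F * (Real.log (1 + M * ρ t / P.b i) - Real.log (1 + M * ρ (t + 1) / P.b i)) := by
    intro t ht
    have hρt' := hact (t + 1) (Finset.mem_range.1 ht)
    have h8 := residual_decrease_le (P := P) hM (hA i) (hmono (Nat.le_succ t)) hρt'
    rw [residual_sub] at h8
    rw [← Finset.mul_sum, ← Finset.sum_div]
    change _ ≤ 2 * (Real.log (1 + M * ρ t / P.b i) - Real.log (1 + M * ρ (t + 1) / P.b i)) at h8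
    calc _ ≤ 4 * θ.F *
          (2 * (Real.log (1 + M * ρ t / P.b i) - Real.log (1 + M * ρ (t + 1) / P.b i))) :=
          mul_le_mul_of_nonneg_left h8 (by positivity)
      _ = _ := by ring
  have h9 := Finset.sum_le_sum h7
  rw [← Finset.mul_sum, Finset.sum_range_sub'] at h9
  have hb : 0 < P.b i := hi.trans_le (P.residual_le _ i)
  have h10 : Real.log (1 + M * ρ 0 / P.b i) ≤ 1 + Real.logb 2 M := by
    refine le_trans (Real.log_le_log ?_ ?_) (log_one_add_le hM)
    · have := hact 0 (Nat.zero_le _)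
      positivity
    · have h11 : ρ 0 ≤ P.b i := P.residual_le _ i
      have : M * ρ 0 / P.b i ≤ M := by
        rw [div_le_iff₀ hb]
        gcongr
      linarith
  have h12 : 0 ≤ Real.log (1 + M * ρ τ / P.b i) := by
    apply Real.log_nonneg
    have := hact τ le_rfl
    have : 0 ≤ M * ρ τ / P.b i := by positivity
    linarith
  have h13 : 8 * θ.F * (Real.log (1 + M * ρ 0 / P.b i) - Real.log (1 + M * ρ τ / P.b i)) ≤
      8 * θ.F * (1 + Real.logb 2 M) := by
    gcongr
    linarith
  linarith

/-- At each place the depth telescopes to at most `Z`, and each renewal adds `2 * Z + 1`. With `F (1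
+ log M)` places and nine times as many renewals this is `19 * Z + 9`, per unit of `F (1 + log M)`.
-/
theorem Fits.sum_rowProgress_le (h : P.Fits θ) {M : ℝ} (hM : 1 ≤ M)
    (hA : ∀ i j, P.A i j ≠ 0 → P.b i / P.A i j ≤ M) {i : Fin m} {τ : ℕ}
    (hi : 0 < P.residual (P.bidRun θ a τ).x i) :
    ∑ t ∈ Finset.range τ, P.rowProgress θ a i t ≤
      19 * (θ.Z + 1) * (θ.F * (1 + Real.logb 2 M)) := by
  have h1 := h.sum_sum_renewal_le hM hA hi
  have hlog : 0 ≤ Real.logb 2 M := Real.logb_nonneg (by norm_num) hM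
  have h2 : ∑ t ∈ Finset.range τ, P.rowProgress θ a i t ≤
      ∑ j ∈ P.row i, ∑ k ∈ Finset.range (P.top θ j + 1), ((θ.Z : ℝ) +
        (∑ t ∈ Finset.range τ, (if P.scale θ (P.bidRun θ a t).x i j ≤ k then
          P.renewal θ a j k t else 0)) * (2 * θ.Z + 1)) := by
    unfold rowProgress
    rw [Finset.sum_comm]
    apply Finset.sum_le_sum
    intro j hj
    rw [Finset.sum_comm]
    apply Finset.sum_le_sum
    intro k _
    have hw := h.row_w_pos hi hj
    have h3 := sum_ite_sub_le (p := fun t => P.scale θ (P.bidRun θ a t).x i j ≤ k)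
      (P.scale_le_succ θ a i j k) (y := P.depthAt θ a j k) (B := θ.Z)
      (fun t => ((h.inv a t j).depth_mem h.Z_le hw k).1)
      (fun t => ((h.inv a t j).depth_mem h.Z_le hw k).2) τ
    rw [← sub_le_iff_le_add, Finset.sum_mul, ← Finset.sum_sub_distrib]
    refine le_trans (Finset.sum_le_sum ?_) h3
    intro t _
    split_ifs
    · unfold progress; linarith
    · simp
  refine h2.trans ?_
  simp_rw [Finset.sum_add_distrib, ← Finset.sum_mul]
  have h4 : ∑ j ∈ P.row i, ∑ _k ∈ Finset.range (P.top θ j + 1), (θ.Z : ℝ) ≤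
      θ.Z * (θ.F * (1 + Real.logb 2 M)) := by
    calc _ ≤ ∑ j ∈ P.row i, (1 + Real.logb 2 M) * θ.Z := by
          apply Finset.sum_le_sum
          intro j _
          rw [Finset.sum_const, Finset.card_range, nsmul_eq_mul]
          have := top_le_logb (P := P) hM h.F_pos hA j
          push_cast
          exact mul_le_mul_of_nonneg_right (by linarith) (Nat.cast_nonneg _)
      _ = (P.row i).card * ((1 + Real.logb 2 M) * θ.Z) := by rw [Finset.sum_const, nsmul_eq_mul]
      _ ≤ θ.F * ((1 + Real.logb 2 M) * θ.Z) := by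
          have : ((P.row i).card : ℝ) ≤ θ.F := by exact_mod_cast h.row_card_le i
          gcongr
      _ = _ := by ring
  have h5 := mul_le_mul_of_nonneg_right h1 (show (0 : ℝ) ≤ 2 * θ.Z + 1 by positivity)
  have h6 : 0 ≤ (θ.F * (1 + Real.logb 2 M) : ℝ) := by positivity
  nlinarith

theorem bidRun_e (P : CoveringILP m n) (θ : Tuning) (a : ℕ → ℕ) (i : Fin m) (τ : ℕ) :
    (P.bidRun θ a τ).e i = (P.start θ).e i +
      ∑ t ∈ Finset.range τ, ((if P.Raises θ (P.bidRun θ a t) (a t) i then (a t : ℤ) else 0)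
        - P.rowCut θ (P.bidRun θ a t) (a t) i)
      - ((θ.Z : ℤ) + 3) * ∑ j ∈ P.row i,
        ((P.scale θ (P.start θ).x i j : ℤ) - P.scale θ (P.bidRun θ a τ).x i j) := by
  induction τ with
  | zero => simp [bidRun]
  | succ τ ih =>
    have h1 : (P.bidRun θ a (τ + 1)).e i =
        (if P.Raises θ (P.bidRun θ a τ) (a τ) i then (P.bidRun θ a τ).e i + a τ
          else (P.bidRun θ a τ).e i) - P.rowCut θ (P.bidRun θ a τ) (a τ) i
        - ((θ.Z : ℤ) + 3) * ∑ j ∈ P.row i, ((P.scale θ (P.bidRun θ a τ).x i j : ℤ) -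
          P.scale θ (P.bidRun θ a (τ + 1)).x i j) := rfl
    rw [h1, Finset.sum_range_succ]
    simp only [Finset.sum_sub_distrib] at ih ⊢
    split_ifs <;> rw [ih] <;> ring

/-- At the variable that dictates the initial bid, rounding to a power of two loses only a constant
factor. -/
theorem le_two_pow_start_e {j : Fin n} {i : Fin m} (h : P.Fits θ) (hw : 0 < P.w j)
    (hij : P.A i j ≠ 0)
    (hj : (P.row i).sup (fun j => startCost θ.K (P.col j).card (P.w j)) =
      startCost θ.K (P.col j).card (P.w j)) :
    P.w j / (16 * (P.col j).card) ≤ (2 : ℝ) ^ (P.start θ).e i := by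
  have hdeg : (1 : ℝ) ≤ (P.col j).card := by
    have : 0 < (P.col j).card := Finset.card_pos.2 ⟨i, mem_col.2 hij⟩
    exact_mod_cast this
  set q : ℝ := 4 * (P.col j).card * 2 ^ θ.K / P.w j with hq
  have hq4 : 4 ≤ q := by
    rw [hq, le_div_iff₀ hw]
    have := h.w_le j
    nlinarith
  have h1 : (2 : ℝ) ^ startCost θ.K (P.col j).card (P.w j) ≤ 4 * q := by
    have h2 : 1 < ⌈q⌉₊ := by
      rw [Nat.lt_ceil]
      push_cast
      linarith
    have h3 := Nat.pow_pred_clog_lt_self (b := 2) (by norm_num) h2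
    have h4 : 0 < Nat.clog 2 ⌈q⌉₊ := Nat.clog_pos (by norm_num) h2
    have h5 : ((2 : ℝ) ^ (Nat.clog 2 ⌈q⌉₊ - 1)) < ⌈q⌉₊ := by exact_mod_cast h3
    have h6 := Nat.ceil_lt_add_one (show 0 ≤ q by linarith)
    have h7 : (2 : ℝ) ^ startCost θ.K (P.col j).card (P.w j) =
        2 ^ (Nat.clog 2 ⌈q⌉₊ - 1) * 2 := by
      rw [← pow_succ, Nat.sub_add_cancel h4]; rfl
    rw [h7]
    linarith
  have h8 : (2 : ℝ) ^ (P.start θ).e i = 2 ^ θ.K / 2 ^ startCost θ.K (P.col j).card (P.w j) := by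
    simp only [start]
    rw [hj, zpow_sub₀ (by norm_num), zpow_natCast, zpow_natCast]
  rw [h8, div_le_div_iff₀ (by positivity) (by positivity)]
  calc P.w j * 2 ^ startCost θ.K (P.col j).card (P.w j) ≤ P.w j * (4 * q) := by gcongr
    _ = _ := by rw [hq]; field_simp; ring

/-- At that same variable the current bid is at most a quarter of `w * target`, and the target is at
most `2 * M` while the constraint is active; the initial bid was at least `w / (16 * Δ)`. -/
theorem Fits.e_sub_le (h : P.Fits θ) {M : ℝ} (hM : 1 ≤ M)
    (hA : ∀ i j, P.A i j ≠ 0 → P.b i / P.A i j ≤ M) {i : Fin m} {τ : ℕ} {Δ : ℝ}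
    (hi : 0 < P.residual (P.bidRun θ a τ).x i) (hne : (P.row i).Nonempty)
    (hΔ : ∀ j, ((P.col j).card : ℝ) ≤ Δ) :
    ((P.bidRun θ a τ).e i : ℝ) - (P.start θ).e i ≤ 3 + Real.logb 2 M + Real.logb 2 Δ := by
  obtain ⟨j, hj, hmax⟩ := Finset.exists_mem_eq_sup (P.row i) hne
    (fun j => startCost θ.K (P.col j).card (P.w j))
  have hw := h.row_w_pos hi hj
  have hij := mem_row.1 hj
  have hAj := P.A_pos hij
  have h1 := le_two_pow_start_e h hw hij hmax
  have hact : i ∈ P.act (P.bidRun θ a τ).x j := mem_act.2 ⟨hij, hi⟩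
  have hk : (P.view θ (P.bidRun θ a τ) j).k i = P.scale θ (P.bidRun θ a τ).x i j := if_pos hact
  have h2 := VarView.le_load (V := P.view θ (P.bidRun θ a τ) j) hact hk.le
  have he : (P.view θ (P.bidRun θ a τ) j).e i = (P.bidRun θ a τ).e i := if_pos hact
  rw [he] at h2
  have hinv := h.inv a τ j
  have h3 := hinv.safe _ (hk ▸ hinv.k_le i hact)
  have h4 := hinv.slack_le (P.scale θ (P.bidRun θ a τ).x i j)
  have h5 : (target (P.scale θ (P.bidRun θ a τ).x i j) ((P.bidRun θ a τ).x j) : ℝ) ≤ 2 * M := by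
    have h6 := target_le (P.scale θ (P.bidRun θ a τ).x i j) ((P.bidRun θ a τ).x j)
    have h7 : ((P.bidRun θ a τ).x j : ℝ) ≤ M := by
      refine le_trans ?_ (hA i j hij)
      rw [le_div_iff₀ hAj]
      have := P.residual_le_sub (P.bidRun θ a τ).x i j
      linarith
    have h8 : (2 : ℝ) ^ P.scale θ (P.bidRun θ a τ).x i j ≤ M := by
      apply two_pow_scaleOf_le h.F_pos _ hM
      refine le_trans ?_ (hA i j hij)
      have := P.residual_le (P.bidRun θ a τ).x i
      gcongr
    have h9 : (target (P.scale θ (P.bidRun θ a τ).x i j) ((P.bidRun θ a τ).x j) : ℝ) ≤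
      (P.bidRun θ a τ).x j + 2 ^ P.scale θ (P.bidRun θ a τ).x i j := by exact_mod_cast h6
    linarith
  have hdeg : (0 : ℝ) < (P.col j).card := by
    exact_mod_cast Finset.card_pos.2 ⟨i, mem_col.2 hij⟩
  have h10 : (2 : ℝ) ^ (P.bidRun θ a τ).e i ≤ P.w j * M / 2 := by
    change _ ≤ P.w j * (target _ ((P.bidRun θ a τ).x j) : ℝ) at h4
    have := mul_le_mul_of_nonneg_left h5 hw.le
    linarith
  have h11 : (2 : ℝ) ^ ((P.bidRun θ a τ).e i - (P.start θ).e i) ≤ 2 ^ 3 * M * Δ := by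
    rw [zpow_sub₀ (by norm_num), div_le_iff₀ (by positivity)]
    rw [div_le_iff₀ (by positivity)] at h1
    have h12 := hΔ j
    have hp : (0 : ℝ) < 2 ^ (P.start θ).e i := by positivity
    calc (2 : ℝ) ^ (P.bidRun θ a τ).e i ≤ P.w j * M / 2 := h10
      _ ≤ (2 ^ (P.start θ).e i * (16 * (P.col j).card)) * M / 2 := by gcongr
      _ ≤ (2 ^ (P.start θ).e i * (16 * Δ)) * M / 2 := by gcongr
      _ = _ := by ring
  have hΔ0 : 0 < Δ := hdeg.trans_le (hΔ j)
  have h13 := Real.logb_le_logb_of_le (b := 2) (by norm_num) (by positivity) h11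
  rw [Real.logb_mul (by positivity) (by positivity), Real.logb_mul (by positivity) (by positivity),
    ← Real.rpow_intCast, Real.logb_rpow (by norm_num) (by norm_num), ← Real.rpow_natCast,
    Real.logb_rpow (by norm_num) (by norm_num)] at h13
  push_cast at h13
  linarith

/-- While a constraint is active, both its raises and its stuck iterations are bounded. -/
theorem Fits.accounting (h : P.Fits θ) {M : ℝ} (hM : 1 ≤ M)
    (hA : ∀ i j, P.A i j ≠ 0 → P.b i / P.A i j ≤ M) {i : Fin m} {τ : ℕ} {Δ : ℝ}
    (hi : 0 < P.residual (P.bidRun θ a τ).x i) (hne : (P.row i).Nonempty)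
    (hΔ : ∀ j, ((P.col j).card : ℝ) ≤ Δ) :
    (∑ t ∈ Finset.range τ, (if P.Raises θ (P.bidRun θ a t) (a t) i then (a t : ℝ) else 0) ≤
      3 + Real.logb 2 M + Real.logb 2 Δ + 421 * (θ.Z + 1) * (θ.F * (1 + Real.logb 2 M))) ∧
    ∑ t ∈ Finset.range τ,
      (if P.Raises θ (P.bidRun θ a t) (a t) i then 0 else ((2 : ℝ) ^ a t)⁻¹) ≤
      152 * (θ.Z + 1) * (θ.F * (1 + Real.logb 2 M)) := by
  have h1 := h.sum_rowProgress_le hM hA hi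
  have hmono := P.bidRun_x_mono θ a
  have hact : ∀ t < τ, 0 < P.residual (P.bidRun θ a t).x i :=
    fun t ht => hi.trans_le (residual_anti (hmono ht.le) i)
  have hlog : 0 ≤ Real.logb 2 M := Real.logb_nonneg (by norm_num) hM
  constructor
  -- The raises equal the net change of the exponent plus everything that was cut: `421 = 22 * 19 +
  -- 3`, the `3` coming from `Z + 3 ≤ 3 * (Z + 1)` for the scale drops. The constant `152` of the
  -- other half is `8 * 19`.
  · have h2 := P.bidRun_e θ a i τ
    have h3 := h.e_sub_le hM hA hi hne hΔ
    have h4 : ∑ t ∈ Finset.range τ, (P.rowCut θ (P.bidRun θ a t) (a t) i : ℝ) ≤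
        22 * ∑ t ∈ Finset.range τ, P.rowProgress θ a i t := by
      rw [Finset.mul_sum]
      exact Finset.sum_le_sum fun t ht => h.rowCut_le (hact t (Finset.mem_range.1 ht))
    have h5 : ∑ j ∈ P.row i, ((P.scale θ (P.start θ).x i j : ℝ) -
        P.scale θ (P.bidRun θ a τ).x i j) ≤ θ.F * (1 + Real.logb 2 M) := by
      calc _ ≤ ∑ j ∈ P.row i, (1 + Real.logb 2 M) := by
            apply Finset.sum_le_sum
            intro j hj
            have h6 := top_le_logb (P := P) hM h.F_pos hA j
            have h7 : P.scale θ (P.start θ).x i j ≤ P.top θ j := by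
              apply Finset.le_sup (f := fun i => P.scale θ (P.start θ).x i j)
              rw [mem_act]
              exact ⟨mem_row.1 hj, hi.trans_le (residual_anti (hmono (Nat.zero_le τ)) i)⟩
            have h8 : (P.scale θ (P.start θ).x i j : ℝ) ≤ P.top θ j := by exact_mod_cast h7
            have h9 : (0 : ℝ) ≤ P.scale θ (P.bidRun θ a τ).x i j := by positivity
            linarith
        _ = (P.row i).card * (1 + Real.logb 2 M) := by rw [Finset.sum_const, nsmul_eq_mul]
        _ ≤ _ := by
            have : ((P.row i).card : ℝ) ≤ θ.F := by exact_mod_cast h.row_card_le i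
            gcongr
    have h2' : ((P.bidRun θ a τ).e i : ℝ) = (P.start θ).e i +
      ∑ t ∈ Finset.range τ, ((if P.Raises θ (P.bidRun θ a t) (a t) i then (a t : ℝ) else 0)
        - P.rowCut θ (P.bidRun θ a t) (a t) i)
      - ((θ.Z : ℝ) + 3) * ∑ j ∈ P.row i,
        ((P.scale θ (P.start θ).x i j : ℝ) - P.scale θ (P.bidRun θ a τ).x i j) := by
      rw [h2]; push_cast; rfl
    rw [Finset.sum_sub_distrib] at h2'
    have h10 := mul_le_mul_of_nonneg_left h5 (show (0 : ℝ) ≤ (θ.Z : ℝ) + 3 by positivity)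
    have h11 : ((θ.Z : ℝ) + 3) * (θ.F * (1 + Real.logb 2 M)) ≤
        3 * (θ.Z + 1) * (θ.F * (1 + Real.logb 2 M)) := by
      have hZ : (0 : ℝ) ≤ θ.Z := by positivity
      gcongr
      linarith
    linarith
  · calc _ ≤ ∑ t ∈ Finset.range τ, 8 * P.rowProgress θ a i t := by
          apply Finset.sum_le_sum
          intro t ht
          split_ifs with hr
          · have := h.rowProgress_nonneg (hact t (Finset.mem_range.1 ht))
            linarith
          · exact h.inv_two_pow_le (hact t (Finset.mem_range.1 ht)) hr
      _ ≤ _ := by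
          rw [← Finset.mul_sum]
          linarith

end CoveringILP

/-! ### The schedule of raises and the number of iterations -/

/-- The factor `2 ^ raiseExp γ t` by which bids are raised in iteration `t`. -/
def raiseExp (γ : ℝ) (t : ℕ) : ℕ :=
  if t % 2 = 0 then 1 else 1 + ⌊γ * Real.logb 2 (t + 1)⌋₊

theorem one_le_raiseExp (γ : ℝ) (t : ℕ) : 1 ≤ raiseExp γ t := by
  unfold raiseExp; split_ifs <;> omega

theorem half_le_card_even (τ : ℕ) : τ ≤ 2 * ((Finset.range τ).filter fun t => t % 2 = 0).card := by
  have : (τ + 1) / 2 = ((Finset.range τ).filter fun t => t % 2 = 0).card := by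
    induction τ with
    | zero => rfl
    | succ τ ih =>
      rw [Finset.range_add_one, Finset.filter_insert]
      split_ifs with h
      · rw [Finset.card_insert_of_notMem (by simp), ← ih]; omega
      · rw [← ih]; omega
  omega

theorem card_odd_ge (s τ : ℕ) :
    τ / 2 ≤ ((Finset.range τ).filter fun t => t % 2 = 1 ∧ s ≤ t).card + (s + 1) / 2 := by
  induction τ with
  | zero => simp
  | succ τ ih =>
    rw [Finset.range_add_one, Finset.filter_insert]
    split_ifs with h
    · rw [Finset.card_insert_of_notMem (by simp)]; omega
    · omega

theorem logb_two_le {x : ℝ} (hx : 0 < x) : Real.logb 2 x ≤ 3 / 2 * x := by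
  unfold Real.logb
  have h2 := Real.log_two_gt_d9
  rw [div_le_iff₀ (by linarith)]
  have := Real.log_le_sub_one_of_pos hx
  nlinarith

theorem half_lt_logb {D : ℝ} (hD : 3 / 2 ≤ D) : 1 / 2 < Real.logb 2 D := by
  rw [Real.lt_logb_iff_rpow_lt (by norm_num) (by linarith), ← Real.sqrt_eq_rpow,
    Real.sqrt_lt' (by linarith)]
  nlinarith

theorem sqrt_le_div_logb {D : ℝ} (hD : 3 / 2 ≤ D) :
    Real.sqrt D ≤ 3 * (D / Real.logb 2 D) := by
  have h1 := half_lt_logb hD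
  have hs : 0 < Real.sqrt D := Real.sqrt_pos.2 (by linarith)
  have h2 : Real.logb 2 D = 2 * Real.logb 2 (Real.sqrt D) := by
    conv_lhs => rw [← Real.sq_sqrt (show 0 ≤ D by linarith)]
    rw [Real.logb_pow]
    norm_num
  have h3 := logb_two_le hs
  have h4 : Real.sqrt D * Real.sqrt D = D := Real.mul_self_sqrt (by linarith)
  rw [← mul_div_assoc, le_div_iff₀ (by linarith)]
  nlinarith

/-- An even iteration has factor `2`, so it contributes at least `1` to the first sum or `1 / 2` to
the second, and at least half of the iterations are even. -/
theorem sum_even_le {γ : ℝ} {τ : ℕ} {r : ℕ → Prop} {S₁ S₂ : ℝ}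
    (h₁ : ∑ t ∈ Finset.range τ, (if r t then (raiseExp γ t : ℝ) else 0) ≤ S₁)
    (h₂ : ∑ t ∈ Finset.range τ, (if r t then 0 else ((2 : ℝ) ^ raiseExp γ t)⁻¹) ≤ S₂) :
    (τ : ℝ) ≤ 2 * S₁ + 4 * S₂ := by
  have h3 : (((Finset.range τ).filter fun t => t % 2 = 0).card : ℝ) ≤
      ∑ t ∈ Finset.range τ, ((if r t then (raiseExp γ t : ℝ) else 0) +
        2 * (if r t then 0 else ((2 : ℝ) ^ raiseExp γ t)⁻¹)) := by
    rw [Finset.card_filter]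
    push_cast
    apply Finset.sum_le_sum
    intro t _
    by_cases hr : r t
    · rw [if_pos hr, if_pos hr]
      have : (1 : ℝ) ≤ raiseExp γ t := by exact_mod_cast one_le_raiseExp γ t
      split_ifs <;> linarith
    · rw [if_neg hr, if_neg hr]
      split_ifs with he
      · have : raiseExp γ t = 1 := if_pos he
        rw [this]; norm_num
      · positivity
  rw [Finset.sum_add_distrib, ← Finset.mul_sum] at h3
  have h4 := half_le_card_even τ
  have h5 : (τ : ℝ) ≤ 2 * (((Finset.range τ).filter fun t => t % 2 = 0).card : ℝ) := by
    exact_mod_cast h4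
  linarith

/-- Only odd iterations of the second half count. There a raise contributes at least `u`, and a
stuck iteration at least `1 / (2 * τ ^ γ)`. -/
theorem sum_odd_le {γ : ℝ} (hγ : 0 < γ) {τ : ℕ} {r : ℕ → Prop} {S₁ S₂ u : ℝ} (hu : 0 < u)
    (hτ : 0 < τ) (huτ : u ≤ γ * Real.logb 2 (τ / 2))
    (h₁ : ∑ t ∈ Finset.range τ, (if r t then (raiseExp γ t : ℝ) else 0) ≤ S₁)
    (h₂ : ∑ t ∈ Finset.range τ, (if r t then 0 else ((2 : ℝ) ^ raiseExp γ t)⁻¹) ≤ S₂) :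
    (τ : ℝ) ≤ 4 + 4 * (S₁ / u) + 8 * (τ : ℝ) ^ γ * S₂ := by
  have hτ' : (0 : ℝ) < τ := by exact_mod_cast hτ
  have h3 : (((Finset.range τ).filter fun t => t % 2 = 1 ∧ τ / 2 ≤ t).card : ℝ) ≤
      ∑ t ∈ Finset.range τ, (u⁻¹ * (if r t then (raiseExp γ t : ℝ) else 0) +
        2 * (τ : ℝ) ^ γ * (if r t then 0 else ((2 : ℝ) ^ raiseExp γ t)⁻¹)) := by
    rw [Finset.card_filter]
    push_cast
    apply Finset.sum_le_sum
    intro t ht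
    have htτ := Finset.mem_range.1 ht
    by_cases hto : t % 2 = 1 ∧ τ / 2 ≤ t
    · rw [if_pos hto]
      have ha : raiseExp γ t = 1 + ⌊γ * Real.logb 2 (t + 1)⌋₊ := if_neg (by omega)
      have hlog : 0 ≤ Real.logb 2 ((t : ℝ) + 1) :=
        Real.logb_nonneg (by norm_num) (by linarith [(Nat.cast_nonneg t : (0 : ℝ) ≤ t)])
      by_cases hr : r t
      · rw [if_pos hr, if_pos hr, mul_zero, add_zero, inv_mul_eq_div, le_div_iff₀ hu, one_mul]
        refine huτ.trans ?_
        have h4 : γ * Real.logb 2 ((τ : ℝ) / 2) ≤ γ * Real.logb 2 ((t : ℝ) + 1) := by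
          apply mul_le_mul_of_nonneg_left _ hγ.le
          apply Real.logb_le_logb_of_le (by norm_num) (by positivity)
          have : τ ≤ 2 * (t + 1) := by omega
          have : (τ : ℝ) ≤ 2 * (t + 1) := by exact_mod_cast this
          linarith
        have h5 := (Nat.lt_floor_add_one (γ * Real.logb 2 ((t : ℝ) + 1))).le
        rw [ha]
        push_cast
        linarith
      · rw [if_neg hr, if_neg hr, mul_zero, zero_add]
        rw [← div_eq_mul_inv, le_div_iff₀ (by positivity), one_mul, ha, pow_add, pow_one]
        have h6 : (2 : ℝ) ^ ⌊γ * Real.logb 2 ((t : ℝ) + 1)⌋₊ ≤ (τ : ℝ) ^ γ := by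
          calc (2 : ℝ) ^ ⌊γ * Real.logb 2 ((t : ℝ) + 1)⌋₊
              = (2 : ℝ) ^ ((⌊γ * Real.logb 2 ((t : ℝ) + 1)⌋₊ : ℕ) : ℝ) :=
                (Real.rpow_natCast _ _).symm
            _ ≤ (2 : ℝ) ^ (γ * Real.logb 2 ((t : ℝ) + 1)) := by
                apply Real.rpow_le_rpow_of_exponent_le (by norm_num)
                exact Nat.floor_le (mul_nonneg hγ.le hlog)
            _ = ((t : ℝ) + 1) ^ γ := by
                rw [mul_comm, Real.rpow_mul (by norm_num), Real.rpow_logb (by norm_num)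
                  (by norm_num) (by positivity)]
            _ ≤ _ := by
                apply Real.rpow_le_rpow (by positivity) _ hγ.le
                exact_mod_cast htτ
        linarith
    · rw [if_neg hto]
      split_ifs <;> positivity
  rw [Finset.sum_add_distrib, ← Finset.mul_sum, ← Finset.mul_sum] at h3
  have h4 := card_odd_ge (τ / 2) τ
  have h5 : τ ≤ 4 * ((Finset.range τ).filter fun t => t % 2 = 1 ∧ τ / 2 ≤ t).card + 4 := by omega
  have h6 : (τ : ℝ) ≤ 4 * (((Finset.range τ).filter fun t => t % 2 = 1 ∧ τ / 2 ≤ t).card : ℝ) + 4 := by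
    exact_mod_cast h5
  have h7 : u⁻¹ * ∑ t ∈ Finset.range τ, (if r t then (raiseExp γ t : ℝ) else 0) ≤ S₁ / u := by
    rw [inv_mul_eq_div]; gcongr
  have h8 : 2 * (τ : ℝ) ^ γ * ∑ t ∈ Finset.range τ,
      (if r t then 0 else ((2 : ℝ) ^ raiseExp γ t)⁻¹) ≤ 2 * (τ : ℝ) ^ γ * S₂ := by gcongr
  linarith

/-- The number of iterations, from the bounds on the raises and the stuck iterations. -/
theorem exists_iterations_le (A γ : ℝ) (hA : 1 ≤ A) (hγ : 0 < γ) :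
    ∃ C : ℝ, 0 < C ∧ ∀ (τ : ℕ) (r : ℕ → Prop) (D X G : ℝ), 3 / 2 ≤ D → 0 ≤ X → 0 ≤ G →
      G ≤ 2 + 2 * X →
      ∑ t ∈ Finset.range τ, (if r t then (raiseExp (min γ (1 / 2)) t : ℝ) else 0) ≤ A * (D + G) →
      ∑ t ∈ Finset.range τ, (if r t then 0 else ((2 : ℝ) ^ raiseExp (min γ (1 / 2)) t)⁻¹) ≤
        A * G →
      (τ : ℝ) ≤ C * (X + D / Real.logb 2 D + min D (X * D ^ γ)) := by
  set γ' := min γ (1 / 2) with hγ'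
  have hγ0 : 0 < γ' := lt_min hγ (by norm_num)
  set C₂ : ℝ := 12 + 16 * A / γ' + 384 * A * A with hC₂
  have hC₂0 : 0 < C₂ := by positivity
  refine ⟨48 * A + C₂, by positivity, ?_⟩
  intro τ r D X G hD hX hG hGX h₁ h₂
  have hlam := half_lt_logb hD
  set lam := Real.logb 2 D with hl
  have hD0 : 0 < D := by linarith
  have hsq := sqrt_le_div_logb hD
  rw [← hl] at hsq
  have hQ0 : 0 < D / lam := by positivity
  have hs1 : 1 ≤ Real.sqrt D := by
    rw [Real.one_le_sqrt]; linarith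
  have hmin0 : 0 ≤ min D (X * D ^ γ) := le_min hD0.le (by positivity)
  have hE := sum_even_le h₁ h₂
  -- If `D ≤ G`, the even iterations alone give `O(G)`, and the additive constant in `G ≤ 2 + 2 * X`
  -- is absorbed by `D / log D`. Otherwise they give `O(D)`, which serves one branch of the minimum
  -- and bounds `τ ^ γ'` by `O(D ^ γ')` for the other.
  by_cases hGD : D ≤ G
  · have h3 : (τ : ℝ) ≤ 48 * A * (X + D / lam) := by nlinarith
    have : 0 ≤ C₂ * (X + D / lam + min D (X * D ^ γ)) := by positivity
    have : 0 ≤ 48 * A * min D (X * D ^ γ) := by positivity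
    nlinarith
  · push Not at hGD
    have hE' : (τ : ℝ) ≤ 8 * A * D := by nlinarith
    have hkey : (τ : ℝ) ≤ C₂ * (D / lam + X * D ^ γ) := by
      have hXD : 0 ≤ X * D ^ γ := by positivity
      -- A `τ` of order `√D` is already within `D / log D`; for a larger one, `log (τ / 2)` is at
      -- least `log D / 2`.
      by_cases hsmall : (τ : ℝ) ≤ 4 * Real.sqrt D
      · have h4 : (τ : ℝ) ≤ 12 * (D / lam) := by linarith
        have h5 : (12 : ℝ) ≤ C₂ := by
          have : 0 ≤ 16 * A / γ' := by positivity
          have : 0 ≤ 384 * A * A := by positivity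
          linarith
        calc (τ : ℝ) ≤ 12 * (D / lam) := h4
          _ ≤ C₂ * (D / lam) := by gcongr
          _ ≤ _ := by gcongr; linarith
      · push Not at hsmall
        have hτ0 : (0 : ℝ) < τ := lt_trans (by positivity) hsmall
        have hu : γ' * (lam / 2) ≤ γ' * Real.logb 2 ((τ : ℝ) / 2) := by
          apply mul_le_mul_of_nonneg_left _ hγ0.le
          have h6 : lam / 2 = Real.logb 2 (Real.sqrt D) := by
            rw [Real.sqrt_eq_rpow, Real.logb_rpow_eq_mul_logb_of_pos hD0]; ring
          rw [h6]
          apply Real.logb_le_logb_of_le (by norm_num) (by linarith)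
          linarith
        have hO := sum_odd_le hγ0 (u := γ' * (lam / 2)) (by positivity) (by exact_mod_cast hτ0)
          hu h₁ h₂
        have h7 : A * (D + G) / (γ' * (lam / 2)) ≤ 4 * A / γ' * (D / lam) := by
          rw [div_le_iff₀ (by positivity)]
          have : 4 * A / γ' * (D / lam) * (γ' * (lam / 2)) = 2 * A * D := by
            field_simp; ring
          rw [this]
          nlinarith
        have h8 : (τ : ℝ) ^ γ' ≤ 8 * A * D ^ γ' := by
          calc (τ : ℝ) ^ γ' ≤ (8 * A * D) ^ γ' := Real.rpow_le_rpow hτ0.le hE' hγ0.le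
            _ = (8 * A) ^ γ' * D ^ γ' := Real.mul_rpow (by positivity) hD0.le
            _ ≤ (8 * A) ^ (1 : ℝ) * D ^ γ' := by
                gcongr
                · linarith
                · exact (min_le_right _ _).trans (by norm_num)
            _ = _ := by rw [Real.rpow_one]
        -- This is why the exponent is capped at `1 / 2`: the constant part of `G` contributes `D ^
        -- γ'`, which must not exceed the order of `D / log D`.
        have h9 : D ^ γ' ≤ 3 * (D / lam) := by
          refine le_trans ?_ hsq
          rw [Real.sqrt_eq_rpow]
          exact Real.rpow_le_rpow_of_exponent_le (by linarith) (min_le_right _ _)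
        have h10 : D ^ γ' ≤ D ^ γ :=
          Real.rpow_le_rpow_of_exponent_le (by linarith) (min_le_left _ _)
        have hp : 0 ≤ D ^ γ' := by positivity
        have h11 : 8 * (τ : ℝ) ^ γ' * (A * G) ≤ 128 * A * A * (3 * (D / lam) + X * D ^ γ) := by
          calc 8 * (τ : ℝ) ^ γ' * (A * G) ≤ 8 * (8 * A * D ^ γ') * (A * (2 + 2 * X)) := by gcongr
            _ = 128 * A * A * (D ^ γ' + X * D ^ γ') := by ring
            _ ≤ _ := by gcongr
        have h12 : (4 : ℝ) ≤ 12 * (D / lam) := by linarith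
        have h13 : 0 ≤ 12 + 16 * A / γ' := by positivity
        calc (τ : ℝ) ≤ 12 * (D / lam) + 4 * (4 * A / γ' * (D / lam)) +
              128 * A * A * (3 * (D / lam) + X * D ^ γ) := by linarith
          _ = (12 + 16 * A / γ' + 384 * A * A) * (D / lam) + 128 * A * A * (X * D ^ γ) := by ring
          _ ≤ (12 + 16 * A / γ' + 384 * A * A) * (D / lam) +
              (12 + 16 * A / γ' + 384 * A * A) * (X * D ^ γ) := by
              gcongr
              nlinarith [mul_pos (show 0 < A by linarith) (show 0 < A by linarith)]
          _ = _ := by rw [hC₂]; ring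
    rcases le_total D (X * D ^ γ) with hm | hm
    · rw [min_eq_left hm]
      have h14 : 0 ≤ C₂ * (X + D / lam + D) := by positivity
      have h15 : 0 ≤ 48 * A * (X + D / lam) := by positivity
      nlinarith
    · rw [min_eq_right hm]
      have h16 : 0 ≤ X * D ^ γ := by positivity
      have h17 : 0 ≤ 48 * A * (X + D / lam + X * D ^ γ) := by positivity
      have h18 : 0 ≤ C₂ * X := by positivity
      nlinarith

/-! ### Comparison of the two time bounds -/

theorem three_halves_le_logb {x : ℝ} : 3 / 2 ≤ Real.logb 2 (max 3 x) := by
  have h3 : (3 : ℝ) ≤ max 3 x := le_max_left _ _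
  rw [Real.le_logb_iff_rpow_le (by norm_num) (by linarith)]
  refine le_trans ?_ h3
  have h4 : (2 : ℝ) ^ (3 / 2 : ℝ) = Real.sqrt 8 := by
    rw [Real.sqrt_eq_rpow, show (8 : ℝ) = 2 ^ (3 : ℝ) by norm_num, ← Real.rpow_mul (by norm_num)]
    norm_num
  rw [h4, Real.sqrt_le_left (by norm_num)]
  norm_num

theorem third_le_div_logb {x : ℝ} :
    1 / 3 ≤ Real.logb 2 (max 3 x) / Real.logb 2 (Real.logb 2 (max 3 x)) := by
  have h := three_halves_le_logb (x := x)
  have h1 := sqrt_le_div_logb h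
  have h2 : 1 ≤ Real.sqrt (Real.logb 2 (max 3 x)) := by
    rw [Real.one_le_sqrt]; linarith
  linarith

theorem mul_one_add_logb_le {F ε : ℝ} (hF : 1 ≤ F) (hε : 0 < ε) (hε1 : ε ≤ 1) :
    0 ≤ Real.logb 2 (F / ε) ∧
    F * (1 + Real.logb 2 (F / ε)) ≤ 2 + 2 * (F * Real.logb 2 (F / ε)) := by
  have h1 : F ≤ F / ε := by
    rw [le_div_iff₀ hε]; nlinarith
  have h0 : 0 ≤ Real.logb 2 (F / ε) := Real.logb_nonneg (by norm_num) (by linarith)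
  refine ⟨h0, ?_⟩
  rcases le_total F 2 with h | h
  · nlinarith
  · have : 1 ≤ Real.logb 2 (F / ε) := by
      rw [Real.le_logb_iff_rpow_le (by norm_num) (by linarith), Real.rpow_one]
      linarith
    nlinarith

/-- Everything in `D` beyond `log Δ` is at most `2 * F`. The exponent budget is `1.01 = 1.009 +
0.001`: the factor `log F` costs `F ^ 0.009`, and `D ^ γ` costs `F ^ 0.001`. -/
theorem simplifiedTime_ge {f Δ M ε γ : ℝ} (hf : 1 ≤ f) (hΔ : 1 ≤ Δ) (hM : 1 ≤ M) (hε : 0 < ε)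
    (hε1 : ε ≤ 1) (hγ : 0 < γ) (hγ1 : γ ≤ 0.001) :
    mwhvcTime γ (f * (1 + Real.logb 2 M)) (2 ^ f * M * Δ) ε ≤
      1000 * simplifiedTime f Δ M ε := by
  have hl : 0 ≤ Real.logb 2 M := Real.logb_nonneg (by norm_num) hM
  set F := f * (1 + Real.logb 2 M) with hF
  have hF1 : 1 ≤ F := by rw [hF]; nlinarith
  have hX0 := (mul_one_add_logb_le hF1 hε hε1).1
  set d := Real.logb 2 (max 3 Δ) with hd
  set D := Real.logb 2 (max 3 (2 ^ f * M * Δ)) with hD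
  have hd32 : 3 / 2 ≤ d := three_halves_le_logb
  have hD32 : 3 / 2 ≤ D := three_halves_le_logb
  have h2f : (1 : ℝ) ≤ 2 ^ f := Real.one_le_rpow (by norm_num) (by linarith)
  have h2fM : (1 : ℝ) ≤ 2 ^ f * M := by nlinarith
  have hm3 : (3 : ℝ) ≤ max 3 Δ := le_max_left _ _
  have hDd : D ≤ 2 * F + d := by
    have h1 : max 3 (2 ^ f * M * Δ) ≤ 2 ^ f * M * max 3 Δ := by
      apply max_le
      · nlinarith
      · exact mul_le_mul_of_nonneg_left (le_max_right _ _) (by linarith)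
    have h2 := Real.logb_le_logb_of_le (b := 2) (by norm_num)
      (lt_of_lt_of_le (by norm_num) (le_max_left 3 (2 ^ f * M * Δ))) h1
    rw [Real.logb_mul (by positivity) (by positivity), Real.logb_mul (by positivity)
      (by positivity), Real.logb_rpow (by norm_num) (by norm_num)] at h2
    have : f + Real.logb 2 M ≤ 2 * F := by rw [hF]; nlinarith
    linarith
  have hdD : d ≤ D := by
    apply Real.logb_le_logb_of_le (by norm_num) (by linarith)
    apply max_le_max le_rfl
    nlinarith
  set E := 1 + Real.logb 2 ε⁻¹ with hE
  have hE1 : 1 ≤ E := by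
    have : 0 ≤ Real.logb 2 ε⁻¹ := Real.logb_nonneg (by norm_num) ((one_le_inv₀ hε).2 hε1)
    linarith
  have hF0 : 0 < F := by linarith
  have hX : F * Real.logb 2 (F / ε) ≤ 167 * (F ^ (1.009 : ℝ) * E) := by
    -- The constant is `(3 / 2) / 0.009`, rounded up.
    have h1 : Real.logb 2 F ≤ 167 * F ^ (0.009 : ℝ) := by
      have h2 := logb_two_le (show 0 < F ^ (0.009 : ℝ) by positivity)
      rw [Real.logb_rpow_eq_mul_logb_of_pos hF0] at h2
      have : 0 < F ^ (0.009 : ℝ) := by positivity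
      norm_num at h2 ⊢
      linarith
    have h3 : Real.logb 2 (F / ε) = Real.logb 2 F + (E - 1) := by
      rw [div_eq_mul_inv, Real.logb_mul hF0.ne' (inv_ne_zero hε.ne')]
      ring
    have h4 : 1 ≤ F ^ (0.009 : ℝ) := Real.one_le_rpow hF1 (by norm_num)
    have h5 : F ^ (1.009 : ℝ) = F * F ^ (0.009 : ℝ) := by
      rw [← Real.rpow_one_add' hF0.le (by norm_num)]; norm_num
    rw [h3, h5]
    have h6 : Real.logb 2 F + (E - 1) ≤ 167 * (F ^ (0.009 : ℝ) * E) := by nlinarith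
    calc F * (Real.logb 2 F + (E - 1)) ≤ F * (167 * (F ^ (0.009 : ℝ) * E)) := by gcongr
      _ = _ := by ring
  have hd1 : 1 ≤ d ^ (0.01 : ℝ) := Real.one_le_rpow (by linarith) (by norm_num)
  set S := F ^ (1.01 : ℝ) * E * d ^ (0.01 : ℝ) with hS
  have hFS : F ^ (1.009 : ℝ) * E ≤ S := by
    have h1 : F ^ (1.009 : ℝ) ≤ F ^ (1.01 : ℝ) :=
      Real.rpow_le_rpow_of_exponent_le hF1 (by norm_num)
    calc F ^ (1.009 : ℝ) * E ≤ F ^ (1.01 : ℝ) * E := by gcongr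
      _ ≤ S := le_mul_of_one_le_right (by positivity) hd1
  have hFS' : F ≤ S := by
    refine le_trans ?_ hFS
    have h1 : F ≤ F ^ (1.009 : ℝ) := by
      conv_lhs => rw [← Real.rpow_one F]
      exact Real.rpow_le_rpow_of_exponent_le hF1 (by norm_num)
    nlinarith
  have hDS : D / Real.logb 2 D ≤ d / Real.logb 2 d + 4 * S := by
    have h1 := half_lt_logb hd32
    have h2 : Real.logb 2 d ≤ Real.logb 2 D :=
      Real.logb_le_logb_of_le (by norm_num) (by linarith) hdD
    calc D / Real.logb 2 D ≤ (2 * F + d) / Real.logb 2 d := by gcongr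
      _ = d / Real.logb 2 d + 2 * F / Real.logb 2 d := by rw [add_div]; ring
      _ ≤ d / Real.logb 2 d + 4 * F := by
          gcongr
          rw [div_le_iff₀ (by linarith)]
          nlinarith
      _ ≤ _ := by gcongr
  have hmin : min D (F * Real.logb 2 (F / ε) * D ^ γ) ≤ 668 * S := by
    refine (min_le_right _ _).trans ?_
    have h1 : D ^ γ ≤ 4 * (F ^ (0.001 : ℝ) * d ^ (0.01 : ℝ)) := by
      calc D ^ γ ≤ D ^ (0.001 : ℝ) := Real.rpow_le_rpow_of_exponent_le (by linarith) hγ1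
        _ ≤ (4 * (F * d)) ^ (0.001 : ℝ) :=
            Real.rpow_le_rpow (by linarith) (by nlinarith) (by norm_num)
        _ = 4 ^ (0.001 : ℝ) * (F ^ (0.001 : ℝ) * d ^ (0.001 : ℝ)) := by
            rw [Real.mul_rpow (by norm_num) (by positivity), Real.mul_rpow hF0.le (by linarith)]
        _ ≤ 4 ^ (1 : ℝ) * (F ^ (0.001 : ℝ) * d ^ (0.01 : ℝ)) := by
            gcongr
            · norm_num
            · norm_num
            · linarith
            · norm_num
        _ = _ := by rw [Real.rpow_one]
    calc F * Real.logb 2 (F / ε) * D ^ γ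
        ≤ 167 * (F ^ (1.009 : ℝ) * E) * (4 * (F ^ (0.001 : ℝ) * d ^ (0.01 : ℝ))) := by gcongr
      _ = 668 * ((F ^ (1.009 : ℝ) * F ^ (0.001 : ℝ)) * E * d ^ (0.01 : ℝ)) := by ring
      _ = 668 * S := by rw [← Real.rpow_add hF0]; norm_num [hS]
  have hfin : mwhvcTime γ F (2 ^ f * M * Δ) ε = F * Real.logb 2 (F / ε) + D / Real.logb 2 D +
    min D (F * Real.logb 2 (F / ε) * D ^ γ) := rfl
  have hsimp : simplifiedTime f Δ M ε = d / Real.logb 2 d + S := rfl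
  rw [hfin, hsimp]
  have hq : 0 ≤ d / Real.logb 2 d := le_trans (by norm_num) (third_le_div_logb (x := Δ))
  have hS0 : 0 ≤ S := by positivity
  linarith

/-! ### From the tolerance to the number of iterations -/

/-- The number of halvings that a tolerance `β` allows. -/
def tolExp (β : ℝ) : ℕ := Nat.clog 2 ⌈1 / β⌉₊

theorem tolExp_spec {β : ℝ} (hβ : 0 < β) : (2 : ℝ)⁻¹ ^ tolExp β ≤ β := by
  have h1 : 1 / β ≤ 2 ^ tolExp β := by
    have h := Nat.le_pow_clog (b := 2) (by norm_num) ⌈1 / β⌉₊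
    refine (Nat.le_ceil _).trans ?_
    calc (⌈1 / β⌉₊ : ℝ) ≤ ((2 ^ tolExp β : ℕ) : ℝ) := Nat.cast_le.2 h
      _ = _ := by push_cast; rfl
  rw [inv_pow, inv_le_comm₀ (by positivity) hβ]
  simpa using h1

theorem tolExp_le {f ε ε' : ℝ} (hf : 1 ≤ f) (hε : 0 < ε) (hε1 : ε ≤ 1) (hεε' : ε ≤ ε') :
    (tolExp (ε' / (f + ε')) : ℝ) + 1 ≤ 4 * (1 + Real.logb 2 (f / ε)) := by
  have hfe : 1 ≤ f / ε := by rw [le_div_iff₀ hε]; linarith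
  have hlog : 0 ≤ Real.logb 2 (f / ε) := Real.logb_nonneg (by norm_num) hfe
  have h1 : 1 / (ε' / (f + ε')) ≤ 2 * (f / ε) := by
    rw [one_div_div, add_div, div_self (by linarith)]
    have : f / ε' ≤ f / ε := by gcongr
    linarith
  have h1' : 1 < 1 / (ε' / (f + ε')) := by
    rw [one_div_div, lt_div_iff₀ (by linarith)]; linarith
  have h2 : 1 < ⌈1 / (ε' / (f + ε'))⌉₊ := by
    rw [Nat.lt_ceil]
    exact_mod_cast h1'
  have h3 := Nat.pow_pred_clog_lt_self (b := 2) (by norm_num) h2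
  have h4 : 0 < Nat.clog 2 ⌈1 / (ε' / (f + ε'))⌉₊ := Nat.clog_pos (by norm_num) h2
  have h5 : ((2 : ℝ) ^ (tolExp (ε' / (f + ε')) - 1)) < ⌈1 / (ε' / (f + ε'))⌉₊ := by
    exact_mod_cast h3
  have h6 := Nat.ceil_lt_add_one (show 0 ≤ 1 / (ε' / (f + ε')) by linarith)
  have h7 : ((2 : ℝ) ^ (tolExp (ε' / (f + ε')) - 1)) ≤ 2 ^ 2 * (f / ε) := by linarith
  have h8 := Real.logb_le_logb_of_le (b := 2) (by norm_num) (by positivity) h7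
  rw [Real.logb_mul (by norm_num) (by linarith), ← Real.rpow_natCast, ← Real.rpow_natCast,
    Real.logb_rpow (by norm_num) (by norm_num), Real.logb_rpow (by norm_num) (by norm_num)] at h8
  have h9 : ((tolExp (ε' / (f + ε')) - 1 : ℕ) : ℝ) = (tolExp (ε' / (f + ε')) : ℝ) - 1 := by
    rw [Nat.cast_sub (by unfold tolExp; omega)]; simp
  rw [h9] at h8
  push_cast at h8
  linarith

namespace CoveringILP

variable {n m : ℕ}

/-- The number of iterations of the bidding process is within the claimed bound. -/
theorem exists_active_time_le (γ : ℝ) (hγ : 0 < γ) :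
    ∃ C : ℝ, 0 < C ∧ ∀ (n m : ℕ) (P : CoveringILP m n) (θ : Tuning) (M Δ ε ε' : ℝ),
      P.Fits θ → 0 < ε → ε ≤ 1 → ε ≤ ε' → θ.Z = tolExp (ε' / (θ.F + ε')) → 1 ≤ M →
      (∀ i j, P.A i j ≠ 0 → P.b i / P.A i j ≤ M) → 1 ≤ Δ → (∀ j, ((P.col j).card : ℝ) ≤ Δ) →
      ∀ (i : Fin m) (τ : ℕ), (P.row i).Nonempty →
        0 < P.residual (P.bidRun θ (raiseExp (min γ (1 / 2))) τ).x i →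
        (τ : ℝ) ≤ C * mwhvcTime γ (θ.F * (1 + Real.logb 2 M)) (2 ^ (θ.F : ℝ) * M * Δ) ε := by
  obtain ⟨C, hC, hmain⟩ := exists_iterations_le 2000 γ (by norm_num) hγ
  refine ⟨C, hC, ?_⟩
  intro n m P θ M Δ ε ε' h hε hε1 hεε' hZ hM hA hΔ1 hΔ i τ hne hi
  have hl : 0 ≤ Real.logb 2 M := Real.logb_nonneg (by norm_num) hM
  have hlΔ : 0 ≤ Real.logb 2 Δ := Real.logb_nonneg (by norm_num) hΔ1
  have hF1 : (1 : ℝ) ≤ θ.F := by exact_mod_cast h.F_pos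
  set F' := (θ.F : ℝ) * (1 + Real.logb 2 M) with hF'
  have hF'F : (θ.F : ℝ) ≤ F' := by rw [hF']; nlinarith
  have hF'1 : 1 ≤ F' := by linarith
  obtain ⟨hX0, hG⟩ := mul_one_add_logb_le hF'1 hε hε1
  obtain ⟨h₁, h₂⟩ := h.accounting hM hA hi hne hΔ
  have hZ' : (θ.Z : ℝ) + 1 ≤ 4 * (1 + Real.logb 2 (F' / ε)) := by
    rw [hZ]
    refine (tolExp_le hF1 hε hε1 hεε').trans ?_
    have : Real.logb 2 ((θ.F : ℝ) / ε) ≤ Real.logb 2 (F' / ε) := by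
      apply Real.logb_le_logb_of_le (by norm_num) (by positivity)
      gcongr
    linarith
  have hZG : ((θ.Z : ℝ) + 1) * F' ≤ 4 * (F' * (1 + Real.logb 2 (F' / ε))) := by
    calc _ ≤ (4 * (1 + Real.logb 2 (F' / ε))) * F' := by gcongr
      _ = _ := by ring
  have hD : Real.logb 2 M + Real.logb 2 Δ ≤ Real.logb 2 (max 3 (2 ^ (θ.F : ℝ) * M * Δ)) := by
    have h2F : (1 : ℝ) ≤ 2 ^ (θ.F : ℝ) := Real.one_le_rpow (by norm_num) (by linarith)
    rw [← Real.logb_mul (by linarith) (by linarith)]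
    apply Real.logb_le_logb_of_le (by norm_num) (by positivity)
    refine le_trans ?_ (le_max_right _ _)
    have : M * Δ ≤ 2 ^ (θ.F : ℝ) * (M * Δ) := le_mul_of_one_le_left (by positivity) h2F
    linarith
  have hD32 := three_halves_le_logb (x := 2 ^ (θ.F : ℝ) * M * Δ)
  have hG0 : 0 ≤ F' * (1 + Real.logb 2 (F' / ε)) := by positivity
  exact hmain τ (fun t => P.Raises θ (P.bidRun θ (raiseExp (min γ (1 / 2))) t)
    (raiseExp (min γ (1 / 2)) t) i) _ (F' * Real.logb 2 (F' / ε))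
    (F' * (1 + Real.logb 2 (F' / ε))) hD32 (by positivity) hG0 hG
    (h₁.trans (by nlinarith)) (h₂.trans (by nlinarith))

end CoveringILP

/-! ### Messages and node states -/

/-- A natural number, written in binary and cut to `bw` bits. -/
def encodeNat (bw N : ℕ) : Message bw :=
  ⟨N.bits.take bw, by rw [List.length_take]; exact min_le_left _ _⟩

def decodeNat {bw : ℕ} (M : Message bw) : ℕ := Nat.ofDigits 2 (M.1.map fun b => cond b 1 0)

theorem decodeNat_encodeNat {bw N : ℕ} (h : N < 2 ^ bw) : decodeNat (encodeNat bw N) = N := by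
  unfold decodeNat encodeNat
  have h1 : N.bits.length ≤ bw := by
    rw [Nat.size_eq_bits_len]; exact Nat.size_le.2 h
  simp only
  rw [List.take_of_length_le h1, ← Nat.digits_two_eq_bits, Nat.ofDigits_digits]

theorem Nat.pair_lt_two_pow {x y E : ℕ} (hx : x < 2 ^ E) (hy : y < 2 ^ E) :
    Nat.pair x y < 2 ^ (2 * E) := by
  refine (Nat.pair_lt_max_add_one_sq x y).trans_le ?_
  rw [mul_comm, pow_mul]
  apply Nat.pow_le_pow_left
  have := max_lt hx hy
  omega

def shortNum (K : ℕ) (x : ℝ) : ℕ := if h : IsShort K x then h.choose else 0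

def shortDen (K : ℕ) (x : ℝ) : ℕ := if h : IsShort K x then h.choose_spec.choose else 0

theorem shortNum_div_shortDen {K : ℕ} {x : ℝ} (h : IsShort K x) :
    shortNum K x < 2 ^ K ∧ shortDen K x < 2 ^ K ∧
      (shortNum K x : ℝ) / (shortDen K x : ℝ) = x := by
  have := h.choose_spec.choose_spec
  unfold shortNum shortDen
  rw [dif_pos h, dif_pos h]
  exact ⟨this.1, this.2.2.1, this.2.2.2.symm⟩

/-- What a constraint node knows: its right-hand side, its row, and the values of its variables. -/
structure RowView (n : ℕ) where
  b : ℝ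
  a : Fin n → ℝ
  x : Fin n → ℕ

def RowView.residual {n : ℕ} (R : RowView n) : ℝ := R.b - ∑ j, R.a j * (R.x j : ℝ)

def RowView.scale {n : ℕ} (R : RowView n) (F : ℕ) (j : Fin n) : ℕ := scaleOf F R.residual (R.a j)

/-- The states of the nodes. The states `varA`, …, `varD` and `rowA`, …, `rowD` belong to the four
rounds of an iteration; the last argument of most of them is the number of the iteration. -/
inductive NodeState (n m : ℕ) : Type
  | varInit (w : ℝ) (c : Fin m → ℝ)
  | varWait (w : ℝ)
  | varA (V : VarView m) (t : ℕ)
  | varB (V : VarView m) (t : ℕ)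
  | varC (V : VarView m) (t : ℕ)
  | varD (V : VarView m) (t : ℕ)
  | varHalt (x : ℕ)
  | rowInit (b : ℝ)
  | rowReady (R : RowView n) (U : ℕ)
  | rowA (R : RowView n) (t : ℕ)
  | rowB (R : RowView n) (r : Prop) (t : ℕ)
  | rowC (R : RowView n) (t : ℕ)
  | rowD (R : RowView n) (N t : ℕ)
  | rowHalt

namespace NodeState

variable {n m : ℕ}

/-- The content of the message to a neighbour. -/
def msg (θ : Tuning) (a : ℕ → ℕ) : NodeState n m → Fin n ⊕ Fin m → Option ℕ
  | varInit w c, Sum.inr i => some (Nat.pair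
      (Nat.pair (shortNum θ.K (c i)) (shortDen θ.K (c i)))
      (Nat.pair (startCost θ.K (Finset.univ.filter fun i => c i ≠ 0).card w)
        (if w = 0 then 1 else 0)))
  | varA V t, Sum.inr i => some (if V.Stuck (a t) i then 1 else 0)
  -- A value of `2 ^ (2 * K)` already satisfies every adjacent constraint, so the cap loses nothing
  -- and keeps the message short.
  | varC V _, Sum.inr i => some (Nat.pair (min V.x (2 ^ (2 * θ.K))) (V.maxCut θ.Z i))
  | rowReady R U, Sum.inl j => some (Nat.pair U (R.scale θ.F j))
  | rowB _ r _, Sum.inl _ => some (if r then 1 else 0)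
  | rowD R N _, Sum.inl j => some (Nat.pair N (R.scale θ.F j))
  | _, _ => none

/-- The variable node after the constraints `i` with `f i ≠ none` have sent bid costs and scales. -/
def varStart (θ : Tuning) (w : ℝ) (f : Fin m → Option ℕ) : VarView m where
  w := w
  x := startValue θ.K w
  C _ := 0
  top := (Finset.univ.filter fun i => (f i).isSome).sup fun i => (Nat.unpair ((f i).getD 0)).2
  act := Finset.univ.filter fun i => (f i).isSome
  e i := if (f i).isSome then (θ.K : ℤ) - ((Nat.unpair ((f i).getD 0)).1 : ℕ) else 0
  k i := if (f i).isSome then (Nat.unpair ((f i).getD 0)).2 else 0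

def varUpdate (V : VarView m) (f : Fin m → Option ℕ) : VarView m :=
  { V with
    act := Finset.univ.filter fun i => (f i).isSome
    e := fun i => if (f i).isSome then V.e i - ((Nat.unpair ((f i).getD 0)).1 : ℕ) else 0
    k := fun i => if (f i).isSome then (Nat.unpair ((f i).getD 0)).2 else 0 }

def rowStart (θ : Tuning) (b : ℝ) (f : Fin n → Option ℕ) : RowView n where
  b := b
  a j := if (f j).isSome then
      ((Nat.unpair (Nat.unpair ((f j).getD 0)).1).1 : ℝ) /
        ((Nat.unpair (Nat.unpair ((f j).getD 0)).1).2 : ℝ)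
    else 0
  x j := if (f j).isSome ∧ (Nat.unpair (Nat.unpair ((f j).getD 0)).2).2 = 1 then 2 ^ (2 * θ.K)
    else 0

def rowStartCost (f : Fin n → Option ℕ) : ℕ :=
  (Finset.univ.filter fun j => (f j).isSome).sup fun j =>
    (Nat.unpair (Nat.unpair ((f j).getD 0)).2).1

def rowUpdate (R : RowView n) (f : Fin n → Option ℕ) : RowView n :=
  { R with x := fun j => if (f j).isSome then (Nat.unpair ((f j).getD 0)).1 else 0 }

/-- The truncated subtraction is exact because scales never increase along a run, and variables
outside the row contribute `0`. Only this decrement is sent: each variable keeps the exponents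
itself. -/
def rowUpdateCost (θ : Tuning) (R : RowView n) (f : Fin n → Option ℕ) : ℕ :=
  ((Finset.univ.filter fun j => (f j).isSome).sup fun j => (Nat.unpair ((f j).getD 0)).2) +
    (θ.Z + 3) * ∑ j, (R.scale θ.F j - (rowUpdate R f).scale θ.F j)

/-- The next state, from the numbers received from variables (`f`) and constraints (`h`). -/
def next (θ : Tuning) (a : ℕ → ℕ) (f : Fin n → Option ℕ) (h : Fin m → Option ℕ) :
    NodeState n m → NodeState n m
  | varInit w _ => varWait w
  | varWait w => if (varStart θ w h).act.Nonempty then varA (varStart θ w h) 0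
      else varHalt (varStart θ w h).x
  | varA V t => varB V t
  | varB V t => varC ((V.raise (a t) fun i => h i = some 1).fill θ.β) t
  | varC V t => varD V t
  | varD V t => if (varUpdate V h).act.Nonempty then varA (varUpdate V h) (t + 1) else varHalt V.x
  | varHalt x => varHalt x
  | rowInit b => if 0 < (rowStart θ b f).residual then rowReady (rowStart θ b f) (rowStartCost f)
      else rowHalt
  | rowReady R _ => rowA R 0
  | rowA R t => rowB R (∀ j, f j ≠ some 1) t
  | rowB R _ t => rowC R t
  | rowC R t => if 0 < (rowUpdate R f).residual then rowD (rowUpdate R f) (rowUpdateCost θ R f) t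
      else rowHalt
  | rowD R _ t => rowA R (t + 1)
  | rowHalt => rowHalt

def out : NodeState n m → Option ℕ
  | varHalt x => some x
  | rowHalt => some 0
  | _ => none

end NodeState

/-- The bidding process as a message-passing program. -/
def bidAlg (n m bw : ℕ) (θ : Tuning) (a : ℕ → ℕ) : CongestAlg n m bw where
  State := NodeState n m
  initVar _ w c := .varInit w c
  initCon _ b _ := .rowInit b
  send s u := (s.msg θ a u).map (encodeNat bw)
  recv s f := s.next θ a (fun j => (f (Sum.inl j)).map decodeNat)
    (fun i => (f (Sum.inr i)).map decodeNat)
  output := NodeState.out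

/-! ### Simulation of one iteration by four rounds -/

namespace CoveringILP

variable {n m bw : ℕ} {P : CoveringILP m n} {θ : Tuning} {a : ℕ → ℕ}

theorem network_adj_inl_inr {j : Fin n} {i : Fin m} :
    P.network.Adj (Sum.inl j) (Sum.inr i) ↔ P.A i j ≠ 0 := by
  simp [network, SimpleGraph.fromRel_adj]

theorem network_adj_inr_inl {j : Fin n} {i : Fin m} :
    P.network.Adj (Sum.inr i) (Sum.inl j) ↔ P.A i j ≠ 0 := by
  rw [SimpleGraph.adj_comm, network_adj_inl_inr]

/-- The numbers that variable `j` receives if the constraints are in the states `s`. -/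
def fromRows (P : CoveringILP m n) (θ : Tuning) (a : ℕ → ℕ) (s : Fin n ⊕ Fin m → NodeState n m)
    (j : Fin n) (i : Fin m) : Option ℕ :=
  if P.A i j ≠ 0 then (s (Sum.inr i)).msg θ a (Sum.inl j) else none

def fromVars (P : CoveringILP m n) (θ : Tuning) (a : ℕ → ℕ) (s : Fin n ⊕ Fin m → NodeState n m)
    (i : Fin m) (j : Fin n) : Option ℕ :=
  if P.A i j ≠ 0 then (s (Sum.inl j)).msg θ a (Sum.inr i) else none

/-- All messages fit into the bandwidth. -/
def Narrow (P : CoveringILP m n) (θ : Tuning) (a : ℕ → ℕ) (bw : ℕ)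
    (s : Fin n ⊕ Fin m → NodeState n m) : Prop :=
  ∀ u v N, P.network.Adj u v → (s u).msg θ a v = some N → N < 2 ^ bw

theorem msg_eq_none_of_out {s : NodeState n m} (h : ¬(s.out).isNone) (u : Fin n ⊕ Fin m) :
    s.msg θ a u = none := by
  cases s <;> first | rfl | exact absurd rfl h

/-- Under `Narrow` no message is truncated, and halted states have nothing to say, so coding and
halting become invisible. -/
theorem map_decode_msg {s : Fin n ⊕ Fin m → NodeState n m} (hs : P.Narrow θ a bw s)
    (u v : Fin n ⊕ Fin m) :
    (if P.network.Adj u v ∧ ((bidAlg n m bw θ a).output (s u)).isNone then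
      (bidAlg n m bw θ a).send (s u) v else none).map decodeNat =
      if P.network.Adj u v then (s u).msg θ a v else none := by
  by_cases hadj : P.network.Adj u v
  · rw [if_pos hadj]
    by_cases ho : ((s u).out).isNone
    · rw [if_pos ⟨hadj, ho⟩]
      change (((s u).msg θ a v).map (encodeNat bw)).map decodeNat = _
      cases hm : (s u).msg θ a v with
      | none => rfl
      | some N =>
        simp only [Option.map_some]
        rw [decodeNat_encodeNat (hs u v N hadj hm)]
    · rw [if_neg (fun h => ho h.2), msg_eq_none_of_out ho]
      rfl
  · rw [if_neg hadj, if_neg (fun h => hadj h.1)]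
    rfl

theorem round_inl {s : Fin n ⊕ Fin m → NodeState n m} (hs : P.Narrow θ a bw s) (j : Fin n) :
    (bidAlg n m bw θ a).round P s (Sum.inl j) =
      (s (Sum.inl j)).next θ a (fun _ => none) (P.fromRows θ a s j) := by
  unfold CongestAlg.round
  by_cases ho : ((s (Sum.inl j)).out).isSome
  · refine (if_pos (show ((bidAlg n m bw θ a).output (s (Sum.inl j))).isSome from ho)).trans ?_
    cases hsj : s (Sum.inl j) <;> rw [hsj] at ho <;> first | rfl | cases ho
  · refine (if_neg (show ¬((bidAlg n m bw θ a).output (s (Sum.inl j))).isSome from ho)).trans ?_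
    change NodeState.next θ a _ _ _ = _
    congr 1
    · funext j'
      rw [map_decode_msg hs, if_neg]
      simp [network, SimpleGraph.fromRel_adj]
    · funext i
      rw [map_decode_msg hs]
      exact if_congr network_adj_inr_inl rfl rfl

theorem round_inr {s : Fin n ⊕ Fin m → NodeState n m} (hs : P.Narrow θ a bw s) (i : Fin m) :
    (bidAlg n m bw θ a).round P s (Sum.inr i) =
      (s (Sum.inr i)).next θ a (P.fromVars θ a s i) (fun _ => none) := by
  unfold CongestAlg.round
  by_cases ho : ((s (Sum.inr i)).out).isSome
  · refine (if_pos (show ((bidAlg n m bw θ a).output (s (Sum.inr i))).isSome from ho)).trans ?_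
    cases hsj : s (Sum.inr i) <;> rw [hsj] at ho <;> first | rfl | cases ho
  · refine (if_neg (show ¬((bidAlg n m bw θ a).output (s (Sum.inr i))).isSome from ho)).trans ?_
    change NodeState.next θ a _ _ _ = _
    congr 1
    · funext j
      rw [map_decode_msg hs]
      exact if_congr network_adj_inl_inr rfl rfl
    · funext i'
      rw [map_decode_msg hs, if_neg]
      simp [network, SimpleGraph.fromRel_adj]

def rowView (P : CoveringILP m n) (g : BidState n m) (i : Fin m) : RowView n where
  b := P.b i
  a := P.A i
  x j := if P.A i j ≠ 0 then g.x j else 0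

theorem rowView_residual (P : CoveringILP m n) (g : BidState n m) (i : Fin m) :
    (P.rowView g i).residual = P.residual g.x i := by
  unfold RowView.residual residual rowView
  congr 1
  apply Finset.sum_congr rfl
  intro j _
  simp only
  split_ifs with h
  · rfl
  · rw [not_not] at h; rw [h]; simp

theorem rowView_scale (P : CoveringILP m n) (θ : Tuning) (g : BidState n m) (i : Fin m)
    (j : Fin n) : (P.rowView g i).scale θ.F j = P.scale θ g.x i j := by
  unfold RowView.scale scale
  rw [rowView_residual]
  rfl

/-- The total reduction of the bid of constraint `i`. -/
def rowCost (P : CoveringILP m n) (θ : Tuning) (a : ℕ → ℕ) (t : ℕ) (i : Fin m) : ℕ :=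
  P.rowCut θ (P.bidRun θ a t) (a t) i + (θ.Z + 3) * ∑ j,
    (P.scale θ (P.bidRun θ a t).x i j - P.scale θ (P.bidRun θ a (t + 1)).x i j)

/-- The states of the nodes before each of the four rounds of iteration `t`. -/
def nodesA (P : CoveringILP m n) (θ : Tuning) (a : ℕ → ℕ) (t : ℕ) : Fin n ⊕ Fin m → NodeState n m
  | Sum.inl j => if (P.act (P.bidRun θ a t).x j).Nonempty then .varA (P.view θ (P.bidRun θ a t) j) t
      else .varHalt ((P.bidRun θ a t).x j)
  | Sum.inr i => if 0 < P.residual (P.bidRun θ a t).x i then .rowA (P.rowView (P.bidRun θ a t) i) t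
      else .rowHalt

def nodesB (P : CoveringILP m n) (θ : Tuning) (a : ℕ → ℕ) (t : ℕ) : Fin n ⊕ Fin m → NodeState n m
  | Sum.inl j => if (P.act (P.bidRun θ a t).x j).Nonempty then .varB (P.view θ (P.bidRun θ a t) j) t
      else .varHalt ((P.bidRun θ a t).x j)
  | Sum.inr i => if 0 < P.residual (P.bidRun θ a t).x i then
      .rowB (P.rowView (P.bidRun θ a t) i) (P.Raises θ (P.bidRun θ a t) (a t) i) t
      else .rowHalt

def nodesC (P : CoveringILP m n) (θ : Tuning) (a : ℕ → ℕ) (t : ℕ) : Fin n ⊕ Fin m → NodeState n m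
  | Sum.inl j => if (P.act (P.bidRun θ a t).x j).Nonempty then
      .varC (P.filled θ (P.bidRun θ a t) (a t) j) t
      else .varHalt ((P.bidRun θ a t).x j)
  | Sum.inr i => if 0 < P.residual (P.bidRun θ a t).x i then .rowC (P.rowView (P.bidRun θ a t) i) t
      else .rowHalt

def nodesD (P : CoveringILP m n) (θ : Tuning) (a : ℕ → ℕ) (t : ℕ) : Fin n ⊕ Fin m → NodeState n m
  | Sum.inl j => if (P.act (P.bidRun θ a t).x j).Nonempty then
      .varD (P.filled θ (P.bidRun θ a t) (a t) j) t
      else .varHalt ((P.bidRun θ a t).x j)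
  | Sum.inr i => if 0 < P.residual (P.bidRun θ a (t + 1)).x i then
      .rowD (P.rowView (P.bidRun θ a (t + 1)) i) (P.rowCost θ a t i) t
      else .rowHalt

theorem act_nonempty {x : Fin n → ℕ} {i : Fin m} {j : Fin n} (hA : P.A i j ≠ 0)
    (hi : 0 < P.residual x i) : (P.act x j).Nonempty := ⟨i, mem_act.2 ⟨hA, hi⟩⟩

/-- An active constraint keeps all its variables running, so it hears from each of them and can
decide whether anyone objects to a raise. -/
theorem round_nodesA (P : CoveringILP m n) (θ : Tuning) (a : ℕ → ℕ) (t : ℕ) (hbw : 0 < bw) :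
    (bidAlg n m bw θ a).round P (P.nodesA θ a t) = P.nodesB θ a t := by
  have hN : P.Narrow θ a bw (P.nodesA θ a t) := by
    intro u v N _ hm
    rcases u with j | i
    · simp only [nodesA] at hm
      split_ifs at hm
      · rcases v with j' | i
        · cases hm
        · simp only [NodeState.msg, Option.some.injEq] at hm
          have : 1 < 2 ^ bw := Nat.one_lt_two_pow hbw.ne'
          split_ifs at hm <;> omega
      · cases hm
    · simp only [nodesA] at hm
      split_ifs at hm <;> cases hm
  funext v
  rcases v with j | i
  · refine (round_inl hN j).trans ?_
    simp only [nodesA, nodesB]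
    split_ifs <;> rfl
  · refine (round_inr hN i).trans ?_
    simp only [nodesA, nodesB]
    split_ifs with hi
    · simp only [NodeState.next]
      refine congrArg (fun r => NodeState.rowB _ r t) (propext ?_)
      unfold Raises
      have hval : ∀ j, P.A i j ≠ 0 → P.fromVars θ a (P.nodesA θ a t) i j =
          some (if (P.view θ (P.bidRun θ a t) j).Stuck (a t) i then 1 else 0) := by
        intro j hA
        unfold fromVars
        rw [if_pos hA]
        simp only [nodesA]
        rw [if_pos (act_nonempty hA hi)]
        rfl
      constructor
      · intro h j hj hst
        have h1 := h j
        rw [hval j (mem_row.1 hj), if_pos hst] at h1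
        exact h1 rfl
      · intro h j
        by_cases hA : P.A i j ≠ 0
        · rw [hval j hA, if_neg (h j (mem_row.2 hA))]
          simp
        · unfold fromVars
          rw [if_neg hA]
          simp
    · rfl

theorem round_nodesB (P : CoveringILP m n) (θ : Tuning) (a : ℕ → ℕ) (t : ℕ) (hbw : 0 < bw) :
    (bidAlg n m bw θ a).round P (P.nodesB θ a t) = P.nodesC θ a t := by
  have hN : P.Narrow θ a bw (P.nodesB θ a t) := by
    intro u v N _ hm
    rcases u with j | i
    · simp only [nodesB] at hm
      split_ifs at hm <;> cases hm
    · simp only [nodesB] at hm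
      split_ifs at hm
      · rcases v with j' | i
        · simp only [NodeState.msg, Option.some.injEq] at hm
          have : 1 < 2 ^ bw := Nat.one_lt_two_pow hbw.ne'
          split_ifs at hm <;> omega
        · cases hm
      · cases hm
  funext v
  rcases v with j | i
  · refine (round_inl hN j).trans ?_
    simp only [nodesB, nodesC]
    split_ifs
    · simp only [NodeState.next]
      unfold filled raised
      refine congrArg (fun V : VarView m => NodeState.varC (V.fill θ.β) t) ?_
      unfold VarView.raise
      rw [VarView.mk.injEq]
      refine ⟨rfl, rfl, rfl, rfl, rfl, ?_, rfl⟩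
      funext i
      by_cases hi : i ∈ (P.view θ (P.bidRun θ a t) j).act
      · have hi' := mem_act.1 hi
        have : P.fromRows θ a (P.nodesB θ a t) j i = some 1 ↔
            P.Raises θ (P.bidRun θ a t) (a t) i := by
          unfold fromRows
          rw [if_pos hi'.1]
          simp only [nodesB]
          rw [if_pos hi'.2]
          simp [NodeState.msg]
        simp only [hi, this]
      · simp [hi]
    · rfl
  · refine (round_inr hN i).trans ?_
    simp only [nodesB, nodesC]
    split_ifs <;> rfl

theorem maxCut_le {m : ℕ} (V : VarView m) (Z : ℕ) (i : Fin m) : V.maxCut Z i ≤ Z + 1 :=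
  Finset.sup_le fun _ _ => min_le_left _ _

/-- Capping the values does not change which constraints are satisfied. -/
theorem Fits.cap_residual (h : P.Fits θ) {x : Fin n → ℕ} {R : RowView n} {i : Fin m}
    (hb : R.b = P.b i) (ha : R.a = P.A i)
    (hx : ∀ j, R.x j = if P.A i j ≠ 0 then min (x j) (2 ^ (2 * θ.K)) else 0) :
    (0 < R.residual ↔ 0 < P.residual x i) ∧
      (0 < P.residual x i → ∀ j, R.x j = if P.A i j ≠ 0 then x j else 0) := by
  have hsum : R.residual = P.residual (fun j => min (x j) (2 ^ (2 * θ.K))) i := by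
    unfold RowView.residual residual
    rw [hb, ha]
    congr 1
    apply Finset.sum_congr rfl
    intro j _
    rw [hx j]
    split_ifs with hA
    · rfl
    · rw [not_not] at hA; rw [hA]; simp
  -- A single value that reaches the cap satisfies the row. Hence a row with positive residual, with
  -- or without capping, has only values below the cap.
  have hcap : ∀ y : Fin n → ℕ, ∀ j, P.A i j ≠ 0 → 2 ^ (2 * θ.K) ≤ y j → ¬0 < P.residual y i := by
    intro y j hA hy hres
    have h1 := P.residual_le_sub y i j
    have h2 := h.b_le i j hA
    have h3 : ((2 : ℝ) ^ (2 * θ.K)) ≤ y j := by exact_mod_cast hy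
    have h4 := mul_le_mul_of_nonneg_left h3 (P.A_nonneg i j)
    linarith
  have hlt : 0 < P.residual x i → ∀ j, R.x j = if P.A i j ≠ 0 then x j else 0 := by
    intro hres j
    rw [hx j]
    split_ifs with hA
    · apply min_eq_left
      by_contra! hc
      exact hcap x j hA hc.le hres
    · rfl
  refine ⟨⟨fun hR => ?_, fun hres => ?_⟩, hlt⟩
  · rw [hsum] at hR
    have : ∑ j, P.A i j * ((min (x j) (2 ^ (2 * θ.K)) : ℕ) : ℝ) = ∑ j, P.A i j * (x j : ℝ) := by
      apply Finset.sum_congr rfl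
      intro j _
      by_cases hA : P.A i j ≠ 0
      · rw [min_eq_left]
        by_contra! hc
        exact hcap _ j hA (le_min hc.le le_rfl) hR
      · rw [not_not] at hA; rw [hA]; simp
    unfold residual at hR ⊢
    rw [this] at hR
    exact hR
  · refine hres.trans_le (le_of_eq ?_)
    unfold residual RowView.residual
    rw [hb, ha]
    congr 1
    apply Finset.sum_congr rfl
    intro j _
    rw [hlt hres j]
    split_ifs with hA
    · rfl
    · rw [not_not] at hA; rw [hA]; simp

theorem Fits.round_nodesC (h : P.Fits θ) (a : ℕ → ℕ) (t : ℕ) {E : ℕ} (hE : 2 * E ≤ bw)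
    (hK : 2 * θ.K < E) (hZ : θ.Z + 1 < 2 ^ E) :
    (bidAlg n m bw θ a).round P (P.nodesC θ a t) = P.nodesD θ a t := by
  have hmsg : ∀ (V : VarView m) i, Nat.pair (min V.x (2 ^ (2 * θ.K))) (V.maxCut θ.Z i) < 2 ^ bw := by
    intro V i
    refine (Nat.pair_lt_two_pow ?_ ((maxCut_le V θ.Z i).trans_lt hZ)).trans_le
      (Nat.pow_le_pow_right (by norm_num) hE)
    exact (min_le_right _ _).trans_lt (Nat.pow_lt_pow_right (by norm_num) hK)
  have hN : P.Narrow θ a bw (P.nodesC θ a t) := by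
    intro u v N _ hm
    rcases u with j | i
    · simp only [nodesC] at hm
      split_ifs at hm
      · rcases v with j' | i
        · cases hm
        · simp only [NodeState.msg, Option.some.injEq] at hm
          rw [← hm]
          exact hmsg _ _
      · cases hm
    · simp only [nodesC] at hm
      split_ifs at hm <;> cases hm
  have hmono : (P.bidRun θ a t).x ≤ (P.bidRun θ a (t + 1)).x := P.bidRun_x_mono θ a (Nat.le_succ t)
  funext v
  rcases v with j | i
  · refine (round_inl hN j).trans ?_
    simp only [nodesC, nodesD]
    split_ifs <;> rfl
  · refine (round_inr hN i).trans ?_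
    simp only [nodesC, nodesD]
    by_cases hi : 0 < P.residual (P.bidRun θ a t).x i
    · rw [if_pos hi]
      set f := P.fromVars θ a (P.nodesC θ a t) i with hf
      have hval : ∀ j, P.A i j ≠ 0 → f j = some (Nat.pair
          (min ((P.bidRun θ a (t + 1)).x j) (2 ^ (2 * θ.K)))
          ((P.filled θ (P.bidRun θ a t) (a t) j).maxCut θ.Z i)) := by
        intro j hA
        rw [hf]
        unfold fromVars
        rw [if_pos hA]
        simp only [nodesC]
        rw [if_pos (act_nonempty hA hi)]
        rfl
      have hnone : ∀ j, ¬P.A i j ≠ 0 → f j = none := by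
        intro j hA
        rw [hf]
        unfold fromVars
        rw [if_neg hA]
      have hsome : ∀ j, (f j).isSome ↔ P.A i j ≠ 0 := by
        intro j
        by_cases hA : P.A i j ≠ 0
        · rw [hval j hA]; simp [hA]
        · rw [hnone j hA]; simp [hA]
      set R := NodeState.rowUpdate (P.rowView (P.bidRun θ a t) i) f with hR
      have hRx : ∀ j, R.x j =
          if P.A i j ≠ 0 then min ((P.bidRun θ a (t + 1)).x j) (2 ^ (2 * θ.K)) else 0 := by
        intro j
        rw [hR]
        unfold NodeState.rowUpdate
        simp only [hsome]
        split_ifs with hA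
        · rw [hval j hA]; simp
        · rfl
      obtain ⟨hpos, hx⟩ := h.cap_residual (x := (P.bidRun θ a (t + 1)).x) (R := R) rfl rfl hRx
      simp only [NodeState.next]
      rw [← hR]
      by_cases hi' : 0 < P.residual (P.bidRun θ a (t + 1)).x i
      · rw [if_pos (hpos.2 hi'), if_pos hi']
        have hRe : R = P.rowView (P.bidRun θ a (t + 1)) i := by
          have : R.x = (P.rowView (P.bidRun θ a (t + 1)) i).x := funext (hx hi')
          rw [hR] at this ⊢
          unfold NodeState.rowUpdate rowView at this ⊢
          simp only at this
          rw [this]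
        rw [hRe]
        congr 1
        unfold NodeState.rowUpdateCost rowCost rowCut
        rw [← hR, hRe]
        congr 1
        · apply Finset.sup_congr
          · ext j
            simp [hsome, mem_row]
          · intro j hj
            have := (Finset.mem_filter.1 hj).2
            rw [hval j this]
            simp
        · congr 1
          apply Finset.sum_congr rfl
          intro j _
          rw [rowView_scale, rowView_scale]
      · rw [if_neg (fun hc => hi' (hpos.1 hc)), if_neg hi']
    · rw [if_neg hi, if_neg (fun hc => hi (hc.trans_le (residual_anti hmono i)))]
      rfl

/-- Without active constraints nothing is paid, so the frozen output of a halted variable agrees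
with the ideal process forever. -/
theorem Fits.x_succ_eq (h : P.Fits θ) {t : ℕ} {j : Fin n}
    (hj : ¬(P.act (P.bidRun θ a t).x j).Nonempty) :
    (P.bidRun θ a (t + 1)).x j = (P.bidRun θ a t).x j := by
  have hinv := h.inv a t j
  rw [Finset.not_nonempty_iff_eq_empty] at hj
  have hpaid : (P.raised θ (P.bidRun θ a t) (a t) j).paid = (P.bidRun θ a t).C j := by
    funext T
    change (P.bidRun θ a t).C j T + ∑ i ∈ P.act (P.bidRun θ a t).x j with _, _ = _
    rw [hj]
    simp
  change max ((P.bidRun θ a t).x j) (sSup {T : ℕ | (1 - θ.β) * P.w j * T ≤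
    (P.raised θ (P.bidRun θ a t) (a t) j).paid T}) = _
  apply max_eq_left
  rw [hpaid]
  rcases (P.w_nonneg j).eq_or_lt with hw | hw
  · have : {T : ℕ | (1 - θ.β) * P.w j * T ≤ (P.bidRun θ a t).C j T} = Set.univ := by
      ext T
      have := hinv.C_nonneg T
      simp only [← hw, mul_zero, zero_mul, Set.mem_ofPred_eq, Set.mem_univ, iff_true]
      exact this
    rw [this, Nat.sSup_of_not_bddAbove (by simp [not_bddAbove_univ])]
    exact Nat.zero_le _
  · apply csSup_le'
    intro T hT
    by_contra! hc
    exact absurd hT (not_le.2 (hinv.unsat hw T hc))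

theorem Fits.round_nodesD (h : P.Fits θ) (a : ℕ → ℕ) (t : ℕ) {E : ℕ} (hE : 2 * E ≤ bw)
    (hcost : ∀ i, 0 < P.residual (P.bidRun θ a (t + 1)).x i → P.rowCost θ a t i < 2 ^ E)
    (hscale : ∀ i j, P.A i j ≠ 0 → P.scale θ (P.bidRun θ a (t + 1)).x i j < 2 ^ E) :
    (bidAlg n m bw θ a).round P (P.nodesD θ a t) = P.nodesA θ a (t + 1) := by
  have hN : P.Narrow θ a bw (P.nodesD θ a t) := by
    intro u v N hadj hm
    rcases u with j | i
    · simp only [nodesD] at hm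
      split_ifs at hm <;> cases hm
    · simp only [nodesD] at hm
      split_ifs at hm with hi
      · rcases v with j | i'
        · rw [network_adj_inr_inl] at hadj
          simp only [NodeState.msg, Option.some.injEq] at hm
          rw [← hm, rowView_scale]
          exact (Nat.pair_lt_two_pow (hcost i hi) (hscale i j hadj)).trans_le
            (Nat.pow_le_pow_right (by norm_num) hE)
        · cases hm
      · cases hm
  have hmono : (P.bidRun θ a t).x ≤ (P.bidRun θ a (t + 1)).x := P.bidRun_x_mono θ a (Nat.le_succ t)
  funext v
  rcases v with j | i
  · refine (round_inl hN j).trans ?_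
    simp only [nodesD, nodesA]
    set f := P.fromRows θ a (P.nodesD θ a t) j with hf
    have hval : ∀ i, i ∈ P.act (P.bidRun θ a (t + 1)).x j → f i = some (Nat.pair
        (P.rowCost θ a t i) (P.scale θ (P.bidRun θ a (t + 1)).x i j)) := by
      intro i hi
      rw [mem_act] at hi
      rw [hf]
      unfold fromRows
      rw [if_pos hi.1]
      simp only [nodesD]
      rw [if_pos hi.2]
      simp only [NodeState.msg]
      rw [rowView_scale]
    have hnone : ∀ i, i ∉ P.act (P.bidRun θ a (t + 1)).x j → f i = none := by
      intro i hi
      rw [hf]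
      unfold fromRows
      by_cases hA : P.A i j ≠ 0
      · rw [if_pos hA]
        simp only [nodesD]
        rw [if_neg (fun hc => hi (mem_act.2 ⟨hA, hc⟩))]
        rfl
      · rw [if_neg hA]
    have hsome : ∀ i, (f i).isSome ↔ i ∈ P.act (P.bidRun θ a (t + 1)).x j := by
      intro i
      by_cases hi : i ∈ P.act (P.bidRun θ a (t + 1)).x j
      · rw [hval i hi]; simp [hi]
      · rw [hnone i hi]; simp [hi]
    by_cases hj : (P.act (P.bidRun θ a t).x j).Nonempty
    · rw [if_pos hj]
      simp only [NodeState.next]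
      have hact : (NodeState.varUpdate (P.filled θ (P.bidRun θ a t) (a t) j) f).act =
          P.act (P.bidRun θ a (t + 1)).x j := by
        unfold NodeState.varUpdate
        ext i
        simp [hsome]
      rw [hact]
      split_ifs with hj'
      · congr 1
        unfold NodeState.varUpdate view
        rw [VarView.mk.injEq]
        refine ⟨rfl, rfl, rfl, rfl, ?_, ?_, ?_⟩
        · ext i
          simp [hsome]
        · funext i
          simp only [hsome]
          split_ifs with hi
          · rw [hval i hi]
            have hi0 := act_anti (P := P) hmono j hi
            have h1 : (P.filled θ (P.bidRun θ a t) (a t) j).e i =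
              if P.Raises θ (P.bidRun θ a t) (a t) i then (P.bidRun θ a t).e i + (a t)
              else (P.bidRun θ a t).e i := raised_e hi0 (a t)
            have h2 : (P.bidRun θ a (t + 1)).e i =
              (if P.Raises θ (P.bidRun θ a t) (a t) i then (P.bidRun θ a t).e i + (a t)
                else (P.bidRun θ a t).e i) - P.rowCut θ (P.bidRun θ a t) (a t) i
              - ((θ.Z : ℤ) + 3) * ∑ j ∈ P.row i, ((P.scale θ (P.bidRun θ a t).x i j : ℤ) -
                P.scale θ (P.bidRun θ a (t + 1)).x i j) := rfl
            have h3 : ((∑ j, (P.scale θ (P.bidRun θ a t).x i j -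
                P.scale θ (P.bidRun θ a (t + 1)).x i j) : ℕ) : ℤ) =
                ∑ j ∈ P.row i, ((P.scale θ (P.bidRun θ a t).x i j : ℤ) -
                P.scale θ (P.bidRun θ a (t + 1)).x i j) := by
              rw [Nat.cast_sum, row, Finset.sum_filter]
              apply Finset.sum_congr rfl
              intro j' _
              split_ifs with hA
              · exact Nat.cast_sub (scale_anti hmono i j')
              · rw [not_not] at hA
                unfold scale
                rw [hA]
                simp [scaleOf]
            rw [h1, h2, ← h3]
            unfold rowCost
            simp only [Option.getD_some, Nat.unpair_pair]
            push_cast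
            ring
          · rfl
        · funext i
          simp only [hsome]
          split_ifs with hi
          · rw [hval i hi]
            simp
          · rfl
      · rfl
    · rw [if_neg hj, if_neg (fun hc => hj (hc.mono (act_anti hmono j))), h.x_succ_eq hj]
      rfl
  · refine (round_inr hN i).trans ?_
    simp only [nodesD, nodesA]
    split_ifs <;> rfl

end CoveringILP

/-! ### The two initial rounds and the whole run -/

namespace CoveringILP

variable {n m bw : ℕ} {P : CoveringILP m n} {θ : Tuning} {a : ℕ → ℕ}

/-- The base-two logarithm of the factor by which the initial bid of a constraint lies below
`2 ^ K`. -/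
def rowStartCost (P : CoveringILP m n) (θ : Tuning) (i : Fin m) : ℕ :=
  (P.row i).sup fun j => startCost θ.K (P.col j).card (P.w j)

/-- The states of the nodes after the first round. -/
def nodesReady (P : CoveringILP m n) (θ : Tuning) : Fin n ⊕ Fin m → NodeState n m
  | Sum.inl j => .varWait (P.w j)
  | Sum.inr i => if 0 < P.residual (P.start θ).x i then
      .rowReady (P.rowView (P.start θ) i) (P.rowStartCost θ i)
      else .rowHalt

theorem round_init (hA : ∀ i j, IsShort θ.K (P.A i j)) (a : ℕ → ℕ) {E : ℕ} (hE : 4 * E ≤ bw)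
    (hE0 : 0 < E) (hK : θ.K ≤ E) (hcost : ∀ j, startCost θ.K (P.col j).card (P.w j) < 2 ^ E) :
    (bidAlg n m bw θ a).round P ((bidAlg n m bw θ a).init P) = P.nodesReady θ := by
  have hpow : 2 ^ θ.K ≤ 2 ^ E := Nat.pow_le_pow_right (by norm_num) hK
  have hN : P.Narrow θ a bw ((bidAlg n m bw θ a).init P) := by
    intro u v N _ hm
    rcases u with j | i
    · change NodeState.msg θ a (.varInit (P.w j) fun i => P.A i j) v = _ at hm
      rcases v with j' | i
      · cases hm
      · simp only [NodeState.msg, Option.some.injEq] at hm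
        rw [← hm]
        have h1 := shortNum_div_shortDen (hA i j)
        refine (Nat.pair_lt_two_pow (E := 2 * E) (Nat.pair_lt_two_pow (h1.1.trans_le hpow)
          (h1.2.1.trans_le hpow)) (Nat.pair_lt_two_pow ?_ ?_)).trans_le
          (Nat.pow_le_pow_right (by norm_num) (by omega))
        · exact hcost j
        · have : 1 < 2 ^ E := Nat.one_lt_two_pow hE0.ne'
          split_ifs <;> omega
    · cases hm
  funext v
  rcases v with j | i
  · exact round_inl hN j
  · refine (round_inr hN i).trans ?_
    set f := P.fromVars θ a ((bidAlg n m bw θ a).init P) i with hf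
    have hval : ∀ j, P.A i j ≠ 0 → f j = some (Nat.pair
        (Nat.pair (shortNum θ.K (P.A i j)) (shortDen θ.K (P.A i j)))
        (Nat.pair (startCost θ.K (P.col j).card (P.w j)) (if P.w j = 0 then 1 else 0))) := by
      intro j hA
      rw [hf]
      unfold fromVars
      rw [if_pos hA]
      rfl
    have hsome : ∀ j, (f j).isSome ↔ P.A i j ≠ 0 := by
      intro j
      by_cases hA : P.A i j ≠ 0
      · rw [hval j hA]; simp [hA]
      · rw [hf]
        unfold fromVars
        rw [if_neg hA]
        simp [hA]
    have hR : NodeState.rowStart θ (P.b i) f = P.rowView (P.start θ) i := by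
      unfold NodeState.rowStart rowView
      rw [RowView.mk.injEq]
      refine ⟨rfl, ?_, ?_⟩
      · funext j
        simp only [hsome]
        split_ifs with hj
        · rw [hval j hj]
          simp only [Option.getD_some, Nat.unpair_pair]
          exact (shortNum_div_shortDen (hA i j)).2.2
        · rw [not_not] at hj; exact hj.symm
      · funext j
        simp only [hsome]
        by_cases hj : P.A i j ≠ 0
        · rw [hval j hj, if_pos hj]
          simp only [Option.getD_some, Nat.unpair_pair, start, startValue]
          by_cases hw : P.w j = 0 <;> simp [hw, hj]
        · rw [if_neg (fun h => hj h.1), if_neg hj]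
    have hU : NodeState.rowStartCost f = P.rowStartCost θ i := by
      unfold NodeState.rowStartCost rowStartCost
      apply Finset.sup_congr
      · ext j
        simp [hsome, mem_row]
      · intro j hj
        rw [hval j (mem_row.1 hj)]
        simp
    change NodeState.next θ a f _ (NodeState.rowInit (P.b i)) = _
    simp only [NodeState.next, nodesReady]
    rw [hR, hU, rowView_residual]

theorem round_nodesReady (P : CoveringILP m n) (θ : Tuning) (a : ℕ → ℕ) {E : ℕ}
    (hE : 2 * E ≤ bw) (hcost : ∀ i, P.rowStartCost θ i < 2 ^ E)
    (hscale : ∀ i j, P.A i j ≠ 0 → P.scale θ (P.start θ).x i j < 2 ^ E) :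
    (bidAlg n m bw θ a).round P (P.nodesReady θ) = P.nodesA θ a 0 := by
  have hN : P.Narrow θ a bw (P.nodesReady θ) := by
    intro u v N hadj hm
    rcases u with j | i
    · cases hm
    · simp only [nodesReady] at hm
      split_ifs at hm with hi
      · rcases v with j | i'
        · rw [network_adj_inr_inl] at hadj
          simp only [NodeState.msg, Option.some.injEq] at hm
          rw [← hm, rowView_scale]
          exact (Nat.pair_lt_two_pow (hcost i) (hscale i j hadj)).trans_le
            (Nat.pow_le_pow_right (by norm_num) hE)
        · cases hm
      · cases hm
  funext v
  rcases v with j | i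
  · refine (round_inl hN j).trans ?_
    simp only [nodesReady, nodesA]
    set f := P.fromRows θ a (P.nodesReady θ) j with hf
    have hval : ∀ i, i ∈ P.act (P.start θ).x j → f i = some (Nat.pair
        (P.rowStartCost θ i) (P.scale θ (P.start θ).x i j)) := by
      intro i hi
      rw [mem_act] at hi
      rw [hf]
      unfold fromRows
      rw [if_pos hi.1]
      simp only [nodesReady]
      rw [if_pos hi.2]
      simp only [NodeState.msg]
      rw [rowView_scale]
    have hsome : ∀ i, (f i).isSome ↔ i ∈ P.act (P.start θ).x j := by
      intro i
      by_cases hi : i ∈ P.act (P.start θ).x j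
      · rw [hval i hi]; simp [hi]
      · have : f i = none := by
          rw [hf]
          unfold fromRows
          by_cases hA : P.A i j ≠ 0
          · rw [if_pos hA]
            simp only [nodesReady]
            rw [if_neg (fun hc => hi (mem_act.2 ⟨hA, hc⟩))]
            rfl
          · rw [if_neg hA]
        rw [this]; simp [hi]
    have hact : (Finset.univ.filter fun i => (f i).isSome) = P.act (P.start θ).x j := by
      ext i
      simp [hsome]
    have hV : NodeState.varStart θ (P.w j) f = P.view θ (P.start θ) j := by
      unfold NodeState.varStart view
      rw [VarView.mk.injEq]
      refine ⟨rfl, rfl, rfl, ?_, hact, ?_, ?_⟩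
      · rw [hact]
        apply Finset.sup_congr rfl
        intro i hi
        rw [hval i hi]
        simp
      · funext i
        simp only [hsome]
        split_ifs with hi
        · rw [hval i hi]
          simp [start, rowStartCost]
        · rfl
      · funext i
        simp only [hsome]
        split_ifs with hi
        · rw [hval i hi]
          simp
        · rfl
    simp only [NodeState.next]
    rw [hV]
    rfl
  · refine (round_inr hN i).trans ?_
    simp only [nodesReady, nodesA]
    by_cases hi : 0 < P.residual (P.start θ).x i
    · rw [if_pos hi]
      exact (if_pos hi).symm
    · rw [if_neg hi]
      exact (if_neg hi).symm

/-- All numbers that are sent in the course of the bidding process have at most `E` bits. -/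
structure FitsBits (P : CoveringILP m n) (θ : Tuning) (a : ℕ → ℕ) (E : ℕ) : Prop where
  short : ∀ i j, IsShort θ.K (P.A i j)
  K_lt : 2 * θ.K < E
  Z_lt : θ.Z + 1 < 2 ^ E
  startCost_lt : ∀ j, startCost θ.K (P.col j).card (P.w j) < 2 ^ E
  scale_lt : ∀ t i j, P.A i j ≠ 0 → P.scale θ (P.bidRun θ a t).x i j < 2 ^ E
  rowCost_lt : ∀ t i, 0 < P.residual (P.bidRun θ a (t + 1)).x i → P.rowCost θ a t i < 2 ^ E

theorem Fits.run_eq_nodesA (h : P.Fits θ) {E : ℕ} (hE : P.FitsBits θ a E) (hbw : 4 * E ≤ bw)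
    (t : ℕ) : (bidAlg n m bw θ a).run P (2 + 4 * t) = P.nodesA θ a t := by
  have hE0 : 0 < E := (Nat.zero_le _).trans_lt hE.K_lt
  induction t with
  | zero =>
    change (bidAlg n m bw θ a).round P ((bidAlg n m bw θ a).round P _) = _
    have h1 := round_init (bw := bw) hE.short a hbw hE0 (by have := hE.K_lt; omega) hE.startCost_lt
    refine (congrArg _ h1).trans (P.round_nodesReady θ a (by omega) ?_ (hE.scale_lt 0))
    intro i
    refine (Finset.sup_lt_iff (Nat.two_pow_pos E)).2 fun j _ => hE.startCost_lt j
  | succ t ih =>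
    have h1 := P.round_nodesA (bw := bw) θ a t (by omega)
    have h2 := P.round_nodesB (bw := bw) θ a t (by omega)
    have h3 := h.round_nodesC (bw := bw) a t (by omega) hE.K_lt hE.Z_lt
    have h4 := h.round_nodesD (bw := bw) a t (by omega) (hE.rowCost_lt t) (hE.scale_lt (t + 1))
    change (bidAlg n m bw θ a).round P ((bidAlg n m bw θ a).round P
      ((bidAlg n m bw θ a).round P ((bidAlg n m bw θ a).round P
        ((bidAlg n m bw θ a).run P (2 + 4 * t))))) = _
    refine Eq.trans ?_ h4
    refine congrArg _ (Eq.trans ?_ h3)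
    refine congrArg _ (Eq.trans ?_ h2)
    refine congrArg _ (Eq.trans ?_ h1)
    exact congrArg _ ih

theorem Fits.haltsWith (h : P.Fits θ) {E : ℕ} (hE : P.FitsBits θ a E) (hbw : 4 * E ≤ bw) {t : ℕ}
    (ht : P.Feasible (P.bidRun θ a t).x) :
    (bidAlg n m bw θ a).HaltsWith P (2 + 4 * t) (P.bidRun θ a t).x := by
  have hres : ∀ i, ¬0 < P.residual (P.bidRun θ a t).x i := fun i =>
    not_lt.2 (sub_nonpos.2 (ht i))
  have hrun := h.run_eq_nodesA hE hbw t
  have hvar : ∀ j, (bidAlg n m bw θ a).output ((bidAlg n m bw θ a).run P (2 + 4 * t) (Sum.inl j)) =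
      some ((P.bidRun θ a t).x j) := by
    intro j
    refine (congrArg _ (congrFun hrun (Sum.inl j))).trans ?_
    simp only [nodesA]
    rw [if_neg]
    · rfl
    · rintro ⟨i, hi⟩
      exact hres i (mem_act.1 hi).2
  refine ⟨?_, hvar⟩
  rintro (j | i)
  · rw [hvar j]; rfl
  · have : (bidAlg n m bw θ a).output ((bidAlg n m bw θ a).run P (2 + 4 * t) (Sum.inr i)) =
        some 0 := by
      refine (congrArg _ (congrFun hrun (Sum.inr i))).trans ?_
      simp only [nodesA]
      rw [if_neg (hres i)]
      rfl
    rw [this]; rfl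

end CoveringILP

/-! ### Bit lengths and very small tolerances -/

theorem IsShort.lt {k : ℕ} {x : ℝ} (h : IsShort k x) : x < 2 ^ k := by
  obtain ⟨p, q, hp, hq, -, rfl⟩ := h
  have hq1 : (1 : ℝ) ≤ q := by exact_mod_cast hq
  have hp1 : (p : ℝ) < 2 ^ k := by exact_mod_cast hp
  exact (div_le_self (Nat.cast_nonneg p) hq1).trans_lt hp1

theorem IsShort.one_le_mul {k : ℕ} {x : ℝ} (h : IsShort k x) (hx : x ≠ 0) : 1 ≤ x * 2 ^ k := by
  obtain ⟨p, q, -, hq, hqk, rfl⟩ := h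
  have hq0 : (0 : ℝ) < q := by exact_mod_cast hq
  have hqk' : (q : ℝ) ≤ 2 ^ k := by exact_mod_cast hqk.le
  have hp : (1 : ℝ) ≤ p := by
    have : p ≠ 0 := fun h0 => hx (by rw [h0]; simp)
    exact_mod_cast Nat.one_le_iff_ne_zero.2 this
  rw [div_mul_eq_mul_div, le_div_iff₀ hq0]
  nlinarith

/-- The tolerance `ε`, raised to a bound below which it cannot matter. -/
def tolerance (n K : ℕ) (ε : ℝ) : ℝ := max ε (2⁻¹ ^ (n * K + 3 * K + n))

/-- This `β` makes `F / (1 - β)` equal to `F` plus the tolerance. The maximum with `1` keeps `F`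
positive when the matrix is zero. -/
def tuning (n K f : ℕ) (ε : ℝ) : Tuning where
  F := max f 1
  Z := tolExp (tolerance n K ε / ((max f 1 : ℕ) + tolerance n K ε))
  K := K
  β := tolerance n K ε / ((max f 1 : ℕ) + tolerance n K ε)

theorem tolerance_pos (n K : ℕ) (ε : ℝ) : 0 < tolerance n K ε :=
  lt_max_of_lt_right (by positivity)

namespace CoveringILP

variable {n m : ℕ} {P : CoveringILP m n}

theorem row_card_le_rank (P : CoveringILP m n) (i : Fin m) : (P.row i).card ≤ P.rank := by
  have : (P.row i).card = Set.ncard {j : Fin n | P.A i j ≠ 0} := by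
    rw [← Set.ncard_coe_finset]; simp [row]
  rw [this]
  exact Finset.le_sup (f := fun i : Fin m => Set.ncard {j : Fin n | P.A i j ≠ 0})
    (Finset.mem_univ i)

theorem col_card_le_maxDegree (P : CoveringILP m n) (j : Fin n) :
    (P.col j).card ≤ P.maxDegree := by
  have : (P.col j).card = Set.ncard {i : Fin m | P.A i j ≠ 0} := by
    rw [← Set.ncard_coe_finset]; simp [col]
  rw [this]
  exact Finset.le_sup (f := fun j : Fin n => Set.ncard {i : Fin m | P.A i j ≠ 0})
    (Finset.mem_univ j)

theorem rank_le (P : CoveringILP m n) : P.rank ≤ n := by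
  refine Finset.sup_le fun i _ => ?_
  refine (Set.ncard_le_ncard (Set.subset_univ _)).trans ?_
  rw [Set.ncard_univ, Nat.card_fin]

theorem one_le_maxRatio (P : CoveringILP m n) : 1 ≤ P.maxRatio := le_max_left _ _

theorem div_le_maxRatio (P : CoveringILP m n) {i : Fin m} {j : Fin n} (h : P.A i j ≠ 0) :
    P.b i / P.A i j ≤ P.maxRatio := by
  refine le_trans ?_ (le_max_right _ _)
  refine le_csSup ?_ ⟨i, j, h, rfl⟩
  have : {r : ℝ | ∃ i j, P.A i j ≠ 0 ∧ r = P.b i / P.A i j} ⊆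
      Set.range fun p : Fin m × Fin n => P.b p.1 / P.A p.1 p.2 := by
    rintro r ⟨i, j, -, rfl⟩
    exact ⟨(i, j), rfl⟩
  exact ((Set.finite_range _).subset this).bddAbove

theorem exists_ne_zero_of_rank_pos (h : 0 < P.rank) : ∃ i j, P.A i j ≠ 0 := by
  by_contra! hc
  have : P.rank ≤ 0 := by
    refine Finset.sup_le fun i _ => ?_
    simp [hc i]
  omega

theorem eq_zero_of_rank_eq_zero (h : P.rank = 0) (i : Fin m) (j : Fin n) : P.A i j = 0 := by
  by_contra hA
  have h1 := P.row_card_le_rank i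
  have h2 : 0 < (P.row i).card := Finset.card_pos.2 ⟨j, mem_row.2 hA⟩
  omega

theorem InputShort.le_mul {K : ℕ} (h : P.InputShort K) {i : Fin m} {j : Fin n} (hA : P.A i j ≠ 0) :
    P.b i ≤ P.A i j * 2 ^ (2 * K) := by
  have h1 := (h.1 i j).one_le_mul hA
  have h2 := (h.2.1 i).lt
  have h3 : (0 : ℝ) < 2 ^ K := by positivity
  rw [two_mul, pow_add]
  nlinarith

theorem InputShort.fits {K : ℕ} (h : P.InputShort K) (ε : ℝ) : P.Fits (tuning n K P.rank ε) where
  F_pos := lt_max_of_lt_right one_pos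
  row_card_le i := (P.row_card_le_rank i).trans (le_max_left _ _)
  β_lt := by
    have h1 := tolerance_pos n K ε
    have h2 : (1 : ℝ) ≤ (max P.rank 1 : ℕ) := by exact_mod_cast le_max_right _ _
    change _ / _ < (1 : ℝ)
    rw [div_lt_one (by linarith)]
    linarith
  Z_le := by
    have h1 := tolerance_pos n K ε
    have h2 : (1 : ℝ) ≤ (max P.rank 1 : ℕ) := by exact_mod_cast le_max_right _ _
    exact tolExp_spec (by positivity)
  b_le i j hA := h.le_mul hA
  w_le j := (h.2.2 j).lt.le

theorem startCost_le {K d ℓ : ℕ} {w : ℝ} (hw : IsShort K w) (hd : d ≤ 2 ^ ℓ) :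
    startCost K d w ≤ 2 * K + ℓ + 2 := by
  unfold startCost
  apply Nat.clog_le_of_le_pow
  rw [Nat.ceil_le]
  by_cases h0 : w = 0
  · rw [h0]; simp
  have hw0 : 0 < w := by
    obtain ⟨p, q, -, -, -, rfl⟩ := hw
    exact lt_of_le_of_ne (by positivity) (Ne.symm h0)
  have h1 := hw.one_le_mul h0
  have hd' : (d : ℝ) ≤ 2 ^ ℓ := by exact_mod_cast hd
  rw [div_le_iff₀ hw0]
  push_cast
  calc (4 : ℝ) * d * 2 ^ K ≤ 4 * 2 ^ ℓ * 2 ^ K * (w * 2 ^ K) := by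
        have : (4 : ℝ) * d * 2 ^ K ≤ 4 * 2 ^ ℓ * 2 ^ K := by gcongr
        exact this.trans (le_mul_of_one_le_right (by positivity) h1)
    _ = 2 ^ (2 * K + ℓ + 2) * w := by ring

theorem Fits.scale_le {θ : Tuning} (h : P.Fits θ) (x : Fin n → ℕ) {i : Fin m} {j : Fin n}
    (hA : P.A i j ≠ 0) : P.scale θ x i j ≤ 2 * θ.K := by
  have hpos := P.A_pos hA
  have h1 : P.residual x i / P.A i j ≤ 2 ^ (2 * θ.K) := by
    rw [div_le_iff₀ hpos, mul_comm]
    exact (P.residual_le x i).trans (h.b_le i j hA)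
  have h2 := two_pow_scaleOf_le h.F_pos h1 (one_le_pow₀ (by norm_num))
  exact (pow_le_pow_iff_right₀ (by norm_num)).1 h2

theorem Fits.rowCost_le {θ : Tuning} (h : P.Fits θ) (a : ℕ → ℕ) (t : ℕ) (i : Fin m) :
    P.rowCost θ a t i ≤ (θ.Z + 3) * (1 + n * (2 * θ.K)) := by
  have h1 : P.rowCut θ (P.bidRun θ a t) (a t) i ≤ θ.Z + 1 :=
    Finset.sup_le fun j _ => maxCut_le _ _ _
  have h2 : ∑ j, (P.scale θ (P.bidRun θ a t).x i j - P.scale θ (P.bidRun θ a (t + 1)).x i j) ≤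
      n * (2 * θ.K) := by
    refine (Finset.sum_le_card_nsmul _ _ (2 * θ.K) fun j _ => ?_).trans (by simp)
    by_cases hA : P.A i j ≠ 0
    · exact (Nat.sub_le _ _).trans (h.scale_le _ hA)
    · rw [not_not] at hA
      unfold scale
      rw [hA]
      simp [scaleOf]
  unfold rowCost
  calc _ ≤ (θ.Z + 1) + (θ.Z + 3) * (n * (2 * θ.K)) :=
        add_le_add h1 (Nat.mul_le_mul_left _ h2)
    _ ≤ _ := by rw [mul_add]; omega

/-- The lower bound on the tolerance makes `Z` polynomial in the input size uniformly in `ε`, so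
that numbers of order `Z` can be sent. -/
theorem tuning_Z_le {K f ℓ : ℕ} (ε : ℝ) (hf : f ≤ 2 ^ ℓ) :
    (tuning n K f ε).Z ≤ n * K + 3 * K + n + ℓ + 1 := by
  change tolExp _ ≤ _
  unfold tolExp
  apply Nat.clog_le_of_le_pow
  rw [Nat.ceil_le]
  have h1 := tolerance_pos n K ε
  have h2 : (2 : ℝ)⁻¹ ^ (n * K + 3 * K + n) ≤ tolerance n K ε := le_max_right _ _
  have h3 : ((max f 1 : ℕ) : ℝ) ≤ 2 ^ ℓ := by exact_mod_cast max_le hf Nat.one_le_two_pow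
  set q := n * K + 3 * K + n
  rw [one_div_div, add_div, div_self h1.ne']
  have h4 : 1 ≤ tolerance n K ε * 2 ^ q := by
    calc (1 : ℝ) = 2⁻¹ ^ q * 2 ^ q := by rw [← mul_pow]; norm_num
      _ ≤ _ := by gcongr
  have h5 : ((max f 1 : ℕ) : ℝ) / tolerance n K ε ≤ 2 ^ ℓ * 2 ^ q := by
    rw [div_le_iff₀ h1]
    calc ((max f 1 : ℕ) : ℝ) ≤ 2 ^ ℓ * 1 := by linarith
      _ ≤ 2 ^ ℓ * (tolerance n K ε * 2 ^ q) := by gcongr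
      _ = _ := by ring
  have h6 : (1 : ℝ) ≤ 2 ^ ℓ * 2 ^ q := by
    rw [← pow_add]; exact one_le_pow₀ (by norm_num)
  push_cast
  rw [show q + ℓ + 1 = ℓ + q + 1 by ring, pow_succ, pow_add]
  push_cast at h5
  linarith

theorem InputShort.fitsBits {κ ℓ : ℕ} (h : P.InputShort (κ * ℓ)) (hn : n ≤ 2 ^ ℓ) (hm : m ≤ 2 ^ ℓ)
    (hℓ : 0 < ℓ) (ε : ℝ) (a : ℕ → ℕ) :
    P.FitsBits (tuning n (κ * ℓ) P.rank ε) a ((2 * κ + 12) * ℓ) := by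
  have hfit := h.fits ε
  set E := (2 * κ + 12) * ℓ with hE
  have hE' : E = 2 * (κ * ℓ) + 12 * ℓ := by rw [hE]; ring
  have hlt : E < 2 ^ E := Nat.lt_two_pow_self
  have hZ := tuning_Z_le (n := n) (K := κ * ℓ) ε ((P.rank_le).trans hn)
  have hκ : κ ≤ 2 ^ κ := Nat.lt_two_pow_self.le
  have hℓ2 : ℓ ≤ 2 ^ ℓ := Nat.lt_two_pow_self.le
  have hone : 1 ≤ 2 ^ κ := Nat.one_le_two_pow
  have hone' : 1 ≤ 2 ^ ℓ := Nat.one_le_two_pow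
  set u := 2 ^ κ with hu
  set v := 2 ^ ℓ with hv
  have hK : κ * ℓ ≤ u * v := Nat.mul_le_mul hκ hℓ2
  have hnK : n * (κ * ℓ) ≤ u * v * v := by
    calc n * (κ * ℓ) ≤ v * (u * v) := Nat.mul_le_mul hn hK
      _ = _ := by ring
  have huv : 1 ≤ u * v := Nat.mul_pos hone hone'
  have h1 : u * v ≤ u * v * v := Nat.le_mul_of_pos_right _ hone'
  have h2 : v ≤ u * v * v := (Nat.le_mul_of_pos_left _ huv)
  have hZ3 : (tuning n (κ * ℓ) P.rank ε).Z + 3 ≤ 16 * (u * v * v) := by omega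
  have hcost : 16 * (u * v * v) * (1 + n * (2 * (κ * ℓ))) < 2 ^ E := by
    have h3 : 1 + n * (2 * (κ * ℓ)) ≤ 4 * (u * v * v) := by
      rw [mul_left_comm]; omega
    have h4 : u * v * v = 2 ^ (κ + ℓ + ℓ) := by rw [pow_add, pow_add]
    calc 16 * (u * v * v) * (1 + n * (2 * (κ * ℓ))) ≤ 16 * (u * v * v) * (4 * (u * v * v)) :=
          Nat.mul_le_mul_left _ h3
      _ = 2 ^ (6 + 2 * (κ + ℓ + ℓ)) := by rw [h4]; ring
      _ < 2 ^ E := by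
        apply Nat.pow_lt_pow_right (by norm_num)
        have : κ ≤ κ * ℓ := Nat.le_mul_of_pos_right _ hℓ
        omega
  refine ⟨h.1, ?_, ?_, ?_, ?_, ?_⟩
  · change 2 * (κ * ℓ) < E
    omega
  · have : 16 * (u * v * v) ≤ 16 * (u * v * v) * (1 + n * (2 * (κ * ℓ))) :=
      Nat.le_mul_of_pos_right _ (by omega)
    omega
  · intro j
    refine (startCost_le (ℓ := ℓ) (h.2.2 j) ?_).trans_lt ?_
    · refine (Finset.card_le_univ _).trans ?_
      rwa [Fintype.card_fin]
    · change 2 * (κ * ℓ) + ℓ + 2 < 2 ^ E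
      omega
  · intro t i j hA
    refine (hfit.scale_le _ hA).trans_lt ?_
    change 2 * (κ * ℓ) < 2 ^ E
    omega
  · intro t i _
    exact ((hfit.rowCost_le a t i).trans (Nat.mul_le_mul_right _ hZ3)).trans_lt hcost

theorem cost_nonneg (P : CoveringILP m n) (x : Fin n → ℕ) : 0 ≤ P.cost x :=
  Finset.sum_nonneg fun j _ => mul_nonneg (P.w_nonneg j) (Nat.cast_nonneg _)

theorem Fits.feasible_cap {θ : Tuning} (h : P.Fits θ) {y : Fin n → ℕ} (hy : P.Feasible y) :
    P.Feasible fun j => min (y j) (2 ^ (2 * θ.K)) := by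
  intro i
  let g : BidState n m := ⟨fun j => min (y j) (2 ^ (2 * θ.K)), fun _ _ => 0, fun _ => 0⟩
  have h1 := (h.cap_residual (x := y) (R := P.rowView g i) (i := i) rfl rfl fun j => rfl).1
  rw [rowView_residual] at h1
  have h2 : ¬0 < P.residual y i := not_lt.2 (sub_nonpos.2 (hy i))
  exact sub_nonpos.1 (not_lt.1 fun hc => h2 (h1.1 hc))

/-- Costs are multiples of a common fraction that is not too small. -/
theorem exists_common_denominator {K : ℕ} (hw : ∀ j, IsShort K (P.w j)) :
    ∃ Q : ℕ, 0 < Q ∧ Q ≤ 2 ^ (n * K) ∧ ∀ x, ∃ N : ℕ, Q * P.cost x = N := by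
  choose p q _ hq0 hq hpq using hw
  refine ⟨∏ j, q j, Finset.prod_pos fun j _ => hq0 j, ?_, fun x => ?_⟩
  · calc ∏ j, q j ≤ ∏ _j : Fin n, 2 ^ K := Finset.prod_le_prod' fun j _ => (hq j).le
      _ = 2 ^ (n * K) := by
        rw [Finset.prod_const, Finset.card_univ, Fintype.card_fin, ← pow_mul, mul_comm]
  · refine ⟨∑ j, p j * (∏ k ∈ Finset.univ.erase j, q k) * x j, ?_⟩
    unfold cost
    rw [Finset.mul_sum]
    push_cast
    apply Finset.sum_congr rfl
    intro j _
    have h0 : (q j : ℝ) ≠ 0 := by exact_mod_cast (hq0 j).ne'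
    rw [hpq j, ← Finset.mul_prod_erase _ _ (Finset.mem_univ j)]
    field_simp

theorem InputShort.cost_cap_le {K : ℕ} (h : P.InputShort K) (y : Fin n → ℕ) :
    P.cost (fun j => min (y j) (2 ^ (2 * K))) ≤ n * 2 ^ (3 * K) := by
  unfold cost
  refine (Finset.sum_le_card_nsmul _ _ ((2 : ℝ) ^ (3 * K)) fun j _ => ?_).trans (by simp)
  have h1 := (h.2.2 j).lt.le
  have h2 : ((min (y j) (2 ^ (2 * K)) : ℕ) : ℝ) ≤ 2 ^ (2 * K) := by
    exact_mod_cast min_le_right _ _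
  calc _ ≤ (2 : ℝ) ^ K * 2 ^ (2 * K) := by gcongr
    _ = _ := by rw [← pow_add]; congr 1; ring

/-- If `ε` was enlarged, compare with the capped solution `z`, whose cost is at most `n * 2 ^ (3 *
K)`. After multiplication by a common denominator `Q ≤ 2 ^ (n * K)` the costs are integers and the
tolerance contributes less than `1`, so even the factor `rank` holds. -/
theorem InputShort.cost_le {K : ℕ} (h : P.InputShort K) (hr : 0 < P.rank) {ε : ℝ} (hε : 0 < ε)
    (a : ℕ → ℕ) (t : ℕ) {y : Fin n → ℕ} (hy : P.Feasible y) :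
    P.cost (P.bidRun (tuning n K P.rank ε) a t).x ≤ (P.rank + ε) * P.cost y := by
  have hfit := h.fits ε
  set x := (P.bidRun (tuning n K P.rank ε) a t).x with hx
  have hF : (max P.rank 1 : ℕ) = P.rank := max_eq_left hr
  have hδ := tolerance_pos n K ε
  have hr' : (0 : ℝ) < P.rank := by exact_mod_cast hr
  have key : ∀ z, P.Feasible z → P.cost x ≤ (P.rank + tolerance n K ε) * P.cost z := by
    intro z hz
    have h1 := hfit.cost_le a hz t
    have h2 : (tuning n K P.rank ε).β = tolerance n K ε / (P.rank + tolerance n K ε) := by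
      unfold tuning; simp only [hF]
    have h3 : (tuning n K P.rank ε).F = P.rank := hF
    rw [h2, h3, ← hx, one_sub_div (by positivity), add_sub_cancel_right, div_mul_eq_mul_div,
      div_le_iff₀ (by positivity), mul_assoc] at h1
    have h4 := le_of_mul_le_mul_left h1 hr'
    linarith
  rcases le_or_gt ((2 : ℝ)⁻¹ ^ (n * K + 3 * K + n)) ε with hc | hc
  · have h1 : tolerance n K ε = ε := max_eq_left hc
    have h2 := key y hy
    rwa [h1] at h2
  · have h1 : tolerance n K ε = 2⁻¹ ^ (n * K + 3 * K + n) := max_eq_right hc.le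
    set z : Fin n → ℕ := fun j => min (y j) (2 ^ (2 * K)) with hz
    have h2 := key z (hfit.feasible_cap hy)
    obtain ⟨Q, hQ0, hQ, hint⟩ := exists_common_denominator h.2.2
    obtain ⟨N, hN⟩ := hint x
    obtain ⟨N', hN'⟩ := hint z
    have hQ0' : (0 : ℝ) < Q := by exact_mod_cast hQ0
    have hQ' : (Q : ℝ) ≤ 2 ^ (n * K) := by exact_mod_cast hQ
    have hn : (n : ℝ) < 2 ^ n := by exact_mod_cast (Nat.lt_two_pow_self (n := n))
    have hsmall : Q * (tolerance n K ε * P.cost z) < 1 := by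
      have hcz := h.cost_cap_le y
      have h0 : 0 ≤ (2 : ℝ)⁻¹ ^ (n * K + 3 * K + n) * P.cost z :=
        mul_nonneg (by positivity) (P.cost_nonneg z)
      rw [h1]
      calc (Q : ℝ) * (2⁻¹ ^ (n * K + 3 * K + n) * P.cost z)
          ≤ 2 ^ (n * K) * (2⁻¹ ^ (n * K + 3 * K + n) * (n * 2 ^ (3 * K))) := by
            gcongr
        _ < 2 ^ (n * K) * (2⁻¹ ^ (n * K + 3 * K + n) * (2 ^ n * 2 ^ (3 * K))) := by
            gcongr
        _ = (2⁻¹ * 2) ^ (n * K + 3 * K + n) := by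
            rw [mul_pow, show (2 : ℝ) ^ (n * K + 3 * K + n) = 2 ^ (n * K) * (2 ^ n * 2 ^ (3 * K)) by
              rw [← pow_add, ← pow_add]; congr 1; ring]
            ring
        _ = 1 := by norm_num
    have hlt : (N : ℝ) < P.rank * N' + 1 := by
      calc (N : ℝ) = Q * P.cost x := hN.symm
        _ ≤ Q * ((P.rank + tolerance n K ε) * P.cost z) := by gcongr
        _ = P.rank * (Q * P.cost z) + Q * (tolerance n K ε * P.cost z) := by ring
        _ < P.rank * N' + 1 := by rw [hN']; linarith
    have hle : N ≤ P.rank * N' := by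
      have : N < P.rank * N' + 1 := by exact_mod_cast hlt
      omega
    have hle' : P.cost x ≤ P.rank * P.cost z := by
      have : (N : ℝ) ≤ P.rank * N' := by exact_mod_cast hle
      rw [← hN, ← hN'] at this
      refine le_of_mul_le_mul_left ?_ hQ0'
      linarith
    have hzy : P.cost z ≤ P.cost y := by
      unfold cost
      apply Finset.sum_le_sum
      intro j _
      apply mul_le_mul_of_nonneg_left _ (P.w_nonneg j)
      exact_mod_cast min_le_left _ _
    calc P.cost x ≤ P.rank * P.cost z := hle'
      _ ≤ P.rank * P.cost y := by gcongr
      _ ≤ (P.rank + ε) * P.cost y := by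
        have := P.cost_nonneg y
        gcongr
        linarith

theorem start_cost (P : CoveringILP m n) (θ : Tuning) : P.cost (P.start θ).x = 0 := by
  apply Finset.sum_eq_zero
  intro j _
  simp only [start, startValue]
  split_ifs with hw
  · rw [hw, zero_mul]
  · simp

end CoveringILP

/-! ### Conclusion -/

theorem third_le_mwhvcTime {γ f Δ ε : ℝ} (h : 0 ≤ f * Real.logb 2 (f / ε)) :
    1 / 3 ≤ mwhvcTime γ f Δ ε := by
  have h1 := third_le_div_logb (x := Δ)
  have h2 := three_halves_le_logb (x := Δ)
  have h3 : 0 ≤ min (Real.logb 2 (max 3 Δ))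
      (f * Real.logb 2 (f / ε) * Real.logb 2 (max 3 Δ) ^ γ) :=
    le_min (by linarith) (mul_nonneg h (Real.rpow_nonneg (by linarith) _))
  unfold mwhvcTime
  linarith

namespace CoveringILP

variable {n m : ℕ} {P : CoveringILP m n}

/-- The number of iterations after which the bidding process has surely ended. -/
theorem exists_feasible_time (γ : ℝ) (hγ : 0 < γ) :
    ∃ C : ℝ, 0 < C ∧ ∀ (n m : ℕ) (P : CoveringILP m n) (ε : ℝ) (K : ℕ), 0 < ε → ε ≤ 1 →
      P.InputShort K → (∃ y, P.Feasible y) → 0 < P.rank →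
      ∃ τ : ℕ, P.Feasible (P.bidRun (tuning n K P.rank ε) (raiseExp (min γ (1 / 2))) τ).x ∧
        (τ : ℝ) ≤ C * mwhvcTime γ (P.rank * (1 + Real.logb 2 P.maxRatio))
          (2 ^ P.rank * P.maxRatio * P.maxDegree) ε + 1 := by
  obtain ⟨C, hC, hmain⟩ := exists_active_time_le γ hγ
  refine ⟨C, hC, ?_⟩
  intro n m P ε K hε hε1 hP ⟨y, hy⟩ hr
  have hF : (tuning n K P.rank ε).F = P.rank := max_eq_left hr
  set T := mwhvcTime γ (P.rank * (1 + Real.logb 2 P.maxRatio))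
    (2 ^ P.rank * P.maxRatio * P.maxDegree) ε with hT
  have hM := P.one_le_maxRatio
  have hr1 : (1 : ℝ) ≤ P.rank := by exact_mod_cast hr
  have hΔ : (1 : ℝ) ≤ P.maxDegree := by
    obtain ⟨i, j, hA⟩ := exists_ne_zero_of_rank_pos hr
    have h1 : 0 < (P.col j).card := Finset.card_pos.2 ⟨i, mem_col.2 hA⟩
    exact_mod_cast h1.trans_le (P.col_card_le_maxDegree j)
  have hT0 : 0 ≤ T := by
    refine le_trans (by norm_num) (third_le_mwhvcTime ?_)
    have hl : 0 ≤ Real.logb 2 P.maxRatio := Real.logb_nonneg (by norm_num) hM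
    have h1 : 1 ≤ (P.rank : ℝ) * (1 + Real.logb 2 P.maxRatio) := by nlinarith
    refine mul_nonneg (by linarith) (Real.logb_nonneg (by norm_num) ?_)
    rw [le_div_iff₀ hε]
    linarith
  refine ⟨⌊C * T⌋₊ + 1, fun i => ?_, ?_⟩
  · by_cases hi : (P.row i).Nonempty
    · by_contra! hc
      have h1 := hmain n m P (tuning n K P.rank ε) P.maxRatio P.maxDegree ε (tolerance n K ε)
        (hP.fits ε) hε hε1 (le_max_left _ _) rfl hM (fun i j hA => P.div_le_maxRatio hA) hΔ
        (fun j => by exact_mod_cast P.col_card_le_maxDegree j) i _ hi (sub_pos.2 hc)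
      rw [hF, Real.rpow_natCast] at h1
      push_cast at h1
      have h2 := Nat.lt_floor_add_one (C * T)
      linarith
    -- An empty row is never touched by the process; feasibility of the program forces its
    -- right-hand side to be at most `0`.
    · have h0 : ∀ j, P.A i j = 0 := fun j => by
        by_contra hA
        exact hi ⟨j, mem_row.2 hA⟩
      have h1 := hy i
      simp only [h0, zero_mul, Finset.sum_const_zero] at h1 ⊢
      exact h1
  · push_cast
    have := Nat.floor_le (mul_nonneg hC.le hT0)
    linarith

end CoveringILP

end

theorem mainTheorem7 (κ : ℕ) (γ : ℝ) (hγ : 0 < γ) :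
    ∃ (B : ℕ) (C : ℝ)
      (alg : ∀ n m _f : ℕ, ∀ _ε : ℝ, CongestAlg n m (B * (Nat.log 2 (n + m) + 1))),
      ∀ (n m : ℕ) (P : CoveringILP m n) (ε : ℝ), 0 < ε → ε ≤ 1 →
        P.InputShort (κ * (Nat.log 2 (n + m) + 1)) →
        (∃ y, P.Feasible y) →
        ∃ (t : ℕ) (x : Fin n → ℕ),
          (alg n m P.rank ε).HaltsWith P t x ∧
          P.IsApprox ((P.rank : ℝ) + ε) x ∧
          (t : ℝ) ≤ C * (1 + (P.rank : ℝ) / Real.logb 2 (max 2 (n : ℝ))) *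
            mwhvcTime γ ((P.rank : ℝ) * (1 + Real.logb 2 P.maxRatio))
              (2 ^ P.rank * P.maxRatio * (P.maxDegree : ℝ)) ε ∧
          (γ ≤ 0.001 →
            (t : ℝ) ≤ C * (1 + (P.rank : ℝ) / Real.logb 2 (max 2 (n : ℝ))) *
              simplifiedTime (P.rank : ℝ) (P.maxDegree : ℝ) P.maxRatio ε) := by
  obtain ⟨C, hC, htime⟩ := CoveringILP.exists_feasible_time γ hγ
  -- The bandwidth is `4 * (2 * κ + 12)` per unit of `ℓ`, as the first message nests four numbers of
  -- `E` bits. Since the time bound `T` is at least `1 / 3`, the rounds `2 + 4 * τ ≤ 6 + 4 * C * T`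
  -- are at most `(18 + 4 * C) * T`; the `1000` is for the simplified bound.
  refine ⟨8 * κ + 48, 1000 * (18 + 4 * C), fun n m f ε => bidAlg n m _
    (tuning n (κ * (Nat.log 2 (n + m) + 1)) f ε) (raiseExp (min γ (1 / 2))), ?_⟩
  intro n m P ε hε hε1 hP hfeas
  set ℓ := Nat.log 2 (n + m) + 1 with hℓ
  have hlt : n + m < 2 ^ ℓ := Nat.lt_pow_succ_log_self (by norm_num) _
  have hbits := hP.fitsBits (by omega) (by omega) (by omega) ε (raiseExp (min γ (1 / 2)))
  have hbw : 4 * ((2 * κ + 12) * ℓ) ≤ (8 * κ + 48) * ℓ := le_of_eq (by ring)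
  have hhalts := fun τ => (hP.fits ε).haltsWith hbits hbw (t := τ)
  -- The auction does not need this factor of the claimed bound; it only has to be at least `1`.
  have hfac : 1 ≤ 1 + (P.rank : ℝ) / Real.logb 2 (max 2 (n : ℝ)) := by
    have : 0 ≤ Real.logb 2 (max 2 (n : ℝ)) :=
      Real.logb_nonneg (by norm_num) ((by norm_num : (1 : ℝ) ≤ 2).trans (le_max_left _ _))
    have := div_nonneg (Nat.cast_nonneg (α := ℝ) P.rank) this
    linarith
  have hbound : ∀ {t T : ℝ}, 0 ≤ T → t ≤ 1000 * (18 + 4 * C) * T →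
      t ≤ 1000 * (18 + 4 * C) * (1 + (P.rank : ℝ) / Real.logb 2 (max 2 (n : ℝ))) * T := by
    intro t T hT ht
    refine ht.trans (mul_le_mul_of_nonneg_right ?_ hT)
    exact le_mul_of_one_le_right (by positivity) hfac
  -- For rank `0` the matrix vanishes, so feasibility makes the start, which has cost `0`, a
  -- solution, and the two initial rounds suffice.
  rcases Nat.eq_zero_or_pos P.rank with hr | hr
  · have hA := CoveringILP.eq_zero_of_rank_eq_zero hr
    obtain ⟨y, hy⟩ := hfeas
    have hstart : P.Feasible (P.start (tuning n (κ * ℓ) P.rank ε)).x := by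
      intro i
      have h1 := hy i
      simp only [hA, zero_mul, Finset.sum_const_zero] at h1 ⊢
      exact h1
    have hbound' : ∀ {T : ℝ}, 1 / 3 ≤ T → ((2 + 4 * 0 : ℕ) : ℝ) ≤
        1000 * (18 + 4 * C) * (1 + (P.rank : ℝ) / Real.logb 2 (max 2 (n : ℝ))) * T := by
      intro T hT
      refine hbound (by linarith) ?_
      push_cast
      nlinarith
    refine ⟨2 + 4 * 0, _, hhalts 0 hstart, ⟨hstart, fun z _ => ?_⟩, ?_, fun _ => ?_⟩
    · refine (P.start_cost _).trans_le (mul_nonneg (by positivity) (P.cost_nonneg z))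
    · refine hbound' (third_le_mwhvcTime (le_of_eq ?_))
      rw [hr]
      simp
    · refine hbound' ?_
      unfold simplifiedTime
      rw [hr, Nat.cast_zero, zero_mul, Real.zero_rpow (by norm_num), zero_mul, zero_mul, add_zero]
      exact third_le_div_logb
  · obtain ⟨τ, hτ, hτT⟩ := htime n m P ε (κ * ℓ) hε hε1 hP hfeas hr
    have hM := P.one_le_maxRatio
    have hr1 : (1 : ℝ) ≤ P.rank := by exact_mod_cast hr
    have hΔ : (1 : ℝ) ≤ P.maxDegree := by
      obtain ⟨i, j, hA⟩ := CoveringILP.exists_ne_zero_of_rank_pos hr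
      have h1 : 0 < (P.col j).card := Finset.card_pos.2 ⟨i, CoveringILP.mem_col.2 hA⟩
      exact_mod_cast h1.trans_le (P.col_card_le_maxDegree j)
    have hl : 0 ≤ Real.logb 2 P.maxRatio := Real.logb_nonneg (by norm_num) hM
    have hT : 1 / 3 ≤ mwhvcTime γ (P.rank * (1 + Real.logb 2 P.maxRatio))
        (2 ^ P.rank * P.maxRatio * P.maxDegree) ε := by
      have h1 : 1 ≤ (P.rank : ℝ) * (1 + Real.logb 2 P.maxRatio) := by nlinarith
      refine third_le_mwhvcTime (mul_nonneg (by linarith) (Real.logb_nonneg (by norm_num) ?_))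
      rw [le_div_iff₀ hε]
      linarith
    set T := mwhvcTime γ (P.rank * (1 + Real.logb 2 P.maxRatio))
      (2 ^ P.rank * P.maxRatio * P.maxDegree) ε with hTdef
    have htT : ((2 + 4 * τ : ℕ) : ℝ) ≤ (18 + 4 * C) * T := by
      push_cast
      nlinarith
    refine ⟨2 + 4 * τ, _, hhalts τ hτ, ⟨hτ, fun z hz => hP.cost_le hr hε _ τ hz⟩, ?_, fun hγ1 => ?_⟩
    · refine hbound (by linarith) (htT.trans ?_)
      have : 0 ≤ (18 + 4 * C) * T := by positivity
      linarith
    · have h1 := simplifiedTime_ge hr1 hΔ hM hε hε1 hγ hγ1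
      rw [Real.rpow_natCast, ← hTdef] at h1
      refine hbound (by linarith) (htT.trans ?_)
      calc (18 + 4 * C) * T ≤ (18 + 4 * C) *
            (1000 * simplifiedTime P.rank P.maxDegree P.maxRatio ε) := by gcongr
        _ = _ := by ring
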